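/- Let $k$ be an algebraically closed field of characteristic zero, $\mathfrak g$ a Lie algebra over $k$, and $U=U(\mathfrak g)$ its universal enveloping algebra with coproduct $\Delta$ and counit $\varepsilon$ determined by $\Delta(x)=x\otimes 1+1\otimes x$, $\varepsilon(x)=0$ for $x\in\mathfrak g$. Extend $\Delta,\varepsilon$ coefficientwise to $U[[h]]$, the (completed) tensor powers of $U[[h]]$ being $(U^{\otimes n})[[h]]$. An \emph{invariant twist} on $U[[h]]$ is an invertible $F\in (U\otimes U)[[h]]$ which commutes with $\Delta(U[[h]])$ and satisfies $$(F\otimes 1)(\Delta\otimes I)(F)=(1\otimes F)(I\otimes\Delta)(F),\qquad (\varepsilon\otimes I)(F)=(I\otimes\varepsilon)(F)=1 .$$ Invariant twists form a group $P$ under multiplication. Let $C$ be the group of invertible central elements $x$ of $U[[h]]$ with $\varepsilon(x)=1$, and let $\partial:C\to P$, $\partial(x)=(x\otimes x)\Delta(x)^{-1}$; this is a homomorphism with central image, and $F,F'\in P$ are gauge equivalent (that is, $F\Delta(a)=(a\otimes a)F'$ for some $a\in C$) if and only if they have the same image in $\pi_0=P/\partial(C)$. Let $(\Lambda^2\mathfrak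 g)^{\mathfrak g}$ be the space of $\mathfrak g$-invariant skew-symmetric tensors in $\mathfrak g\otimes\mathfrak g$. Then: (1) The group $\pi_0$ of gauge classes of invariant twists on $U[[h]]$ is isomorphic to the additive group $(\Lambda^2\mathfrak g)^{\mathfrak g}[[h]]$. More precisely, for every $X\in(\Lambda^2\mathfrak g)^{\mathfrak g}[[h]]$ the exponential $\exp(hX)\in(U\otimes U)[[h]]$ is an invariant twist, and sending $X$ to the class of $\exp(hX)$ is an isomorphism of groups $(\Lambda^2\mathfrak g)^{\mathfrak g}[[h]]\to\pi_0$. (2) The associator class in $H^3(\pi_0,\ker\partial)$ (trivial action) of the crossed module $\partial:C\to P$ is trivial. That is, for every section $\sigma:\pi_0\to P$ of the projection and every map $a:\pi_0\times\pi_0\to C$ with $\sigma(fg)=\partial(a(f,g))\,\sigma(f)\,\sigma(g)$, there is a map $c:\pi_0\times\pi_0\to\ker\partial$ such that for all $f,g,l\in\pi_0$ $$a(f,gl)\,a(g,l)\,a(f,g)^{-1}\,a(fg,l)^{-1}=c(g,l)\,c(fg,l)^{-1}\,c(f,gl)\,c(f,g)^{-1}.$$ -/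

import Mathlib

open scoped TensorProduct

noncomputable section

namespace InvTwist

section Bialgebra

/-! ### Invariant twists on `H[[h]]` for a bialgebra `H` over `k`

Elements of `H[[h]]` are power series with coefficients in `H`.  The (completed) tensor powers of
`H[[h]]` over `k[[h]]` are `(H ⊗ H)[[h]]` and `(H ⊗ H ⊗ H)[[h]]`, and the structure maps are those
of `H`, applied to the coefficients. -/

variable (k : Type*) (H : Type*) [Field k] [Ring H] [Bialgebra k H]

/-- `F ↦ F ⊗ 1`. -/
def tensorOne : H ⊗[k] H →ₐ[k] H ⊗[k] (H ⊗[k] H) :=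
  (Algebra.TensorProduct.assoc k k k H H H).toAlgHom.comp Algebra.TensorProduct.includeLeft

/-- `F ↦ 1 ⊗ F`. -/
def oneTensor : H ⊗[k] H →ₐ[k] H ⊗[k] (H ⊗[k] H) :=
  Algebra.TensorProduct.includeRight

/-- `Δ ⊗ I`. -/
def comulTensor : H ⊗[k] H →ₐ[k] H ⊗[k] (H ⊗[k] H) :=
  (Algebra.TensorProduct.assoc k k k H H H).toAlgHom.comp
    (Algebra.TensorProduct.map (Bialgebra.comulAlgHom k H) (AlgHom.id k H))

/-- `I ⊗ Δ`. -/
def tensorComul : H ⊗[k] H →ₐ[k] H ⊗[k] (H ⊗[k] H) :=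
  Algebra.TensorProduct.map (AlgHom.id k H) (Bialgebra.comulAlgHom k H)

/-- `ε ⊗ I`. -/
def counitTensor : H ⊗[k] H →ₐ[k] H :=
  (Algebra.TensorProduct.lid k H).toAlgHom.comp
    (Algebra.TensorProduct.map (Bialgebra.counitAlgHom k H) (AlgHom.id k H))

/-- `I ⊗ ε`. -/
def tensorCounit : H ⊗[k] H →ₐ[k] H :=
  (Algebra.TensorProduct.rid k k H).toAlgHom.comp
    (Algebra.TensorProduct.map (AlgHom.id k H) (Bialgebra.counitAlgHom k H))

variable {k} in
/-- The extension of an algebra homomorphism to power series in `h`, coefficient by coefficient. -/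
abbrev extendh {A B : Type*} [Ring A] [Algebra k A] [Ring B] [Algebra k B] (f : A →ₐ[k] B) :
    PowerSeries A →+* PowerSeries B :=
  PowerSeries.map (f : A →+* B)

/-- The coproduct of `H[[h]]`. -/
abbrev comulh : PowerSeries H →+* PowerSeries (H ⊗[k] H) :=
  extendh (Bialgebra.comulAlgHom k H)

/-- The counit of `H[[h]]`. -/
abbrev counith : PowerSeries H →+* PowerSeries k :=
  extendh (Bialgebra.counitAlgHom k H)

variable {H}

/-- `x ⊗ x` for `x` in `H[[h]]`. -/
def tensorSelf (x : PowerSeries H) : PowerSeries (H ⊗[k] H) :=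
  extendh (Algebra.TensorProduct.includeLeft : H →ₐ[k] H ⊗[k] H) x *
    extendh (Algebra.TensorProduct.includeRight : H →ₐ[k] H ⊗[k] H) x

/-- An invariant twist on `H[[h]]` is an invertible element `F` of `(H ⊗ H)[[h]]` which commutes
with `Δ(H[[h]])`, is a 2-cocycle and is normalised. -/
structure IsInvariantTwist (F : (PowerSeries (H ⊗[k] H))ˣ) : Prop where
  invariant : ∀ x : PowerSeries H, comulh k H x * (F : PowerSeries (H ⊗[k] H)) = F * comulh k H x
  cocycle : extendh (tensorOne k H) (F : PowerSeries (H ⊗[k] H)) * extendh (comulTensor k H) F.1 =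
    extendh (oneTensor k H) F.1 * extendh (tensorComul k H) F.1
  counit_left : extendh (counitTensor k H) F.1 = 1
  counit_right : extendh (tensorCounit k H) F.1 = 1

section Commutation

variable {k}

theorem commute_of_coeff {A : Type*} [Ring A] {p q : PowerSeries A}
    (h : ∀ i j, Commute (PowerSeries.coeff i p) (PowerSeries.coeff j q)) : Commute p q := by
  refine PowerSeries.ext fun n => ?_
  rw [PowerSeries.coeff_mul, PowerSeries.coeff_mul, ← Finset.Nat.sum_antidiagonal_swap]
  exact Finset.sum_congr rfl fun x _ => (h x.2 x.1).eq

theorem coeff_commute_comul {F : PowerSeries (H ⊗[k] H)}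
    (h : ∀ x : PowerSeries H, comulh k H x * F = F * comulh k H x) (u : H) (i : ℕ) :
    Commute (Bialgebra.comulAlgHom k H u) (PowerSeries.coeff i F) := by
  have := congrArg (PowerSeries.coeff i) (h (PowerSeries.C u))
  simpa [Commute, SemiconjBy] using this

theorem commute_comulTensor {F : PowerSeries (H ⊗[k] H)}
    (h : ∀ x : PowerSeries H, comulh k H x * F = F * comulh k H x) (G : PowerSeries (H ⊗[k] H)) :
    Commute (extendh (tensorOne k H) F) (extendh (comulTensor k H) G) := by
  refine commute_of_coeff fun i j => ?_
  have key : ∀ z : H ⊗[k] H, Commute (tensorOne k H (PowerSeries.coeff i F))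
      (comulTensor k H z) := by
    intro z
    induction z with
    | zero => simp
    | add x y hx hy => rw [map_add]; exact hx.add_right hy
    | tmul u v =>
      have h1 : Commute ((PowerSeries.coeff i F) ⊗ₜ[k] (1 : H))
          ((Bialgebra.comulAlgHom k H u) ⊗ₜ[k] v) := by
        simp only [Commute, SemiconjBy, Algebra.TensorProduct.tmul_mul_tmul, one_mul, mul_one]
        rw [(coeff_commute_comul h u i).eq]
      exact h1.map (Algebra.TensorProduct.assoc k k k H H H)
  simpa using key (PowerSeries.coeff j G)

theorem commute_tensorComul {F : PowerSeries (H ⊗[k] H)}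
    (h : ∀ x : PowerSeries H, comulh k H x * F = F * comulh k H x) (G : PowerSeries (H ⊗[k] H)) :
    Commute (extendh (oneTensor k H) F) (extendh (tensorComul k H) G) := by
  refine commute_of_coeff fun i j => ?_
  have key : ∀ z : H ⊗[k] H, Commute (oneTensor k H (PowerSeries.coeff i F))
      (tensorComul k H z) := by
    intro z
    induction z with
    | zero => simp
    | add x y hx hy => rw [map_add]; exact hx.add_right hy
    | tmul u v =>
      have h1 : Commute ((1 : H) ⊗ₜ[k] (PowerSeries.coeff i F))
          (u ⊗ₜ[k] (Bialgebra.comulAlgHom k H v)) := by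
        simp only [Commute, SemiconjBy, Algebra.TensorProduct.tmul_mul_tmul, one_mul, mul_one]
        rw [(coeff_commute_comul h v i).eq]
      exact h1
  simpa using key (PowerSeries.coeff j G)

theorem coeff_central {x : PowerSeries H} (hx : x ∈ Subring.center (PowerSeries H)) (i : ℕ)
    (u : H) : Commute u (PowerSeries.coeff i x) := by
  have := congrArg (PowerSeries.coeff i) (Subring.mem_center_iff.1 hx (PowerSeries.C u))
  simpa [Commute, SemiconjBy] using this

theorem tensorSelf_central {x : PowerSeries H} (hx : x ∈ Subring.center (PowerSeries H))
    (G : PowerSeries (H ⊗[k] H)) : Commute (tensorSelf k x) G := by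
  refine Commute.mul_left (commute_of_coeff fun i j => ?_) (commute_of_coeff fun i j => ?_)
  · simp only [PowerSeries.coeff_map]
    induction PowerSeries.coeff j G with
    | zero => simp
    | add x y hx hy => exact hx.add_right hy
    | tmul u v =>
      simp [Commute, SemiconjBy, (coeff_central hx i u).eq]
  · simp only [PowerSeries.coeff_map]
    induction PowerSeries.coeff j G with
    | zero => simp
    | add x y hx hy => exact hx.add_right hy
    | tmul u v =>
      simp [Commute, SemiconjBy, (coeff_central hx i v).eq]

end Commutation

variable (H) in
/-- The group `Aut¹_Tw(H[[h]])` of invariant twists, with multiplication as the group law. -/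
def invariantTwists : Subgroup (PowerSeries (H ⊗[k] H))ˣ where
  carrier := {F | IsInvariantTwist k F}
  one_mem' := ⟨fun x => by simp, by simp, by simp, by simp⟩
  mul_mem' := by
    intro F G hF hG
    refine ⟨fun x => ?_, ?_, ?_, ?_⟩
    · rw [Units.val_mul, ← mul_assoc, hF.invariant, mul_assoc, hG.invariant, mul_assoc]
    · have h1 := (commute_comulTensor hG.invariant F.1).eq
      have h2 := (commute_tensorComul hG.invariant F.1).eq
      simp only [Units.val_mul, map_mul]
      rw [mul_assoc (extendh (tensorOne k H) F.1), ← mul_assoc (extendh (tensorOne k H) G.1), h1,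
        mul_assoc (extendh (comulTensor k H) F.1), ← mul_assoc, hF.cocycle, hG.cocycle, mul_assoc,
        mul_assoc, ← mul_assoc (extendh (tensorComul k H) F.1), ← h2, mul_assoc]
    · rw [Units.val_mul, map_mul, hF.counit_left, hG.counit_left, one_mul]
    · rw [Units.val_mul, map_mul, hF.counit_right, hG.counit_right, one_mul]
  inv_mem' := by
    intro F hF
    have inv_one : ∀ f : PowerSeries (H ⊗[k] H) →+* PowerSeries H, f F.1 = 1 → f (F⁻¹).1 = 1 := by
      intro f hf
      have := map_mul f F.1 (F⁻¹).1
      rwa [Units.mul_inv, map_one, hf, one_mul, eq_comm] at this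
    refine ⟨fun x => ?_, ?_, inv_one _ hF.counit_left, inv_one _ hF.counit_right⟩
    · exact (show Commute _ _ from hF.invariant x).units_inv_right.eq
    · have h1 := commute_comulTensor hF.invariant F.1
      have h2 := commute_tensorComul hF.invariant F.1
      let u (f : H ⊗[k] H →ₐ[k] H ⊗[k] (H ⊗[k] H)) := Units.map (extendh f).toMonoidHom F
      have e1 : u (tensorOne k H) * u (comulTensor k H) =
          u (oneTensor k H) * u (tensorComul k H) := Units.ext hF.cocycle
      have c1 : u (tensorOne k H) * u (comulTensor k H) =
        u (comulTensor k H) * u (tensorOne k H) := Units.ext h1.eq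
      have c2 : u (oneTensor k H) * u (tensorComul k H) =
        u (tensorComul k H) * u (oneTensor k H) := Units.ext h2.eq
      have e2 : (u (tensorOne k H))⁻¹ * (u (comulTensor k H))⁻¹ =
          (u (oneTensor k H))⁻¹ * (u (tensorComul k H))⁻¹ := by
        rw [← mul_inv_rev, ← mul_inv_rev, ← c1, ← c2, e1]
      exact congrArg Units.val e2

variable (H) in
/-- The group `(Z(H[[h]])_ε)ˣ` of invertible central elements of `H[[h]]` of counit `1`. -/
def centralUnits : Subgroup (PowerSeries H)ˣ where
  carrier := {x | (x : PowerSeries H) ∈ Subring.center (PowerSeries H) ∧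
    counith k H (x : PowerSeries H) = 1}
  one_mem' := ⟨Subring.one_mem _, by simp⟩
  mul_mem' := by
    rintro x y ⟨hx, hx'⟩ ⟨hy, hy'⟩
    exact ⟨Subring.mul_mem _ hx hy, by rw [Units.val_mul, map_mul, hx', hy', one_mul]⟩
  inv_mem' := by
    rintro x ⟨hx, hx'⟩
    refine ⟨Subring.mem_center_iff.2 fun g => ?_, ?_⟩
    · exact (show Commute g x.1 from Subring.mem_center_iff.1 hx g).units_inv_right.eq
    · have := map_mul (counith k H) x.1 (x⁻¹).1
      rwa [Units.mul_inv, map_one, hx', one_mul, eq_comm] at this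

variable {k} in
/-- `x ⊗ x` as an invertible element, for an invertible central `x`. -/
def tensorSelfUnit (x : centralUnits k H) : (PowerSeries (H ⊗[k] H))ˣ :=
  Units.map (extendh (Algebra.TensorProduct.includeLeft : H →ₐ[k] H ⊗[k] H)).toMonoidHom x.1 *
    Units.map (extendh (Algebra.TensorProduct.includeRight : H →ₐ[k] H ⊗[k] H)).toMonoidHom x.1

variable {k} in
/-- `Δ(x)` as an invertible element. -/
def comulUnit (x : centralUnits k H) : (PowerSeries (H ⊗[k] H))ˣ :=
  Units.map (comulh k H).toMonoidHom x.1

variable {k} in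
theorem tensorSelfUnit_commute (x : centralUnits k H) (G : (PowerSeries (H ⊗[k] H))ˣ) :
    Commute (tensorSelfUnit x) G :=
  Units.ext (tensorSelf_central x.2.1 G.1).eq

variable {k} in
theorem extendh_comp_apply {A B C : Type*} [Ring A] [Algebra k A] [Ring B] [Algebra k B]
    [Ring C] [Algebra k C] (f : A →ₐ[k] B) (g : B →ₐ[k] C) (x : PowerSeries A) :
    extendh g (extendh f x) = extendh (g.comp f) x :=
  PowerSeries.ext fun n => by simp

variable {k} in
theorem isInvariantTwist_boundary (x : centralUnits k H) :
    IsInvariantTwist k (tensorSelfUnit x * (comulUnit x)⁻¹) := by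
  have counit_aux : ∀ f : H ⊗[k] H →ₐ[k] H,
      (extendh (f.comp (Algebra.TensorProduct.includeLeft : H →ₐ[k] H ⊗[k] H)) x.1.1 *
        extendh (f.comp (Algebra.TensorProduct.includeRight : H →ₐ[k] H ⊗[k] H)) x.1.1 =
          x.1.1) →
      f.comp (Bialgebra.comulAlgHom k H) = AlgHom.id k H →
      extendh f (tensorSelfUnit x * (comulUnit x)⁻¹).1 = 1 := by
    intro f h1 h2
    have e1 : Units.map (extendh f).toMonoidHom (tensorSelfUnit x) = x.1 := by
      ext1
      simp only [tensorSelfUnit, map_mul]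
      exact (congrArg₂ (· * ·) (extendh_comp_apply _ f x.1.1)
        (extendh_comp_apply _ f x.1.1)).trans h1
    have e2 : Units.map (extendh f).toMonoidHom (comulUnit x) = x.1 := by
      ext1
      refine (extendh_comp_apply (Bialgebra.comulAlgHom k H) f x.1.1).trans ?_
      rw [h2]
      exact PowerSeries.ext fun n => by simp
    have e3 : Units.map (extendh f).toMonoidHom (tensorSelfUnit x * (comulUnit x)⁻¹) = 1 := by
      rw [map_mul, map_inv, e1, e2, mul_inv_cancel]
    exact congrArg Units.val e3
  have hε : ∀ f : H →ₐ[k] H, f = (Algebra.ofId k H).comp (Bialgebra.counitAlgHom k H) →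
      extendh f x.1.1 = 1 := by
    rintro f rfl
    rw [← extendh_comp_apply, x.2.2, map_one]
  have hid : ∀ f : H →ₐ[k] H, f = AlgHom.id k H → extendh f x.1.1 = x.1.1 := by
    rintro f rfl
    exact PowerSeries.ext fun n => by simp
  refine ⟨fun y => ?_, ?_, ?_, ?_⟩
  · refine (Commute.mul_right (tensorSelf_central x.2.1 _).symm ?_).eq
    refine Commute.units_inv_right (u := comulUnit x) ?_
    exact (show Commute y x.1.1 from Subring.mem_center_iff.1 x.2.1 y).map (comulh k H)
  · let u {A : Type _} [Ring A] [Algebra k A] (f : H →ₐ[k] A) : (PowerSeries A)ˣ :=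
      Units.map (extendh f).toMonoidHom x.1
    let inl : H →ₐ[k] H ⊗[k] H := Algebra.TensorProduct.includeLeft
    let inr : H →ₐ[k] H ⊗[k] H := Algebra.TensorProduct.includeRight
    let Δ : H →ₐ[k] H ⊗[k] H := Bialgebra.comulAlgHom k H
    let i : H →ₐ[k] H ⊗[k] (H ⊗[k] H) := Algebra.TensorProduct.includeLeft
    have expand : ∀ f : H ⊗[k] H →ₐ[k] H ⊗[k] (H ⊗[k] H),
        Units.map (extendh f).toMonoidHom (tensorSelfUnit x * (comulUnit x)⁻¹) =
          u (f.comp inl) * u (f.comp inr) * (u (f.comp Δ))⁻¹ := by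
      intro f
      have hu : ∀ g : H →ₐ[k] H ⊗[k] H,
          Units.map (extendh f).toMonoidHom (u g) = u (f.comp g) := fun g =>
        Units.ext (extendh_comp_apply g f x.1.1)
      rw [← hu, ← hu, ← hu, ← map_inv, ← map_mul, ← map_mul]
      rfl
    have a1 : (tensorOne k H).comp inl = i := by
      ext v; simp [tensorOne, inl, i, Algebra.TensorProduct.one_def]
    have a2 : (tensorOne k H).comp inr = (oneTensor k H).comp inl := by
      ext v; simp [tensorOne, oneTensor, inl, inr]
    have a3 : (comulTensor k H).comp inl = (tensorOne k H).comp Δ := by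
      ext v; simp [tensorOne, comulTensor, inl, Δ]
    have a4 : (comulTensor k H).comp inr = (oneTensor k H).comp inr := by
      ext v; simp [oneTensor, comulTensor, inr, Algebra.TensorProduct.one_def]
    have a5 : (tensorComul k H).comp inl = i := by
      ext v; simp [tensorComul, inl, i]
    have a6 : (tensorComul k H).comp inr = (oneTensor k H).comp Δ := by
      ext v; simp [tensorComul, oneTensor, inr, Δ]
    have a7 : (comulTensor k H).comp Δ = (tensorComul k H).comp Δ := by
      ext v
      exact Coalgebra.coassoc_apply v
    have comm : ∀ g : H →ₐ[k] H ⊗[k] H, Commute (u i) (u ((oneTensor k H).comp g)) := by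
      intro g
      refine Units.ext (commute_of_coeff fun m n => ?_).eq
      change Commute (i (PowerSeries.coeff m x.1.1))
        (oneTensor k H (g (PowerSeries.coeff n x.1.1)))
      simp [i, oneTensor, Commute, SemiconjBy]
    have main : Units.map (extendh (tensorOne k H)).toMonoidHom
          (tensorSelfUnit x * (comulUnit x)⁻¹) *
        Units.map (extendh (comulTensor k H)).toMonoidHom (tensorSelfUnit x * (comulUnit x)⁻¹) =
        Units.map (extendh (oneTensor k H)).toMonoidHom (tensorSelfUnit x * (comulUnit x)⁻¹) *
        Units.map (extendh (tensorComul k H)).toMonoidHom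
          (tensorSelfUnit x * (comulUnit x)⁻¹) := by
      rw [expand, expand, expand, expand, a1, a2, a3, a4, a5, a6, a7]
      have c1 := (comm inl).eq
      have c2 := (comm inr).eq
      have c3 := (comm Δ).inv_right.eq
      simp only [mul_assoc, inv_mul_cancel_left]
      rw [← mul_assoc (u ((oneTensor k H).comp Δ))⁻¹, ← c3, mul_assoc, inv_mul_cancel_left,
        ← mul_assoc (u ((oneTensor k H).comp inr)) (u i), ← c2, mul_assoc,
        ← mul_assoc (u ((oneTensor k H).comp inl)) (u i), ← c1, mul_assoc]
    exact congrArg Units.val main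
  · refine counit_aux _ ?_ ?_
    · rw [hε, hid, one_mul]
      · ext v; simp [counitTensor]
      · ext v; simp [counitTensor, Algebra.ofId_apply, Algebra.algebraMap_eq_smul_one]
    · ext v
      change TensorProduct.lid k H ((TensorProduct.map Coalgebra.counit LinearMap.id)
        (Coalgebra.comul v)) = v
      have := Coalgebra.rTensor_counit_comul (R := k) v
      rw [LinearMap.rTensor] at this
      rw [this]; simp
  · refine counit_aux _ ?_ ?_
    · rw [hid, hε, mul_one]
      · ext v; simp [tensorCounit, Algebra.ofId_apply, Algebra.algebraMap_eq_smul_one]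
      · ext v; simp [tensorCounit]
    · ext v
      change TensorProduct.rid k H ((TensorProduct.map LinearMap.id Coalgebra.counit)
        (Coalgebra.comul v)) = v
      have := Coalgebra.lTensor_counit_comul (R := k) v
      rw [LinearMap.lTensor] at this
      rw [this]; simp

variable (H) in
/-- The boundary map of the crossed module of invariant twists, `∂ x = (x ⊗ x) Δ(x)⁻¹`. -/
def boundary : centralUnits k H →* invariantTwists k H where
  toFun x := ⟨tensorSelfUnit x * (comulUnit x)⁻¹, isInvariantTwist_boundary x⟩
  map_one' := by
    ext1
    simp [tensorSelfUnit, comulUnit]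
  map_mul' x y := by
    ext1
    have h1 : tensorSelfUnit (x * y) = tensorSelfUnit x * tensorSelfUnit y := by
      ext1
      have hc : Commute (extendh (Algebra.TensorProduct.includeLeft : H →ₐ[k] H ⊗[k] H) y.1.1)
          (extendh (Algebra.TensorProduct.includeRight : H →ₐ[k] H ⊗[k] H) x.1.1) :=
        commute_of_coeff fun m n => by simp [Commute, SemiconjBy]
      change extendh _ (x.1.1 * y.1.1) * extendh _ (x.1.1 * y.1.1) =
        (extendh _ x.1.1 * extendh _ x.1.1) * (extendh _ y.1.1 * extendh _ y.1.1)
      rw [map_mul, map_mul, mul_assoc, ← mul_assoc _ (extendh _ x.1.1), hc.eq]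
      simp only [mul_assoc]
    have h2 : comulUnit (x * y) = comulUnit y * comulUnit x := by
      have hxy : x.1 * y.1 = y.1 * x.1 := Units.ext (Subring.mem_center_iff.1 y.2.1 x.1.1)
      change Units.map _ (x.1 * y.1) = _
      rw [hxy, map_mul]
      rfl
    change tensorSelfUnit (x * y) * (comulUnit (x * y))⁻¹ =
      (tensorSelfUnit x * (comulUnit x)⁻¹) * (tensorSelfUnit y * (comulUnit y)⁻¹)
    rw [h1, h2, mul_inv_rev, mul_assoc, mul_assoc, ← mul_assoc (comulUnit x)⁻¹,
      ← (tensorSelfUnit_commute y (comulUnit x)⁻¹).eq, mul_assoc]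

variable {k} in
theorem boundary_commute (x : centralUnits k H) (F : invariantTwists k H) :
    Commute (boundary k H x) F := by
  refine Subtype.ext (Commute.mul_left (tensorSelfUnit_commute x F.1) (Commute.inv_left ?_)).eq
  exact Units.ext (F.2.invariant x.1.1)

instance boundary_range_normal : (boundary k H).range.Normal := by
  refine ⟨?_⟩
  rintro _ ⟨x, rfl⟩ F
  rw [← (boundary_commute x F).eq, mul_inv_cancel_right]
  exact ⟨x, rfl⟩

variable (H) in
/-- The group `π₀` of gauge classes of invariant twists on `H[[h]]`: the cokernel of `∂`. -/
abbrev GaugeClasses : Type _ := invariantTwists k H ⧸ (boundary k H).range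

variable {k} in
/-- Two invariant twists have the same class if and only if there is a gauge transformation
between them, that is an invertible central `a` of counit `1` with `F Δ(a) = (a ⊗ a) F'`. -/
theorem gaugeClass_eq_iff (F F' : invariantTwists k H) :
    (F : GaugeClasses k H) = F' ↔ ∃ a : centralUnits k H,
      F.1.1 * comulh k H a.1.1 = tensorSelf k a.1.1 * F'.1.1 := by
  have key : ∀ a : centralUnits k H, F.1.1 * comulh k H a.1.1 = tensorSelf k a.1.1 * F'.1.1 ↔
      F = boundary k H a * F' := by
    intro a
    have h1 : F.1.1 * comulh k H a.1.1 = tensorSelf k a.1.1 * F'.1.1 ↔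
        F.1 * comulUnit a = tensorSelfUnit a * F'.1 :=
      (Units.ext_iff (u := F.1 * comulUnit a) (v := tensorSelfUnit a * F'.1)).symm
    have h2 : Commute (comulUnit a) F'.1 := Units.ext (F'.2.invariant a.1.1)
    rw [h1, ← eq_mul_inv_iff_mul_eq, mul_assoc, ← h2.inv_left.eq, ← mul_assoc, Subtype.ext_iff]
    rfl
  rw [QuotientGroup.eq]
  constructor
  · rintro ⟨x, hx⟩
    refine ⟨x⁻¹, (key _).2 ?_⟩
    have := (boundary_commute x F).eq
    rw [map_inv, eq_inv_mul_iff_mul_eq, this, hx, mul_inv_cancel_left]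
  · rintro ⟨a, ha⟩
    refine ⟨a⁻¹, ?_⟩
    rw [(key a).1 ha, map_inv, (boundary_commute a F').eq]
    group

/-- A choice of data that computes the associator of the crossed module `∂`: a section `σ` of the
projection onto `coker ∂` and a map `a` with `σ(fg) = ∂(a(f,g)) σ(f) σ(g)`. -/
structure IsAssociatorChoice (σ : GaugeClasses k H → invariantTwists k H)
    (a : GaugeClasses k H → GaugeClasses k H → centralUnits k H) : Prop where
  isSection : ∀ f, (σ f : GaugeClasses k H) = f
  boundary_eq : ∀ f g, σ (f * g) = boundary k H (a f g) * σ f * σ g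

variable (H) in
/-- The associator class in `H³(coker ∂, ker ∂)` is trivial.  The action of invariant twists on
`centralUnits` is trivial, so the class is represented by the cochain
`a(f,gh) a(g,h) a(f,g)⁻¹ a(fg,h)⁻¹`, and it is trivial if this cochain is the coboundary of a
2-cochain `c` with values in `ker ∂`.  As the class does not depend on the choice of `σ` and `a`,
this is required for every choice. -/
def AssociatorTrivial : Prop :=
  ∀ (σ : GaugeClasses k H → invariantTwists k H)
    (a : GaugeClasses k H → GaugeClasses k H → centralUnits k H), IsAssociatorChoice k σ a →
    ∃ c : GaugeClasses k H → GaugeClasses k H → (boundary k H).ker, ∀ f g l,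
      a f (g * l) * a g l * (a f g)⁻¹ * (a (f * g) l)⁻¹ =
        ((c g l * (c (f * g) l)⁻¹ * c f (g * l) * (c f g)⁻¹ : (boundary k H).ker) :
          centralUnits k H)

end Bialgebra

section Enveloping

/-! ### The bialgebra `U(g)` and invariant bivectors -/

variable (k : Type*) (g : Type*) [Field k] [LieRing g] [LieAlgebra k g]

attribute [local instance 100] LieRing.ofAssociativeRing

/-- The coproduct of `U(g)`, determined by `Δ(x) = x ⊗ 1 + 1 ⊗ x` for `x` in `g`. -/
def envComul : UniversalEnvelopingAlgebra k g →ₐ[k]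
    UniversalEnvelopingAlgebra k g ⊗[k] UniversalEnvelopingAlgebra k g :=
  UniversalEnvelopingAlgebra.lift k
    { toFun := fun x =>
        UniversalEnvelopingAlgebra.ι k x ⊗ₜ 1 + 1 ⊗ₜ UniversalEnvelopingAlgebra.ι k x
      map_add' := fun x y => by
        simp only [map_add, TensorProduct.add_tmul, TensorProduct.tmul_add]; abel
      map_smul' := fun c x => by
        simp only [map_smul, RingHom.id_apply, smul_add, TensorProduct.smul_tmul',
          TensorProduct.tmul_smul]
      map_lie' := fun {x y} => by
        simp only [LieHom.map_lie, LieRing.of_associative_ring_bracket, TensorProduct.sub_tmul,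
          TensorProduct.tmul_sub, add_mul, mul_add, Algebra.TensorProduct.tmul_mul_tmul,
          one_mul, mul_one]
        abel }

/-- The counit of `U(g)`, determined by `ε(x) = 0` for `x` in `g`. -/
def envCounit : UniversalEnvelopingAlgebra k g →ₐ[k] k :=
  UniversalEnvelopingAlgebra.lift k 0

variable {g} in
theorem env_algHom_ext {A : Type*} [Ring A] [Algebra k A]
    {f f' : UniversalEnvelopingAlgebra k g →ₐ[k] A}
    (h : ∀ x : g, f (UniversalEnvelopingAlgebra.ι k x) = f' (UniversalEnvelopingAlgebra.ι k x)) :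
    f = f' :=
  UniversalEnvelopingAlgebra.hom_ext k (LieHom.ext h)

variable {g} in
theorem envComul_ι (x : g) : envComul k g (UniversalEnvelopingAlgebra.ι k x) =
    UniversalEnvelopingAlgebra.ι k x ⊗ₜ 1 + 1 ⊗ₜ UniversalEnvelopingAlgebra.ι k x :=
  UniversalEnvelopingAlgebra.lift_ι_apply k _ x

variable {g} in
theorem envCounit_ι (x : g) : envCounit k g (UniversalEnvelopingAlgebra.ι k x) = 0 :=
  UniversalEnvelopingAlgebra.lift_ι_apply k _ x

instance envBialgebra : Bialgebra k (UniversalEnvelopingAlgebra k g) :=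
  Bialgebra.ofAlgHom (envComul k g) (envCounit k g)
    (by
      refine env_algHom_ext k fun x => ?_
      change Algebra.TensorProduct.assoc k k k _ _ _ (Algebra.TensorProduct.map (envComul k g)
        (.id k _) (envComul k g (UniversalEnvelopingAlgebra.ι k x))) =
          Algebra.TensorProduct.map (.id k _) (envComul k g)
            (envComul k g (UniversalEnvelopingAlgebra.ι k x))
      simp only [envComul_ι, map_add, Algebra.TensorProduct.map_tmul, map_one, AlgHom.id_apply,
        TensorProduct.add_tmul, TensorProduct.tmul_add, Algebra.TensorProduct.assoc_tmul,
        Algebra.TensorProduct.one_def]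
      abel)
    (by
      refine env_algHom_ext k fun x => ?_
      change Algebra.TensorProduct.map (envCounit k g) (.id k _)
        (envComul k g (UniversalEnvelopingAlgebra.ι k x)) =
          (Algebra.TensorProduct.lid k _).symm (UniversalEnvelopingAlgebra.ι k x)
      simp [envComul_ι, envCounit_ι, -UniversalEnvelopingAlgebra.ι_apply])
    (by
      refine env_algHom_ext k fun x => ?_
      change Algebra.TensorProduct.map (.id k _) (envCounit k g)
        (envComul k g (UniversalEnvelopingAlgebra.ι k x)) =
          (Algebra.TensorProduct.rid k k _).symm (UniversalEnvelopingAlgebra.ι k x)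
      simp [envComul_ι, envCounit_ι, -UniversalEnvelopingAlgebra.ι_apply])

/-- The space `(Λ²g)^g` of `g`-invariant skew-symmetric tensors in `g ⊗ g`. -/
def invariantBivectors : Submodule k (g ⊗[k] g) :=
  (LieModule.maxTrivSubmodule k g (g ⊗[k] g)).toSubmodule ⊓
    LinearMap.ker ((TensorProduct.comm k g g).toLinearMap + LinearMap.id)

/-- The additive group `(Λ²g)^g[[h]]`: the formal series `∑ Xₙ hⁿ` is the sequence of its
coefficients. -/
abbrev InvariantBivectorSeries : Type _ := ℕ → invariantBivectors k g

variable {k g} in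
/-- The series `h X = ∑ Xₙ hⁿ⁺¹` in `(U(g) ⊗ U(g))[[h]]`, for `X = ∑ Xₙ hⁿ` in `(Λ²g)^g[[h]]`. -/
def hMul (X : InvariantBivectorSeries k g) :
    PowerSeries (UniversalEnvelopingAlgebra k g ⊗[k] UniversalEnvelopingAlgebra k g) :=
  PowerSeries.X * PowerSeries.mk fun n =>
    TensorProduct.map (LieHom.toLinearMap (UniversalEnvelopingAlgebra.ι k))
      (LieHom.toLinearMap (UniversalEnvelopingAlgebra.ι k)) (X n : g ⊗[k] g)

/-- The exponential `∑ Yᵐ / m!` of a power series `Y` without constant term.  As `Yᵐ` is divisible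
by `hᵐ`, only the terms with `m ≤ n` contribute to the coefficient of `hⁿ`. -/
def exph {A : Type*} [Ring A] [Algebra k A] (Y : PowerSeries A) : PowerSeries A :=
  PowerSeries.mk fun n =>
    ∑ m ∈ Finset.range (n + 1), ((m.factorial : k)⁻¹) • PowerSeries.coeff n (Y ^ m)

end Enveloping

end InvTwist

end

noncomputable section

namespace InvTwist

/-! ### Exponential and logarithm of noncommutative power series -/

section Exponential

open PowerSeries Finset

variable {k : Type*} [Field k] {A : Type*} [Ring A] [Algebra k A]

/-! Taking logarithms linearises the problem. If `F = exp(Y)` is invariant, then `F ⊗ 1` commutes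
with `(Δ ⊗ I)(F)` and `1 ⊗ F` with `(I ⊗ Δ)(F)`, so the twist equation for `F` says exactly that
every coefficient of `Y` is an additive 2-cocycle of the cobar complex of `U`
(`isInvariantTwist_exphUnit`, `coeff_mem_invCocycles`). Every invariant twist has such a logarithm:
its constant term is a unit of `U ⊗ U`, hence a scalar (`PrimGen.exists_smul_one_of_mul_eq_one`),
and the counit makes it `1`.

Invariant cocycles are computed by splitting them under the flip. A symmetric one is the coboundary
of a central element, because the Adams operation `u ↦ u₁u₂` acts by 2 on it modulo coboundaries,
but by a different power of 2 on its leading part (`PrimGen.exists_cobd_eq`). A skew one is additive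
in each argument, so it lies in primitives ⊗ primitives, which is `g ⊗ g` (`exists_envι₂_eq`).
Exponentiating central elements turns additive coboundaries into values of `∂`. Thus each twist is
`∂(c) exp(hX)`, and the flip, which fixes boundaries and inverts `exp(hX)`, gives uniqueness of `X`.

Multiplicativity rests on one identity: for invariant bivectors `X = ∑ a ⊗ b`, `Y = ∑ c ⊗ d` the
tensor `∑ a ⊗ [b,c] ⊗ d` is symmetric, and a third of its product in `U` is a central element with
coboundary `[X, Y]` (`cobd_cubic`). Hence `[hX, hY]` commutes with `hX` and `hY`, the
Baker–Campbell–Hausdorff series stops after one bracket, and `exp(hX) exp(hY)` equals `exp(h(X+Y))`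
up to a boundary. The central correction is the exponential of a biadditive map, so it is a
2-cocycle, and the associator is trivial for this choice and therefore for every choice.

The structure of `U(g)` comes from the filtration by products of elements of `g` and the eigenvalues
of Adams operations on it. The embedding of `g` in `U(g)` is proved for free Lie algebras by means
of the Euler derivation and then passed to quotients. -/

theorem coeff_pow_eq_zero {Y : PowerSeries A} (hY : constantCoeff Y = 0) {m n : ℕ} (h : n < m) :
    coeff n (Y ^ m) = 0 := by
  induction m generalizing n with
  | zero => omega
  | succ m ih =>
    rw [pow_succ, coeff_mul]
    refine sum_eq_zero fun x hx => ?_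
    have hx := HasAntidiagonal.mem_antidiagonal.1 hx
    rcases Nat.eq_zero_or_pos x.2 with h0 | h0
    · rw [h0, coeff_zero_eq_constantCoeff_apply, hY, mul_zero]
    · rw [ih (by omega), zero_mul]

theorem coeff_exph (Y : PowerSeries A) (n : ℕ) :
    coeff n (exph k Y) = ∑ m ∈ range (n + 1), ((m.factorial : k)⁻¹) • coeff n (Y ^ m) := by
  simp [exph]

/-- Gives all coefficients below `N` the same summation range, so that it can be interchanged with
sums over antidiagonals. -/
theorem coeff_exph_of_lt {Y : PowerSeries A} (hY : constantCoeff Y = 0) {n N : ℕ} (h : n < N) :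
    coeff n (exph k Y) = ∑ m ∈ range N, ((m.factorial : k)⁻¹) • coeff n (Y ^ m) := by
  rw [coeff_exph]
  refine sum_subset (range_subset_range.2 h) fun m _ hm => ?_
  rw [coeff_pow_eq_zero hY (by simpa using hm), smul_zero]

theorem constantCoeff_exph (Y : PowerSeries A) : constantCoeff (exph k Y) = 1 := by
  rw [← coeff_zero_eq_constantCoeff_apply, coeff_exph]
  simp

theorem exph_zero : exph k (0 : PowerSeries A) = 1 := by
  ext n
  rw [coeff_exph, sum_eq_single 0]
  · simp
  · intro m _ hm
    simp [hm]
  · simp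

theorem map_exph {B : Type*} [Ring B] [Algebra k B] (f : A →ₐ[k] B) (Y : PowerSeries A) :
    extendh f (exph k Y) = exph k (extendh f Y) := by
  ext n
  simp only [coeff_exph, coeff_map, ← map_pow, AlgHom.coe_toRingHom, map_sum, map_smul]

theorem commute_exph {Y Z : PowerSeries A} (hY : constantCoeff Y = 0) (h : Commute Z Y) :
    Commute Z (exph k Y) := by
  ext n
  have e : ∀ x ∈ antidiagonal n, coeff x.1 Z * coeff x.2 (exph k Y) =
      ∑ m ∈ range (n + 1), ((m.factorial : k)⁻¹) • (coeff x.1 Z * coeff x.2 (Y ^ m)) := by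
    intro x hx
    rw [coeff_exph_of_lt hY (N := n + 1)
      (by have := HasAntidiagonal.mem_antidiagonal.1 hx; omega), mul_sum]
    simp
  have e' : ∀ x ∈ antidiagonal n, coeff x.1 (exph k Y) * coeff x.2 Z =
      ∑ m ∈ range (n + 1), ((m.factorial : k)⁻¹) • (coeff x.1 (Y ^ m) * coeff x.2 Z) := by
    intro x hx
    rw [coeff_exph_of_lt hY (N := n + 1)
      (by have := HasAntidiagonal.mem_antidiagonal.1 hx; omega), sum_mul]
    simp
  rw [coeff_mul, coeff_mul, sum_congr rfl e, sum_congr rfl e', sum_comm,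
    sum_comm (s := antidiagonal n)]
  refine sum_congr rfl fun m _ => ?_
  rw [← smul_sum, ← smul_sum, ← coeff_mul, ← coeff_mul, (h.pow_right m).eq]

/-- Only the two end terms of the antidiagonal involve degree `n`; all the others agree. This is the
first variation of a product. -/
theorem coeff_mul_sub_coeff_mul {F F' G G' : PowerSeries A} {n : ℕ} (hn : n ≠ 0)
    (h : ∀ i < n, coeff i F = coeff i G) (h' : ∀ i < n, coeff i F' = coeff i G') :
    coeff n (F * F') - coeff n (G * G') =
      (coeff n F - coeff n G) * constantCoeff F' + constantCoeff F * (coeff n F' - coeff n G') := by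
  obtain ⟨n, rfl⟩ := Nat.exists_eq_succ_of_ne_zero hn
  have h0 : constantCoeff F' = constantCoeff G' := by
    simpa using h' 0 (by omega)
  have h1 : constantCoeff F = constantCoeff G := by
    simpa using h 0 (by omega)
  rw [coeff_mul, coeff_mul, Nat.sum_antidiagonal_succ, Nat.sum_antidiagonal_succ,
    Nat.sum_antidiagonal_eq_sum_range_succ_mk, Nat.sum_antidiagonal_eq_sum_range_succ_mk,
    sum_range_succ, sum_range_succ]
  have : ∑ x ∈ range n, coeff (x + 1) F * coeff (n - x) F' =
      ∑ x ∈ range n, coeff (x + 1) G * coeff (n - x) G' := by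
    refine sum_congr rfl fun x hx => ?_
    rw [mem_range] at hx
    rw [h _ (by omega), h' _ (by omega)]
  simp only [this, coeff_zero_eq_constantCoeff, Nat.sub_self, h0, h1]
  noncomm_ring

/-- In a power with at least two factors the coefficient of `h^n` in `Y` only occurs next to a
constant term, which is zero. -/
theorem coeff_pow_congr {Y Z : PowerSeries A} {n : ℕ} (hY : constantCoeff Y = 0)
    (h : ∀ i < n, coeff i Y = coeff i Z) (hn : n ≠ 0) {m : ℕ} (hm : m ≠ 1) :
    coeff n (Y ^ m) = coeff n (Z ^ m) := by
  have hlow : ∀ j : ℕ, ∀ i < n, coeff i (Y ^ j) = coeff i (Z ^ j) := by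
    intro j
    induction j with
    | zero => simp
    | succ j ih =>
      intro i hi
      rw [pow_succ, pow_succ, coeff_mul, coeff_mul]
      refine sum_congr rfl fun x hx => ?_
      have hx := HasAntidiagonal.mem_antidiagonal.1 hx
      rw [ih _ (by omega), h _ (by omega)]
  rcases m with _ | _ | m
  · simp
  · simp at hm
  · rw [← sub_eq_zero, pow_succ Y, pow_succ Z, coeff_mul_sub_coeff_mul hn (hlow _) h, hY]
    simp [hY]

/-- Only the linear term of the exponential sees a change at `h^n`. The existence and uniqueness of
logarithms, and the inductive study of the logarithm of a twist, rest on this. -/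
theorem coeff_exph_sub {Y Z : PowerSeries A} {n : ℕ} (hY : constantCoeff Y = 0)
    (h : ∀ i < n, coeff i Y = coeff i Z) (hn : n ≠ 0) :
    coeff n (exph k Y) - coeff n (exph k Z) = coeff n Y - coeff n Z := by
  rw [coeff_exph, coeff_exph, ← sum_sub_distrib, sum_eq_single 1]
  · simp
  · intro m _ hm
    rw [coeff_pow_congr hY h hn hm, sub_self]
  · intro h1
    simp at h1
    omega

theorem coeff_exph_congr {Y Z : PowerSeries A} {n : ℕ} (hY : constantCoeff Y = 0)
    (h : ∀ i < n, coeff i Y = coeff i Z) : ∀ i < n, coeff i (exph k Y) = coeff i (exph k Z) := by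
  intro i hi
  rcases Nat.eq_zero_or_pos i with rfl | h0
  · simp [coeff_zero_eq_constantCoeff, constantCoeff_exph]
  · rw [← sub_eq_zero, coeff_exph_sub hY (fun j hj => h j (by omega)) (by omega), h i hi, sub_self]

theorem exph_injective {Y Z : PowerSeries A} (hY : constantCoeff Y = 0) (hZ : constantCoeff Z = 0)
    (h : exph k Y = exph k Z) : Y = Z := by
  ext n
  induction n using Nat.strong_induction_on with
  | _ n ih =>
    rcases Nat.eq_zero_or_pos n with rfl | h0
    · simp [hY, hZ]
    · rw [← sub_eq_zero, ← coeff_exph_sub (k := k) hY ih (by omega), h, sub_self]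

variable (k) in
/-- The coefficients of the logarithm of a power series with constant term `1`. -/
def logCoeff (F : PowerSeries A) (n : ℕ) : A :=
  if n = 0 then 0 else
    coeff n F - coeff n (exph k (PowerSeries.mk fun i => if _h : i < n then logCoeff F i else 0))

/-- The recursion in `logCoeff` adds at each degree the error left by the exponential of the
truncation, and by `coeff_exph_sub` this corrects that degree exactly. -/
theorem exists_exph_eq {F : PowerSeries A} (hF : constantCoeff F = 1) :
    ∃ Y : PowerSeries A, constantCoeff Y = 0 ∧ exph k Y = F := by
  have h0 : constantCoeff (PowerSeries.mk (logCoeff k F)) = 0 := by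
    rw [← coeff_zero_eq_constantCoeff_apply, coeff_mk, logCoeff, if_pos rfl]
  refine ⟨PowerSeries.mk (logCoeff k F), h0, ?_⟩
  ext n
  rcases Nat.eq_zero_or_pos n with rfl | hn
  · simp [coeff_zero_eq_constantCoeff, constantCoeff_exph, hF]
  · have := coeff_exph_sub (k := k) (Y := PowerSeries.mk (logCoeff k F))
      (Z := PowerSeries.mk fun i => if _h : i < n then logCoeff k F i else 0) (n := n) h0
      (fun i hi => by simp [hi]) (by omega)
    rw [coeff_mk, coeff_mk, dif_neg (lt_irrefl n), sub_zero, logCoeff.eq_1 k F n,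
      if_neg (by omega)] at this
    exact sub_left_injective this

/-- The formal derivative of a power series with coefficients in a noncommutative ring. -/
def deriv (f : PowerSeries A) : PowerSeries A :=
  PowerSeries.mk fun n => ((n : ℕ) + 1 : A) * coeff (n + 1) f

theorem coeff_deriv (f : PowerSeries A) (n : ℕ) :
    coeff n (deriv f) = ((n : ℕ) + 1 : A) * coeff (n + 1) f := by simp [deriv]

theorem deriv_add (f g : PowerSeries A) : deriv (f + g) = deriv f + deriv g := by
  ext n; simp [coeff_deriv, mul_add]

theorem deriv_mul (f g : PowerSeries A) : deriv (f * g) = deriv f * g + f * deriv g := by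
  ext n
  rw [map_add, coeff_deriv, coeff_mul, coeff_mul, coeff_mul]
  have h1 : ∑ p ∈ antidiagonal (n + 1), (p.1 : A) * (coeff p.1 f * coeff p.2 g) =
      ∑ p ∈ antidiagonal n, coeff p.1 (deriv f) * coeff p.2 g := by
    rw [Nat.sum_antidiagonal_succ]
    simp [coeff_deriv, mul_assoc]
  have h2 : ∑ p ∈ antidiagonal (n + 1), (p.2 : A) * (coeff p.1 f * coeff p.2 g) =
      ∑ p ∈ antidiagonal n, coeff p.1 f * coeff p.2 (deriv g) := by
    rw [Nat.sum_antidiagonal_succ']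
    simp only [coeff_deriv, Nat.cast_zero, zero_mul, zero_add, Nat.cast_add, Nat.cast_one]
    refine sum_congr rfl fun x _ => ?_
    have := (Nat.cast_commute (x.2 + 1) (coeff x.1 f)).eq
    push_cast at this
    rw [← mul_assoc, this, mul_assoc]
  rw [← h1, ← h2, ← sum_add_distrib, mul_sum]
  refine sum_congr rfl fun x hx => ?_
  rw [← add_mul, ← Nat.cast_add, HasAntidiagonal.mem_antidiagonal.1 hx]
  simp

theorem deriv_pow_succ {Y : PowerSeries A} (h : Commute (deriv Y) Y) (m : ℕ) :
    deriv (Y ^ (m + 1)) = ((m : ℕ) + 1 : k) • (deriv Y * Y ^ m) := by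
  induction m with
  | zero => simp
  | succ m ih =>
    rw [pow_succ, deriv_mul, ih, (h.pow_right (m + 1)).symm.eq, smul_mul_assoc, mul_assoc,
      ← pow_succ]
    push_cast
    module

theorem deriv_exph [CharZero k] {Y : PowerSeries A} (hY : constantCoeff Y = 0)
    (h : Commute (deriv Y) Y) : deriv (exph k Y) = deriv Y * exph k Y := by
  ext n
  have e : ∀ x ∈ antidiagonal n, coeff x.1 (deriv Y) * coeff x.2 (exph k Y) =
      ∑ m ∈ range (n + 1), ((m.factorial : k)⁻¹) • (coeff x.1 (deriv Y) * coeff x.2 (Y ^ m)) := by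
    intro x hx
    rw [coeff_exph_of_lt hY (N := n + 1)
      (by have := HasAntidiagonal.mem_antidiagonal.1 hx; omega), mul_sum]
    simp
  rw [coeff_deriv, coeff_exph, mul_sum, coeff_mul, sum_congr rfl e, sum_comm, sum_range_succ',
    pow_zero, coeff_one, if_neg (by omega), smul_zero, mul_zero, add_zero]
  refine sum_congr rfl fun m _ => ?_
  rw [← smul_sum, ← coeff_mul, mul_smul_comm, ← coeff_deriv, deriv_pow_succ (k := k) h,
    coeff_smul, smul_smul]
  congr 1
  rw [Nat.factorial_succ]
  have : ((m : k) + 1) ≠ 0 := by exact_mod_cast Nat.succ_ne_zero m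
  have : (m.factorial : k) ≠ 0 := by exact_mod_cast Nat.factorial_ne_zero m
  push_cast
  field_simp

/-- A linear equation `F' = P F` determines each coefficient from the lower ones, after division by
`n + 1`. -/
theorem eq_of_deriv_eq [CharZero k] {F G P : PowerSeries A} (h0 : constantCoeff F = constantCoeff G)
    (hF : deriv F = P * F) (hG : deriv G = P * G) : F = G := by
  ext n
  induction n using Nat.strong_induction_on with
  | _ n ih =>
    rcases n with _ | n
    · simpa using h0
    · have h1 : coeff n (deriv F) = coeff n (deriv G) := by
        rw [hF, hG, coeff_mul, coeff_mul]
        refine sum_congr rfl fun x hx => ?_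
        rw [ih x.2 (by have := HasAntidiagonal.mem_antidiagonal.1 hx; omega)]
      rw [coeff_deriv, coeff_deriv] at h1
      have h2 : ∀ a : A, ((n : ℕ) + 1 : A) * a = ((n : k) + 1) • a := by
        intro a
        rw [Algebra.smul_def]
        simp
      rw [h2, h2] at h1
      have : ((n : k) + 1) ≠ 0 := by exact_mod_cast Nat.succ_ne_zero n
      exact smul_right_injective _ this h1

/-- The product of exponentials of constants times the variable whose commutator commutes with
both. -/
theorem exph_X_mul_exph_X [CharZero k] (x y : A) (hx : Commute (x * y - y * x) x)
    (hy : Commute (x * y - y * x) y) :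
    exph k (C x * X) * exph k (C y * X) =
      exph k (C (x + y) * X + C ((2 : k)⁻¹ • (x * y - y * x)) * X ^ 2) := by
  set w := x * y - y * x with hw
  have hz : ∀ a : A, constantCoeff (C a * X : PowerSeries A) = 0 := fun a => by simp
  have hd : ∀ a : A, deriv (C a * X : PowerSeries A) = C a := by
    intro a
    ext n
    rcases n with _ | n <;> simp [coeff_deriv, coeff_C]
  have hd2 : deriv (C ((2 : k)⁻¹ • w) * X ^ 2 : PowerSeries A) = C w * X := by
    ext n
    rcases n with _ | _ | n
    · simp [coeff_deriv, coeff_X_pow]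
    · simp [coeff_deriv, coeff_X_pow]
      have : ((1 : A) + 1) = algebraMap k A 2 := by
        rw [map_ofNat]; norm_num
      rw [this, ← Algebra.smul_def, smul_smul, inv_mul_cancel₀ two_ne_zero, one_smul]
    · simp [coeff_deriv, coeff_X_pow]
  have hC : ∀ {a b : A}, Commute a b → Commute (C a : PowerSeries A) (C b) := fun h => h.map C
  have hCX : ∀ {a b : A}, Commute a b → Commute (C a : PowerSeries A) (C b * X) := fun h =>
    (hC h).mul_right (commute_X _)
  -- Conjugation of `y` by `exp(xh)`: the series stops at `y + wh` because `w = [x, y]` commutes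
  -- with `x`.
  have key : exph k (C x * X) * C y = (C y + C w * X) * exph k (C x * X) := by
    ext n
    have hp : ∀ m : ℕ, x ^ (m + 1) * y = y * x ^ (m + 1) + ((m : k) + 1) • (w * x ^ m) := by
      have hxy : x * y = y * x + w := by rw [hw]; abel
      intro m
      induction m with
      | zero => simp [hxy]
      | succ m ih =>
        rw [pow_succ', mul_assoc, ih, mul_add, ← mul_assoc, hxy, mul_smul_comm, ← mul_assoc x w,
          ← hx.eq, mul_assoc w x, ← pow_succ', add_mul, mul_assoc y x, ← pow_succ']
        push_cast
        module
    have hco : ∀ n, coeff n (exph k (C x * X)) = ((n.factorial : k)⁻¹) • x ^ n := by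
      intro n
      have hcm : ∀ m, (C x * X : PowerSeries A) ^ m = C (x ^ m) * X ^ m := by
        intro m
        rw [(commute_X (C x)).mul_pow, map_pow]
      rw [coeff_exph, sum_eq_single n]
      · rw [hcm, coeff_C_mul, coeff_X_pow, if_pos rfl, mul_one]
      · intro m _ hm
        rw [hcm, coeff_C_mul, coeff_X_pow, if_neg (Ne.symm hm), mul_zero, smul_zero]
      · simp
    rw [add_mul, map_add, coeff_C_mul, coeff_mul_C, mul_assoc, ← (commute_X (exph k (C x * X))).eq,
      coeff_C_mul]
    rcases n with _ | n
    · simp [hco]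
    · rw [coeff_succ_mul_X, hco, hco, smul_mul_assoc, hp, smul_add, mul_smul_comm, mul_smul_comm,
        smul_smul]
      congr 2
      rw [Nat.factorial_succ]
      have : ((n : k) + 1) ≠ 0 := by exact_mod_cast Nat.succ_ne_zero n
      have : (n.factorial : k) ≠ 0 := by exact_mod_cast Nat.factorial_ne_zero n
      push_cast
      field_simp
  have hxy : Commute w (x + y) := hx.add_right hy
  have hZ : deriv (C (x + y) * X + C ((2 : k)⁻¹ • w) * X ^ 2 : PowerSeries A) =
      C (x + y) + C w * X := by rw [deriv_add, hd, hd2]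
  -- Both sides solve `F' = (x + y + wh) F` with constant term 1.
  refine eq_of_deriv_eq (k := k) (P := C (x + y) + C w * X) ?_ ?_ ?_
  · simp [constantCoeff_exph]
  · rw [deriv_mul, deriv_exph (hz _) (by rw [hd]; exact hCX (Commute.refl _)),
      deriv_exph (hz _) (by rw [hd]; exact hCX (Commute.refl _)), hd, hd, ← mul_assoc, key, map_add]
    noncomm_ring
  -- On the right the exponent commutes with its derivative, since `w` commutes with `x + y`.
  · have hc : Commute (C (x + y) + C w * X : PowerSeries A)
        (C (x + y) * X + C ((2 : k)⁻¹ • w) * X ^ 2) := by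
      have hw' : Commute ((2 : k)⁻¹ • w) (x + y) := hxy.smul_left _
      have hw'' : Commute w ((2 : k)⁻¹ • w) := (Commute.refl w).smul_right _
      have hX : ∀ f : PowerSeries A, Commute f X := fun f => commute_X f
      refine Commute.add_left ?_ (Commute.mul_left ?_ (hX _).symm) <;>
        refine Commute.add_right (Commute.mul_right ?_ (hX _))
          (Commute.mul_right ?_ ((hX _).pow_right 2))
      exacts [Commute.refl _, hC hw'.symm, hC hxy, hC hw'']
    rw [deriv_exph (by simp) (by rw [hZ]; exact hc), hZ]

variable (A) in
/-- The substitution of the inner variable for the outer one in an iterated power series. -/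
def diagonal : PowerSeries (PowerSeries A) →+* PowerSeries A where
  toFun f := PowerSeries.mk fun n => ∑ p ∈ antidiagonal n, coeff p.2 (coeff p.1 f)
  map_zero' := by ext n; simp
  map_add' f g := by ext n; simp [sum_add_distrib]
  map_one' := by
    ext n
    rw [coeff_mk, sum_eq_single (0, n)]
    · simp
    · intro p hp h
      rw [coeff_one, if_neg, map_zero]
      intro h0
      refine h (Prod.ext h0 ?_)
      have := HasAntidiagonal.mem_antidiagonal.1 hp
      simp only at *
      omega
    · simp
  map_mul' f g := by
    ext n
    simp only [coeff_mul, coeff_mk, map_sum, sum_mul_sum]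
    simp only [sum_sigma']
    -- The degrees form a 2 × 2 array, summed by rows on one side and by columns on the other.
    -- Transposition is an involution, so the same map serves as its inverse.
    refine sum_nbij'
      (fun s => ⟨(s.2.1.1 + s.2.2.1, s.2.1.2 + s.2.2.2), (s.2.1.1, s.2.2.1), (s.2.1.2, s.2.2.2)⟩)
      (fun s => ⟨(s.2.1.1 + s.2.2.1, s.2.1.2 + s.2.2.2), (s.2.1.1, s.2.2.1), (s.2.1.2, s.2.2.2)⟩)
      ?_ ?_ ?_ ?_ ?_
    · rintro ⟨⟨p, q⟩, ⟨⟨a, b⟩, ⟨c, d⟩⟩⟩ h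
      simp only [mem_sigma, HasAntidiagonal.mem_antidiagonal] at h ⊢
      exact ⟨by omega, trivial, trivial⟩
    · rintro ⟨⟨p, q⟩, ⟨⟨a, b⟩, ⟨c, d⟩⟩⟩ h
      simp only [mem_sigma, HasAntidiagonal.mem_antidiagonal] at h ⊢
      exact ⟨by omega, trivial, trivial⟩
    · rintro ⟨⟨p, q⟩, ⟨⟨a, b⟩, ⟨c, d⟩⟩⟩ h
      simp only [mem_sigma, HasAntidiagonal.mem_antidiagonal] at h ⊢
      obtain ⟨-, rfl, rfl⟩ := h
      rfl
    · rintro ⟨⟨p, q⟩, ⟨⟨a, b⟩, ⟨c, d⟩⟩⟩ h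
      simp only [mem_sigma, HasAntidiagonal.mem_antidiagonal] at h ⊢
      obtain ⟨-, rfl, rfl⟩ := h
      rfl
    · rintro ⟨⟨p, q⟩, ⟨⟨a, b⟩, ⟨c, d⟩⟩⟩ h
      rfl

theorem coeff_diagonal (f : PowerSeries (PowerSeries A)) (n : ℕ) :
    coeff n (diagonal A f) = ∑ p ∈ antidiagonal n, coeff p.2 (coeff p.1 f) := by
  simp [diagonal]

theorem diagonal_C (f : PowerSeries A) : diagonal A (C f) = f := by
  ext n
  rw [coeff_diagonal, sum_eq_single (0, n)]
  · simp
  · intro p hp h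
    rw [coeff_C, if_neg, map_zero]
    intro h0
    refine h (Prod.ext h0 ?_)
    have := HasAntidiagonal.mem_antidiagonal.1 hp
    simp only at *
    omega
  · simp

theorem diagonal_X : diagonal A X = X := by
  ext n
  rcases n with _ | n
  · simp [coeff_diagonal]
  rw [coeff_diagonal, sum_eq_single (1, n)]
  · simp [coeff_one, coeff_X]
  · intro p hp h
    rw [coeff_X, if_neg, map_zero]
    intro h0
    refine h (Prod.ext h0 ?_)
    have := HasAntidiagonal.mem_antidiagonal.1 hp
    simp only at *
    omega
  · intro h
    exact absurd (HasAntidiagonal.mem_antidiagonal.2 (by simp; omega)) h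

theorem diagonal_exph {Z : PowerSeries (PowerSeries A)} (hZ : constantCoeff Z = 0) :
    diagonal A (exph k Z) = exph k (diagonal A Z) := by
  ext n
  rw [coeff_diagonal, coeff_exph]
  have e : ∀ p ∈ antidiagonal n, coeff p.2 (coeff p.1 (exph k Z)) =
      ∑ m ∈ range (n + 1), ((m.factorial : k)⁻¹) • coeff p.2 (coeff p.1 (Z ^ m)) := by
    intro p hp
    rw [coeff_exph_of_lt hZ (N := n + 1)
      (by have := HasAntidiagonal.mem_antidiagonal.1 hp; omega), map_sum]
    simp
  rw [sum_congr rfl e, sum_comm]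
  refine sum_congr rfl fun m _ => ?_
  rw [← smul_sum, ← map_pow, coeff_diagonal]

theorem exists_eq_mul_X {Y : PowerSeries A} (hY : constantCoeff Y = 0) :
    ∃ Y' : PowerSeries A, Y = Y' * X := by
  refine ⟨PowerSeries.mk fun n => coeff (n + 1) Y, ?_⟩
  ext n
  rcases n with _ | n
  · simpa using hY
  · simp [coeff_succ_mul_X]

theorem mul_X_pow_injective (m : ℕ) {Y Z : PowerSeries A} (h : Y * X ^ m = Z * X ^ m) : Y = Z := by
  ext n
  have := congrArg (coeff (n + m)) h
  simpa using this

/-- The Baker–Campbell–Hausdorff formula for a commutator that commutes with both arguments. -/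
theorem exph_mul_exph [CharZero k] {Y Z : PowerSeries A} (hY : constantCoeff Y = 0)
    (hZ : constantCoeff Z = 0) (h : Commute (Y * Z - Z * Y) Y) (h' : Commute (Y * Z - Z * Y) Z) :
    exph k Y * exph k Z = exph k (Y + Z + (2 : k)⁻¹ • (Y * Z - Z * Y)) := by
  -- After a factor `h` is split off, the cofactors become constants over the ring `A[[h]]` with a
  -- new variable, and `diagonal` later sets that variable equal to `h`.
  obtain ⟨Y, rfl⟩ := exists_eq_mul_X hY
  obtain ⟨Z, rfl⟩ := exists_eq_mul_X hZ
  have hX : ∀ f : PowerSeries A, X * f = f * X := fun f => (commute_X f).eq.symm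
  have hw : Y * X * (Z * X) - Z * X * (Y * X) = (Y * Z - Z * Y) * X ^ 2 := by
    rw [mul_assoc Y, ← mul_assoc X Z, hX Z, mul_assoc Z X (Y * X), ← mul_assoc X Y, hX Y]
    noncomm_ring
  rw [hw] at h h' ⊢
  have hcomm : ∀ T : PowerSeries A, Commute ((Y * Z - Z * Y) * X ^ 2) (T * X) →
      Commute (Y * Z - Z * Y) T := by
    intro T hT
    -- Two powers of `h` come from the commutator and one from `T * X`.
    refine mul_X_pow_injective 3 ?_
    have hX2 : ∀ f : PowerSeries A, X ^ 2 * f = f * X ^ 2 :=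
      fun f => ((commute_X f).pow_right 2).eq.symm
    have e := hT.eq
    rw [mul_assoc, ← mul_assoc (X ^ 2) T, hX2, mul_assoc T X, ← mul_assoc X (Y * Z - Z * Y), hX]
      at e
    calc _ = _ := by rw [pow_succ X 2]; simp only [mul_assoc]
      _ = _ := e
      _ = _ := by rw [pow_succ' X 2]; simp only [mul_assoc]
  have main := congrArg (diagonal A)
    (exph_X_mul_exph_X (k := k) Y Z (hcomm Y h) (hcomm Z h'))
  rw [map_mul, diagonal_exph (by simp), diagonal_exph (by simp), diagonal_exph (by simp)] at main
  simpa only [map_mul, map_add, map_pow, diagonal_C, diagonal_X, add_mul, smul_mul_assoc] using main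

theorem exph_add [CharZero k] {Y Z : PowerSeries A} (hY : constantCoeff Y = 0)
    (hZ : constantCoeff Z = 0) (h : Commute Y Z) : exph k (Y + Z) = exph k Y * exph k Z := by
  have h0 : Y * Z - Z * Y = 0 := sub_eq_zero.2 h.eq
  rw [exph_mul_exph hY hZ (by rw [h0]; exact Commute.zero_left _)
    (by rw [h0]; exact Commute.zero_left _), h0, smul_zero, add_zero]

/-- The exponential of a series without constant term as an invertible element. -/
def exphUnit [CharZero k] {Y : PowerSeries A} (hY : constantCoeff Y = 0) : (PowerSeries A)ˣ where
  val := exph k Y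
  inv := exph k (-Y)
  val_inv := by
    rw [← exph_add hY (by simpa using hY) (Commute.neg_right (Commute.refl Y)), add_neg_cancel,
      exph_zero]
  inv_val := by
    rw [← exph_add (by simpa using hY) hY (Commute.neg_left (Commute.refl Y)), neg_add_cancel,
      exph_zero]

end Exponential

/-! ### Filtration and Adams operation on a primitively generated bialgebra -/

section PrimitivelyGenerated

variable {k : Type*} {A : Type*} [Field k] [Ring A]

section Filtration

variable [Algebra k A]

/-- The span of the products of at most `n` elements of `V`. -/
def fil (V : Submodule k A) (n : ℕ) : Submodule k A := (1 ⊔ V) ^ n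

/-- The filtration `fil`, shifted by one. -/
def filPred (V : Submodule k A) : ℕ → Submodule k A
  -- Degree −1 is zero, so that `fil V n` modulo `filPred V n` is the graded piece for every `n`,
  -- including 0.
  | 0 => ⊥
  | n + 1 => fil V n

variable {V : Submodule k A}

theorem fil_zero : fil V 0 = 1 := pow_zero _

theorem one_le_sup : (1 : Submodule k A) ≤ 1 ⊔ V := le_sup_left

theorem fil_mono {m n : ℕ} (h : m ≤ n) : fil V m ≤ fil V n :=
  pow_le_pow_right₀ one_le_sup h

theorem fil_mul (m n : ℕ) : fil V m * fil V n = fil V (m + n) := (pow_add _ m n).symm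

theorem mul_mem_fil {m n : ℕ} {a b : A} (ha : a ∈ fil V m) (hb : b ∈ fil V n) :
    a * b ∈ fil V (m + n) := fil_mul (V := V) m n ▸ Submodule.mul_mem_mul ha hb

theorem le_fil_one : V ≤ fil V 1 := by
  rw [fil, pow_one]
  exact le_sup_right

theorem one_mem_fil (n : ℕ) : (1 : A) ∈ fil V n :=
  fil_mono (Nat.zero_le n) (by rw [fil_zero]; exact Submodule.one_le.1 le_rfl)

theorem mul_mem_fil_succ {n : ℕ} {v u : A} (hv : v ∈ V) (hu : u ∈ fil V n) :
    v * u ∈ fil V (n + 1) := by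
  rw [add_comm]
  exact mul_mem_fil (le_fil_one hv) hu

/-- As `(1 + V)^(n+1) = (1 + V)(1 + V)^n`, this serves as the induction principle for the
filtration. -/
theorem fil_succ_le {n : ℕ} {W : Submodule k A} (h1 : ∀ u ∈ fil V n, u ∈ W)
    (h2 : ∀ v ∈ V, ∀ u ∈ fil V n, v * u ∈ W) : fil V (n + 1) ≤ W := by
  rw [fil, pow_succ', Submodule.mul_le]
  intro m hm u hu
  obtain ⟨c, hc, v, hv, rfl⟩ := Submodule.mem_sup.1 hm
  obtain ⟨c, rfl⟩ := Submodule.mem_one.1 hc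
  rw [add_mul, ← Algebra.smul_def]
  exact W.add_mem (W.smul_mem c (h1 u hu)) (h2 v hv u hu)

theorem mem_fil_zero {u : A} : u ∈ fil V 0 ↔ ∃ c : k, c • (1 : A) = u := by
  simp [fil_zero, Submodule.mem_one, Algebra.algebraMap_eq_smul_one]

theorem filPred_le (n : ℕ) : filPred V n ≤ fil V n := by
  cases n with
  | zero => exact bot_le
  | succ n => exact fil_mono (Nat.le_succ n)

theorem filPred_mono {m n : ℕ} (h : m ≤ n) : filPred V m ≤ filPred V n := by
  cases m with
  | zero => exact bot_le
  | succ m =>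
    obtain ⟨n, rfl⟩ : ∃ n', n = n' + 1 := ⟨n - 1, by omega⟩
    exact fil_mono (by omega)

theorem fil_mul_filPred_le {i j n : ℕ} (h : i + j ≤ n) : fil V i * filPred V j ≤ filPred V n := by
  cases j with
  | zero => simp [filPred]
  | succ j =>
    refine le_trans ?_ (filPred_mono h)
    exact (fil_mul i j).le

theorem mul_mem_fil_of_mem_filPred {n : ℕ} {v u : A} (hv : v ∈ V) (hu : u ∈ filPred V n) :
    v * u ∈ fil V n := by
  have := fil_mul_filPred_le (V := V) (i := 1) (j := n) (n := n + 1) (by omega)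
  exact this (Submodule.mul_mem_mul (le_fil_one hv) hu)

/-- The filtration of `A ⊗ A` by the total degree. -/
def tensorFil (V : Submodule k A) (n : ℕ) : Submodule k (A ⊗[k] A) :=
  Submodule.span k {z | ∃ i j : ℕ, i + j ≤ n ∧ ∃ a ∈ fil V i, ∃ b ∈ fil V j, a ⊗ₜ[k] b = z}

theorem tmul_mem_tensorFil {i j n : ℕ} (h : i + j ≤ n) {a b : A} (ha : a ∈ fil V i)
    (hb : b ∈ fil V j) : a ⊗ₜ[k] b ∈ tensorFil V n :=
  Submodule.subset_span ⟨i, j, h, a, ha, b, hb, rfl⟩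

theorem tensorFil_le {n : ℕ} {W : Submodule k (A ⊗[k] A)}
    (h : ∀ i j : ℕ, i + j ≤ n → ∀ a ∈ fil V i, ∀ b ∈ fil V j, a ⊗ₜ[k] b ∈ W) :
    tensorFil V n ≤ W := by
  refine Submodule.span_le.2 ?_
  rintro _ ⟨i, j, hij, a, ha, b, hb, rfl⟩
  exact h i j hij a ha b hb

theorem tensorFil_mono {m n : ℕ} (h : m ≤ n) : tensorFil V m ≤ tensorFil V n :=
  tensorFil_le fun _ _ hij _ ha _ hb => tmul_mem_tensorFil (hij.trans h) ha hb

end Filtration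

variable [Bialgebra k A]

open Coalgebra (comul counit)

variable (k) in
/-- An element `p` is primitive if `Δ(p) = p ⊗ 1 + 1 ⊗ p`. -/
def IsPrim (p : A) : Prop := comul (R := k) p = p ⊗ₜ[k] 1 + 1 ⊗ₜ p

/-- `V` is a Lie algebra of primitive elements which generates the algebra. -/
structure PrimGen (V : Submodule k A) : Prop where
  isPrim : ∀ v ∈ V, IsPrim k v
  lie_mem : ∀ v ∈ V, ∀ w ∈ V, v * w - w * v ∈ V
  exhaust : ∀ u : A, ∃ n, u ∈ fil V n

theorem IsPrim.counit_eq_zero {p : A} (hp : IsPrim k p) : counit (R := k) p = 0 := by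
  have h := Coalgebra.rTensor_counit_comul (R := k) p
  rw [hp, map_add, LinearMap.rTensor_tmul, LinearMap.rTensor_tmul, Bialgebra.counit_one,
    add_eq_right] at h
  have := congrArg (TensorProduct.map LinearMap.id (counit (R := k) (A := A))) h
  have h2 := congrArg (TensorProduct.lid k k) this
  simpa using h2

variable (k A) in
/-- The second Adams operation `u ↦ u₁ u₂`. -/
def adams : A →ₗ[k] A := LinearMap.mul' k A ∘ₗ comul

theorem IsPrim.adams_eq {p : A} (hp : IsPrim k p) : adams k A p = (2 : k) • p := by
  rw [adams, LinearMap.comp_apply, hp]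
  simp [two_smul]

theorem adams_one : adams k A 1 = 1 := by simp [adams, Algebra.TensorProduct.one_def]

variable {V : Submodule k A}

namespace PrimGen

variable (h : PrimGen V)
include h

theorem comul_mul {v : A} (hv : v ∈ V) (u : A) :
    comul (R := k) (v * u) = (v ⊗ₜ[k] 1 + 1 ⊗ₜ v) * comul (R := k) u := by
  rw [Bialgebra.comul_mul, h.isPrim v hv]

theorem comul_mem {n : ℕ} {u : A} (hu : u ∈ fil V n) : comul (R := k) u ∈ tensorFil V n := by
  induction n generalizing u with
  | zero =>
    obtain ⟨c, rfl⟩ := mem_fil_zero.1 hu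
    rw [map_smul, Bialgebra.comul_one, Algebra.TensorProduct.one_def]
    exact Submodule.smul_mem _ _
      (tmul_mem_tensorFil (i := 0) (j := 0) le_rfl (one_mem_fil 0) (one_mem_fil 0))
  | succ n ih =>
    refine fil_succ_le (W := (tensorFil V (n + 1)).comap (comul (R := k)))
      (fun u hu => tensorFil_mono (Nat.le_succ n) (ih hu)) (fun v hv u hu => ?_) hu
    rw [Submodule.mem_comap, h.comul_mul hv]
    refine tensorFil_le (V := V) (n := n) (W := (tensorFil V (n + 1)).comap
      (LinearMap.mulLeft k (v ⊗ₜ[k] 1 + 1 ⊗ₜ v))) (fun i j hij a ha b hb => ?_) (ih hu)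
    rw [Submodule.mem_comap, LinearMap.mulLeft_apply, add_mul]
    simp only [Algebra.TensorProduct.tmul_mul_tmul, one_mul]
    exact Submodule.add_mem _ (tmul_mem_tensorFil (by omega) (mul_mem_fil_succ hv ha) hb)
      (tmul_mem_tensorFil (by omega) ha (mul_mem_fil_succ hv hb))

/-- The commutator with `v` is a derivation that preserves `V`, so the associated graded algebra is
commutative. -/
theorem commutator_mem {n : ℕ} {v u : A} (hv : v ∈ V) (hu : u ∈ fil V n) :
    v * u - u * v ∈ fil V n := by
  induction n generalizing u with
  | zero =>
    obtain ⟨c, rfl⟩ := mem_fil_zero.1 hu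
    simp
  | succ n ih =>
    refine fil_succ_le (W := (fil V (n + 1)).comap (LinearMap.mulLeft k v - LinearMap.mulRight k v))
      (fun u hu => fil_mono (Nat.le_succ n) (ih hu)) (fun w hw u hu => ?_) hu
    rw [Submodule.mem_comap]
    have e : (LinearMap.mulLeft k v - LinearMap.mulRight k v) (w * u) =
        (v * w - w * v) * u + w * (v * u - u * v) := by
      simp only [LinearMap.sub_apply, LinearMap.mulLeft_apply, LinearMap.mulRight_apply]
      noncomm_ring
    rw [e]
    exact Submodule.add_mem _ (mul_mem_fil_succ (h.lie_mem v hv w hw) hu)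
      (mul_mem_fil_succ hw (ih hu))

/-- The Adams operation `ψ` is `2^n` on the graded piece of degree `n`. For `v` primitive, `ψ(vu) =
v u₁u₂ + u₁ v u₂ = 2vψ(u) - [v,u₁]u₂`, and the last term has no larger degree than `u`. -/
theorem adams_sub_mem {n : ℕ} {u : A} (hu : u ∈ fil V n) :
    adams k A u - (2 : k) ^ n • u ∈ filPred V n := by
  induction n generalizing u with
  | zero =>
    obtain ⟨c, rfl⟩ := mem_fil_zero.1 hu
    simp [adams_one]
  | succ n ih =>
    have hpres : ∀ {u : A}, u ∈ fil V n → adams k A u ∈ fil V n := fun hu => by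
      simpa using Submodule.add_mem _ (filPred_le n (ih hu)) ((fil V n).smul_mem ((2 : k) ^ n) hu)
    refine fil_succ_le
      (W := (filPred V (n + 1)).comap (adams k A - (2 : k) ^ (n + 1) • LinearMap.id))
      (fun u hu => ?_) (fun v hv u hu => ?_) hu
    · exact (fil V n).sub_mem (hpres hu) ((fil V n).smul_mem ((2 : k) ^ (n + 1)) hu)
    · let L : A ⊗[k] A →ₗ[k] A := LinearMap.mul' k A ∘ₗ
        TensorProduct.map (LinearMap.mulLeft k v - LinearMap.mulRight k v) LinearMap.id
      have e : ∀ z : A ⊗[k] A, LinearMap.mul' k A ((v ⊗ₜ[k] 1 + 1 ⊗ₜ v) * z) =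
          (2 : k) • (v * LinearMap.mul' k A z) - L z := by
        intro z
        induction z with
        | zero => simp
        | add x y hx hy => rw [mul_add, map_add, hx, hy, map_add, map_add, mul_add]; module
        | tmul a b =>
          simp [L, add_mul, two_smul, sub_mul]
          noncomm_ring
      have hL : L (comul u) ∈ fil V n := by
        have hle : tensorFil V n ≤ (fil V n).comap L := by
          refine tensorFil_le fun i j hij a ha b hb => ?_
          have e3 : L (a ⊗ₜ b) = (v * a - a * v) * b := by simp [L]
          rw [Submodule.mem_comap, e3]
          exact fil_mono hij (mul_mem_fil (h.commutator_mem hv ha) hb)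
        exact hle (h.comul_mem hu)
      have e2 : adams k A (v * u) - (2 : k) ^ (n + 1) • (v * u) =
          (2 : k) • (v * (adams k A u - (2 : k) ^ n • u)) - L (comul u) := by
        rw [adams, LinearMap.comp_apply, h.comul_mul hv, e, LinearMap.comp_apply, mul_sub,
          mul_smul_comm, pow_succ']
        module
      change adams k A (v * u) - (2 : k) ^ (n + 1) • (v * u) ∈ fil V n
      rw [e2]
      exact (fil V n).sub_mem ((fil V n).smul_mem _ (mul_mem_fil_of_mem_filPred hv (ih hu))) hL

/-- The primitive elements are those of `V`. -/
theorem mem_of_isPrim [CharZero k] {p : A} (hp : IsPrim k p) : p ∈ V := by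
  -- A primitive element has Adams eigenvalue 2, but in degree `n + 2` the eigenvalue is `2^(n+2) ≠
  -- 2`, so the degree can be lowered until it is 1.
  have h1 : ∀ n : ℕ, p ∈ fil V (n + 1) → p ∈ fil V 1 := by
    intro n
    induction n with
    | zero => exact id
    | succ n ih =>
      intro hn
      refine ih ?_
      have := h.adams_sub_mem hn
      rw [hp.adams_eq, ← sub_smul] at this
      refine (Submodule.smul_mem_iff _ ?_).1 this
      have h2 : (2 : k) - 2 ^ (n + 1 + 1) = -(((2 ^ (n + 2) - 2 : ℕ)) : k) := by
        rw [Nat.cast_sub]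
        · push_cast; ring
        · rw [pow_succ]; have := Nat.one_le_two_pow (n := n + 1); omega
      rw [h2, neg_ne_zero, Nat.cast_ne_zero]
      have := Nat.one_le_two_pow (n := n)
      rw [pow_add]
      omega
  obtain ⟨n, hn⟩ := h.exhaust p
  have := h1 n (fil_mono (Nat.le_succ n) hn)
  -- What remains is a scalar plus an element of `V`, and the counit kills the scalar.
  rw [fil, pow_one] at this
  obtain ⟨c, hc, v, hv, e⟩ := Submodule.mem_sup.1 this
  obtain ⟨c, rfl⟩ := Submodule.mem_one.1 hc
  have h3 := congrArg (counit (R := k)) e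
  rw [map_add, (h.isPrim v hv).counit_eq_zero, hp.counit_eq_zero, add_zero,
    Bialgebra.counit_algebraMap] at h3
  rw [h3, map_zero, zero_add] at e
  exact e ▸ hv

end PrimGen

end PrimitivelyGenerated

/-! ### The graded algebra has no zero divisors, and units are scalars -/

section Units

variable {k : Type*} {A : Type*} [Field k] [Ring A] [Bialgebra k A]

open Coalgebra (comul counit IsCocomm)

/-- The linear map `a ⊗ b ↦ φ(a) b`. -/
def contractLeft (φ : A →ₗ[k] k) : A ⊗[k] A →ₗ[k] A :=
  (TensorProduct.lid k A).toLinearMap ∘ₗ TensorProduct.map φ LinearMap.id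

@[simp]
theorem contractLeft_tmul (φ : A →ₗ[k] k) (a b : A) : contractLeft φ (a ⊗ₜ b) = φ a • b := by
  simp [contractLeft]

/-- The operator `u ↦ φ(u₁) u₂`. -/
def contract (φ : A →ₗ[k] k) : Module.End k A := contractLeft φ ∘ₗ comul

theorem contract_apply (φ : A →ₗ[k] k) (u : A) : contract φ u = contractLeft φ (comul u) := rfl

theorem contract_add_smul (φ χ : A →ₗ[k] k) (t : k) :
    contract (φ + t • χ) = contract φ + t • contract χ := by
  have : contractLeft (φ + t • χ) = contractLeft φ + t • contractLeft χ := by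
    ext a b
    simp [add_smul, mul_smul]
  ext u
  simp [contract, this]

theorem contractLeft_counit_comul (u : A) : contractLeft (counit (R := k)) (comul u) = u := by
  have := Coalgebra.rTensor_counit_comul (R := k) u
  rw [LinearMap.rTensor] at this
  simp [contractLeft, this]

/-- By coassociativity, contracting twice is contracting with the convolution of the functionals. -/
theorem contract_contract (φ χ : A →ₗ[k] k) (u : A) :
    contract φ (contract χ u) = (TensorProduct.lid k A)
      (TensorProduct.map (LinearMap.mul' k k ∘ₗ TensorProduct.map χ φ ∘ₗ comul) LinearMap.id
        (comul u)) := by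
  have h := Coalgebra.coassoc_apply (R := k) u
  have h1 : ∀ z : A ⊗[k] A, contract φ (contractLeft χ z) =
      (TensorProduct.lid k A) (TensorProduct.map χ (contractLeft φ)
        (LinearMap.lTensor A (comul (R := k)) z)) := by
    intro z
    induction z with
    | zero => simp
    | add x y hx hy => simp only [map_add, hx, hy]
    | tmul a b => simp [contract]
  have h2 : ∀ z : (A ⊗[k] A) ⊗[k] A, (TensorProduct.lid k A) (TensorProduct.map χ (contractLeft φ)
      (TensorProduct.assoc k A A A z)) = (TensorProduct.lid k A)
      (TensorProduct.map (LinearMap.mul' k k ∘ₗ TensorProduct.map χ φ) LinearMap.id z) := by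
    intro z
    induction z with
    | zero => simp
    | add x y hx hy => simp only [map_add, hx, hy]
    | tmul z c =>
      induction z with
      | zero => simp
      | add x y hx hy => simp only [map_add, TensorProduct.add_tmul, hx, hy]
      | tmul a b => simp [mul_smul, smul_comm (φ b)]
  have h3 : ∀ z : A ⊗[k] A, TensorProduct.map (LinearMap.mul' k k ∘ₗ TensorProduct.map χ φ)
      LinearMap.id (LinearMap.rTensor A (comul (R := k)) z) =
      TensorProduct.map (LinearMap.mul' k k ∘ₗ TensorProduct.map χ φ ∘ₗ comul) LinearMap.id z := by
    intro z
    induction z with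
    | zero => simp
    | add x y hx hy => simp only [map_add, hx, hy]
    | tmul a b => simp
  rw [contract_apply χ, h1, ← h, h2, h3]

/-- Convolution of functionals is commutative because the coproduct is cocommutative. -/
theorem contract_commute [IsCocomm k A] (φ χ : A →ₗ[k] k) :
    Commute (contract φ) (contract χ) := by
  have h : ∀ φ χ : A →ₗ[k] k, LinearMap.mul' k k ∘ₗ TensorProduct.map χ φ ∘ₗ
      comul (R := k) (A := A) =
      LinearMap.mul' k k ∘ₗ TensorProduct.map φ χ ∘ₗ comul := by
    intro φ χ
    ext u
    have h1 : ∀ z : A ⊗[k] A, LinearMap.mul' k k (TensorProduct.map χ φ z) =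
        LinearMap.mul' k k (TensorProduct.map φ χ (TensorProduct.comm k A A z)) := by
      intro z
      induction z with
      | zero => simp
      | add x y hx hy => simp only [map_add, hx, hy]
      | tmul a b => simp [mul_comm]
    simp only [LinearMap.comp_apply]
    rw [h1, Coalgebra.comm_comul]
  ext u
  change contract φ (contract χ u) = contract χ (contract φ u)
  rw [contract_contract, contract_contract, h]

open Polynomial in
-- The two contractions commute, so this is the binomial theorem. It allows arguments on the line `φ
-- + tχ` of functionals, both for polarisation and for choosing a generic `t`.
theorem exists_polynomial_contract_pow [IsCocomm k A] (φ χ : A →ₗ[k] k) (m : ℕ) (u : A) :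
    ∃ P : k[X], (∀ t, P.eval t = counit (R := k) ((contract (φ + t • χ) ^ m) u)) ∧
      ∀ j ≤ m, P.coeff j =
        m.choose j * counit (R := k) ((contract φ ^ (m - j)) ((contract χ ^ j) u)) := by
  refine ⟨∑ j ∈ Finset.range (m + 1), C ((m.choose j : k) *
    counit (R := k) ((contract φ ^ (m - j)) ((contract χ ^ j) u))) * X ^ j, fun t => ?_,
    fun j hj => ?_⟩
  · have hc : Commute (t • contract χ) (contract φ) := (contract_commute χ φ).smul_left t
    rw [contract_add_smul, add_comm (contract φ), hc.add_pow, eval_finsetSum, LinearMap.sum_apply,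
      map_sum]
    refine Finset.sum_congr rfl fun j _ => ?_
    have h1 : (t • contract χ) ^ j * contract φ ^ (m - j) =
        contract φ ^ (m - j) * (t • contract χ) ^ j := ((hc.pow_pow j (m - j))).eq
    rw [h1, _root_.smul_pow, ← Nat.cast_comm, ← nsmul_eq_mul]
    simp
    ring
  · rw [finsetSum_coeff, Finset.sum_eq_single j]
    · rw [coeff_C_mul_X_pow, if_pos rfl]
    · intro i _ hi
      rw [coeff_C_mul_X_pow, if_neg (Ne.symm hi)]
    · intro h
      simp at h
      omega

variable {V : Submodule k A}

/-- Expanding the first factor in a basis of `V` turns `p` into its coordinate functionals, to which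
the hypothesis applies. -/
theorem mul_map_projection_mem {p : A →ₗ[k] V} (hp1 : p 1 = 0) {W : Submodule k A} {z : A ⊗[k] A}
    (hz : ∀ φ : A →ₗ[k] k, φ 1 = 0 → contractLeft φ z ∈ W) :
    LinearMap.mul' k A (TensorProduct.map (V.subtype ∘ₗ p) LinearMap.id z) ∈ V * W := by
  classical
  let b := Module.Free.chooseBasis k V
  -- The basis may be infinite; requiring the expansion for every larger finite set lets the
  -- expansions of two tensors be added.
  have key : ∃ S : Finset (Module.Free.ChooseBasisIndex k V), ∀ S', S ⊆ S' →
      LinearMap.mul' k A (TensorProduct.map (V.subtype ∘ₗ p) LinearMap.id z) =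
        ∑ i ∈ S', (b i : A) * contractLeft (b.coord i ∘ₗ p) z := by
    clear hz
    induction z with
    | zero => exact ⟨∅, fun S' _ => by simp⟩
    | add x y hx hy =>
      obtain ⟨S, hS⟩ := hx
      obtain ⟨T, hT⟩ := hy
      refine ⟨S ∪ T, fun S' h' => ?_⟩
      rw [map_add, map_add, hS S' (Finset.union_subset_left h'),
        hT S' (Finset.union_subset_right h'), ← Finset.sum_add_distrib]
      exact Finset.sum_congr rfl fun i _ => by rw [map_add, mul_add]
    | tmul a c =>
      refine ⟨(b.repr (p a)).support, fun S' h' => ?_⟩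
      have e : ((p a : V) : A) = ∑ i ∈ S', b.coord i (p a) • (b i : A) := by
        conv_lhs => rw [← b.linearCombination_repr (p a), Finsupp.linearCombination_apply,
          Finsupp.sum_of_support_subset _ h' _ (by simp)]
        simp
      simp only [TensorProduct.map_tmul, LinearMap.comp_apply, Submodule.subtype_apply,
        LinearMap.id_apply, LinearMap.mul'_apply, contractLeft_tmul]
      rw [e, Finset.sum_mul]
      simp
  obtain ⟨S, hS⟩ := key
  rw [hS S subset_rfl]
  exact Submodule.sum_mem _ fun i _ =>
    Submodule.mul_mem_mul (b i).2 (hz _ (by simp [hp1]))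

theorem eq_zero_of_counit_eq_zero {u : A} (hu : u ∈ fil V 0) (h0 : counit (R := k) u = 0) :
    u = 0 := by
  obtain ⟨c, rfl⟩ := mem_fil_zero.1 hu
  have : c = 0 := by simpa using h0
  simp [this]

namespace PrimGen

variable (h : PrimGen V)
include h

/-- As `φ(1) = 0`, terms with a scalar first factor disappear, and the others have a second factor
of smaller degree. -/
theorem contract_mem {φ : A →ₗ[k] k} (hφ : φ 1 = 0) {n : ℕ} {u : A} (hu : u ∈ fil V n) :
    contract φ u ∈ filPred V n := by
  have hle : tensorFil V n ≤ (filPred V n).comap (contractLeft φ) := by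
    refine tensorFil_le fun i j hij a ha b hb => ?_
    rw [Submodule.mem_comap, contractLeft_tmul]
    rcases i with _ | i
    · obtain ⟨c, rfl⟩ := mem_fil_zero.1 ha
      simp [hφ]
    · refine Submodule.smul_mem _ _ (filPred_mono (m := j + 1) (by omega) hb)
  exact hle (h.comul_mem hu)

theorem contract_pow_mem {φ : A →ₗ[k] k} (hφ : φ 1 = 0) {n : ℕ} {u : A} (m : ℕ)
    (hu : u ∈ fil V (n + m)) : (contract φ ^ m) u ∈ fil V n := by
  induction m generalizing u with
  | zero => simpa using hu
  | succ m ih =>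
    rw [pow_succ, Module.End.mul_apply]
    exact ih (h.contract_mem hφ hu)

theorem contract_pow_eq_zero {φ : A →ₗ[k] k} (hφ : φ 1 = 0) {n : ℕ} {u : A}
    (hu : u ∈ filPred V n) : (contract φ ^ n) u = 0 := by
  rcases n with _ | n
  · simpa [filPred] using hu
  · rw [pow_succ', Module.End.mul_apply]
    have := h.contract_mem hφ (h.contract_pow_mem hφ (n := 0) n
      (by rw [zero_add]; exact hu))
    simpa [filPred] using this

/-- Contraction is a derivation of the graded algebra. The error has coefficient `φ(aa') - φ(a)ε(a')
- ε(a)φ(a')`, which vanishes when `a` or `a'` is scalar; otherwise `b` and `b'` each lose a degree.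
-/
theorem contract_mul_sub_mem {φ : A →ₗ[k] k} (hφ : φ 1 = 0) {m n : ℕ} {u v : A}
    (hu : u ∈ fil V (m + 1)) (hv : v ∈ fil V (n + 1)) :
    contract φ (u * v) - contract φ u * v - u * contract φ v ∈ fil V (m + n) := by
  let B : A ⊗[k] A →ₗ[k] A ⊗[k] A →ₗ[k] A :=
    (LinearMap.mul k (A ⊗[k] A)).compr₂ (contractLeft φ) -
      (LinearMap.mul k A).compl₁₂ (contractLeft φ) (contractLeft (counit (R := k))) -
      (LinearMap.mul k A).compl₁₂ (contractLeft (counit (R := k))) (contractLeft φ)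
  have hB : ∀ z z', B z z' = contractLeft φ (z * z') -
      contractLeft φ z * contractLeft (counit (R := k)) z' -
      contractLeft (counit (R := k)) z * contractLeft φ z' := fun z z' => rfl
  have hle : ∀ z ∈ tensorFil V (m + 1), ∀ z' ∈ tensorFil V (n + 1), B z z' ∈ fil V (m + n) := by
    intro z hz z' hz'
    have h1 : tensorFil V (n + 1) ≤ (fil V (m + n)).comap (B z) := by
      refine tensorFil_le fun i' j' hij' a' ha' b' hb' => ?_
      have h2 : tensorFil V (m + 1) ≤ (fil V (m + n)).comap (B.flip (a' ⊗ₜ b')) := by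
        refine tensorFil_le fun i j hij a ha b hb => ?_
        rw [Submodule.mem_comap, LinearMap.flip_apply, hB]
        have e : contractLeft φ (a ⊗ₜ[k] b * a' ⊗ₜ[k] b') -
            contractLeft φ (a ⊗ₜ[k] b) * contractLeft (counit (R := k)) (a' ⊗ₜ[k] b') -
            contractLeft (counit (R := k)) (a ⊗ₜ[k] b) * contractLeft φ (a' ⊗ₜ[k] b') =
            (φ (a * a') - φ a * counit (R := k) a' - counit (R := k) a * φ a') • (b * b') := by
          simp only [Algebra.TensorProduct.tmul_mul_tmul, contractLeft_tmul, smul_mul_assoc,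
            mul_smul_comm]
          module
        rw [e]
        rcases i with _ | i
        · obtain ⟨c, rfl⟩ := mem_fil_zero.1 ha
          simp [hφ]
        · rcases i' with _ | i'
          · obtain ⟨c, rfl⟩ := mem_fil_zero.1 ha'
            simp [hφ, mul_comm]
          · exact Submodule.smul_mem _ _ (fil_mono (by omega) (mul_mem_fil hb hb'))
      exact h2 hz
    exact h1 hz'
  have := hle _ (h.comul_mem hu) _ (h.comul_mem hv)
  rwa [hB, contractLeft_counit_comul, contractLeft_counit_comul, ← Bialgebra.comul_mul] at this

/-- Leibniz rule for the power `m + n` of this derivation: for degree reasons only the term with `m`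
derivatives on `u` and `n` on `v` survives. The induction is Pascal's rule. -/
theorem contract_pow_mul {φ : A →ₗ[k] k} (hφ : φ 1 = 0) {N : ℕ} : ∀ {m n : ℕ}, m + n = N →
    ∀ {u v : A}, u ∈ fil V m → v ∈ fil V n → (contract φ ^ N) (u * v) =
      (N.choose m : k) • ((contract φ ^ m) u * (contract φ ^ n) v) := by
  induction N with
  | zero =>
    intro m n hN u v _ _
    obtain ⟨rfl, rfl⟩ : m = 0 ∧ n = 0 := by omega
    simp
  | succ N ih =>
    intro m n hN u v hu hv
    rcases m with _ | m
    · obtain ⟨c, rfl⟩ := mem_fil_zero.1 hu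
      obtain rfl : n = N + 1 := by omega
      simp
    rcases n with _ | n
    · obtain ⟨c, rfl⟩ := mem_fil_zero.1 hv
      obtain rfl : m = N := by omega
      simp
    obtain rfl : N = m + n + 1 := by omega
    set w := contract φ (u * v) - contract φ u * v - u * contract φ v with hw
    have hw' : w ∈ filPred V (m + n + 1) := h.contract_mul_sub_mem hφ hu hv
    have e : contract φ (u * v) = contract φ u * v + u * contract φ v + w := by rw [hw]; abel
    rw [pow_succ, Module.End.mul_apply, e, map_add, map_add, h.contract_pow_eq_zero hφ hw',
      ih (m := m) (n := n + 1) (by omega) (h.contract_mem hφ hu) hv,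
      ih (m := m + 1) (n := n) (by omega) hu (h.contract_mem hφ hv),
      Nat.choose_succ_succ (m + n + 1) m,
      ← Module.End.mul_apply, ← pow_succ, ← Module.End.mul_apply, ← pow_succ]
    push_cast
    module

/-- A linear projection onto `V` that vanishes at `1`. -/
theorem exists_projection : ∃ p : A →ₗ[k] V, p 1 = 0 ∧ ∀ v : V, p v = v := by
  obtain ⟨q, hq⟩ := V.subtype.exists_leftInverse_of_injective (by simp)
  refine ⟨q ∘ₗ (LinearMap.id - (counit (R := k)).smulRight (1 : A)), by simp, fun v => ?_⟩
  have := LinearMap.congr_fun hq v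
  simpa [(h.isPrim v v.2).counit_eq_zero] using this

/-- The operator `θ(u) = p(u₁)u₂` counts degree: it is `n` on the graded piece of degree `n`, since
up to lower terms `θ(vu) = vu + vθ(u)`. -/
theorem projection_conv_sub_mem {p : A →ₗ[k] V} (hp1 : p 1 = 0) (hp : ∀ v : V, p v = v) {n : ℕ}
    {u : A} (hu : u ∈ fil V n) :
    LinearMap.mul' k A (TensorProduct.map (V.subtype ∘ₗ p) LinearMap.id (comul u)) - (n : k) • u ∈
      filPred V n := by
  set θ : A →ₗ[k] A :=
    LinearMap.mul' k A ∘ₗ TensorProduct.map (V.subtype ∘ₗ p) LinearMap.id ∘ₗ comul with hθ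
  change θ u - (n : k) • u ∈ filPred V n
  induction n generalizing u with
  | zero =>
    obtain ⟨c, rfl⟩ := mem_fil_zero.1 hu
    have : θ 1 = 0 := by simp [hθ, hp1, Algebra.TensorProduct.one_def]
    simp [this]
  | succ n ih =>
    refine fil_succ_le (W := (filPred V (n + 1)).comap (θ - ((n + 1 : ℕ) : k) • LinearMap.id))
      (fun u hu => ?_) (fun v hv u hu => ?_) hu
    · have : θ u ∈ fil V n := by
        simpa using Submodule.add_mem _ (filPred_le n (ih hu)) ((fil V n).smul_mem (n : k) hu)
      exact (fil V n).sub_mem this ((fil V n).smul_mem ((n + 1 : ℕ) : k) hu)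
    -- The deviation `θ(vu) - vu - vθ(u)`, written as a linear function of `Δ(u)`.
    · let L : A ⊗[k] A →ₗ[k] A :=
        LinearMap.mul' k A ∘ₗ TensorProduct.map (V.subtype ∘ₗ p) LinearMap.id ∘ₗ
            LinearMap.mulLeft k (v ⊗ₜ[k] 1 + 1 ⊗ₜ v) -
          LinearMap.mulLeft k v ∘ₗ contractLeft (counit (R := k)) -
          LinearMap.mulLeft k v ∘ₗ LinearMap.mul' k A ∘ₗ
            TensorProduct.map (V.subtype ∘ₗ p) LinearMap.id
      have hL : L (comul u) = θ (v * u) - v * u - v * θ u := by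
        have e1 : θ (v * u) = LinearMap.mul' k A (TensorProduct.map (V.subtype ∘ₗ p) LinearMap.id
            ((v ⊗ₜ[k] 1 + 1 ⊗ₜ v) * comul u)) := by
          rw [← h.comul_mul hv]; rfl
        have e2 := contractLeft_counit_comul (k := k) u
        rw [e1]
        nth_rewrite 3 [← e2]
        rfl
      have hLmem : tensorFil V n ≤ (fil V n).comap L := by
        refine tensorFil_le fun i j hij a ha b hb => ?_
        have e : L (a ⊗ₜ b) = p (v * a) * b + (p a * v - v * p a : A) * b -
            counit (R := k) a • (v * b) := by
          simp [L, add_mul, sub_mul, mul_assoc]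
          abel
        rw [Submodule.mem_comap, e]
        rcases i with _ | i
        · obtain ⟨c, rfl⟩ := mem_fil_zero.1 ha
          have := hp ⟨v, hv⟩
          simp only at this
          simp [hp1, this]
        · have hj : ∀ w ∈ V, w * b ∈ fil V n := fun w hw =>
            fil_mono (by omega) (mul_mem_fil_succ hw hb)
          exact (fil V n).sub_mem ((fil V n).add_mem (hj _ (p (v * a)).2)
            (hj _ (h.lie_mem _ (p a).2 _ hv))) ((fil V n).smul_mem _ (hj v hv))
      have e3 : θ (v * u) - ((n + 1 : ℕ) : k) • (v * u) =
          v * (θ u - (n : k) • u) + L (comul u) := by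
        rw [hL, mul_sub, mul_smul_comm]
        push_cast
        module
      change θ (v * u) - ((n + 1 : ℕ) : k) • (v * u) ∈ fil V n
      rw [e3]
      exact (fil V n).add_mem (mul_mem_fil_of_mem_filPred hv (ih hu)) (hLmem (h.comul_mem hu))

/-- The degree operator gives `(m+1)u` modulo `fil V m`, while its value is built from elements of
`V` times contractions of `u`. -/
theorem mem_fil_of_contract_mem [CharZero k] {m : ℕ} {u : A} (hu : u ∈ fil V (m + 1))
    (hc : ∀ φ : A →ₗ[k] k, φ 1 = 0 → contract φ u ∈ filPred V m) : u ∈ fil V m := by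
  obtain ⟨p, hp1, hp⟩ := h.exists_projection
  have h1 := h.projection_conv_sub_mem hp1 hp hu
  have h2 := mul_map_projection_mem hp1 (z := comul (R := k) u) hc
  have h3 : V * filPred V m ≤ fil V m :=
    Submodule.mul_le.2 fun v hv w hw => mul_mem_fil_of_mem_filPred hv hw
  have h4 := (fil V m).sub_mem (h3 h2) h1
  rw [sub_sub_cancel] at h4
  exact (Submodule.smul_mem_iff _ (by exact_mod_cast Nat.succ_ne_zero m)).1 h4

/-- Polarisation: the coefficient of `t` in the power `m + 1` of the contraction by `φ + tχ` shows
that each contraction of `u` by `χ` satisfies the hypothesis in degree `m`. -/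
theorem mem_filPred_of_contract_pow [CharZero k] [IsCocomm k A] {m : ℕ} {u : A} (hu : u ∈ fil V m)
    (hc : ∀ φ : A →ₗ[k] k, φ 1 = 0 → (contract φ ^ m) u = 0) : u ∈ filPred V m := by
  induction m generalizing u with
  | zero => simpa [filPred] using hc 0 rfl
  | succ m ih =>
    refine h.mem_fil_of_contract_mem hu fun χ hχ => ih (h.contract_mem hχ hu) fun φ hφ => ?_
    obtain ⟨P, hP, hP'⟩ := exists_polynomial_contract_pow φ χ (m + 1) u
    have hP0 : P = 0 := Polynomial.funext fun t => by
      rw [hP, hc _ (by simp [hφ, hχ]), map_zero, Polynomial.eval_zero]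
    have h1 := hP' 1 (by omega)
    rw [hP0, Polynomial.coeff_zero, Nat.choose_one_right, Nat.add_sub_cancel, pow_one, eq_comm,
      mul_eq_zero_iff_left (by exact_mod_cast Nat.succ_ne_zero m)] at h1
    exact eq_zero_of_counit_eq_zero
      (h.contract_pow_mem hφ m (by simpa [filPred] using h.contract_mem hχ hu)) h1

/-- A nonzero symbol is seen by a top power of some contraction. Take `φ` for `u` and `χ` for `v`;
along `φ + tχ` the two counits are nonzero polynomials in `t`, so some `t` makes both nonzero, and
by `contract_pow_mul` the product is detected too. -/
theorem mul_notMem_filPred [CharZero k] [IsCocomm k A] {m n : ℕ} {u v : A} (hu : u ∈ fil V m)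
    (hv : v ∈ fil V n) (hu' : u ∉ filPred V m) (hv' : v ∉ filPred V n) :
    u * v ∉ filPred V (m + n) := by
  obtain ⟨φ, hφ, h1⟩ : ∃ φ : A →ₗ[k] k, φ 1 = 0 ∧ (contract φ ^ m) u ≠ 0 := by
    by_contra! hcon
    exact hu' (h.mem_filPred_of_contract_pow hu hcon)
  obtain ⟨χ, hχ, h2⟩ : ∃ χ : A →ₗ[k] k, χ 1 = 0 ∧ (contract χ ^ n) v ≠ 0 := by
    by_contra! hcon
    exact hv' (h.mem_filPred_of_contract_pow hv hcon)
  obtain ⟨P, hP, hP'⟩ := exists_polynomial_contract_pow φ χ m u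
  obtain ⟨Q, hQ, hQ'⟩ := exists_polynomial_contract_pow φ χ n v
  have hP0 : P ≠ 0 := by
    rintro rfl
    have := hP' 0 (by omega)
    simp only [Polynomial.coeff_zero, Nat.choose_zero_right, Nat.cast_one, one_mul, pow_zero,
      Module.End.one_apply, Nat.sub_zero] at this
    exact h1 (eq_zero_of_counit_eq_zero (h.contract_pow_mem hφ m (by simpa using hu)) this.symm)
  have hQ0 : Q ≠ 0 := by
    rintro rfl
    have := hQ' n le_rfl
    simp only [Polynomial.coeff_zero, Nat.choose_self, Nat.cast_one, one_mul, pow_zero,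
      Module.End.one_apply, Nat.sub_self] at this
    exact h2 (eq_zero_of_counit_eq_zero (h.contract_pow_mem hχ n (by simpa using hv)) this.symm)
  obtain ⟨t, ht⟩ : ∃ t, (P * Q).eval t ≠ 0 := by
    by_contra! hcon
    exact mul_ne_zero hP0 hQ0 (Polynomial.funext fun t => by rw [hcon t, Polynomial.eval_zero])
  rw [Polynomial.eval_mul, hP, hQ] at ht
  intro hmem
  have hφχ : (φ + t • χ) 1 = 0 := by simp [hφ, hχ]
  have e := h.contract_pow_mul hφχ rfl hu hv
  rw [h.contract_pow_eq_zero hφχ hmem, eq_comm, smul_eq_zero] at e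
  rcases e with e | e
  · exact (Nat.choose_pos (Nat.le_add_right m n)).ne' (by exact_mod_cast e)
  · have := congrArg (counit (R := k)) e
    rw [Bialgebra.counit_mul, map_zero] at this
    exact ht this

/-- The invertible elements are scalars. -/
theorem exists_smul_one_of_mul_eq_one [CharZero k] [IsCocomm k A] {u v : A} (huv : u * v = 1) :
    ∃ c : k, c • (1 : A) = u := by
  classical
  have h01 : (1 : A) ≠ 0 := by
    intro h0
    have := congrArg (counit (R := k)) h0
    simp at this
  -- Every nonzero element has an exact degree.
  have hmin : ∀ w : A, w ≠ 0 → ∃ n, w ∈ fil V n ∧ w ∉ filPred V n := by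
    intro w hw
    refine ⟨Nat.find (h.exhaust w), Nat.find_spec (h.exhaust w), fun hmem => ?_⟩
    rcases hn : Nat.find (h.exhaust w) with _ | n
    · rw [hn] at hmem
      exact hw (by simpa [filPred] using hmem)
    · rw [hn] at hmem
      exact Nat.find_min (h.exhaust w) (by omega) hmem
  obtain ⟨m, hm, hm'⟩ := hmin u (by rintro rfl; simp at huv; exact h01 huv.symm)
  obtain ⟨n, hn, hn'⟩ := hmin v (by rintro rfl; simp at huv; exact h01 huv.symm)
  have := h.mul_notMem_filPred hm hn hm' hn'
  rw [huv] at this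
  -- Degrees add, but 1 has degree 0; so `u` cannot have positive degree.
  rcases m with _ | m
  · exact mem_fil_zero.1 hm
  · exact absurd (filPred_mono (m := 1) (by omega) (one_mem_fil 0)) this

end PrimGen

end Units

/-! ### The tensor square is primitively generated -/

section PrimGenTensor

variable {k : Type*} {A : Type*} [Field k] [Ring A] [Bialgebra k A]

open Coalgebra (comul counit IsCocomm)

theorem PrimGen.of_adjoin {V : Submodule k A} (h1 : ∀ v ∈ V, IsPrim k v)
    (h2 : ∀ v ∈ V, ∀ w ∈ V, v * w - w * v ∈ V) (h3 : Algebra.adjoin k (V : Set A) = ⊤) :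
    PrimGen V := by
  refine ⟨h1, h2, fun u => ?_⟩
  have hu : u ∈ Algebra.adjoin k (V : Set A) := by rw [h3]; trivial
  induction hu using Algebra.adjoin_induction with
  | mem v hv => exact ⟨1, le_fil_one hv⟩
  | algebraMap c => exact ⟨0, mem_fil_zero.2 ⟨c, (Algebra.algebraMap_eq_smul_one c).symm⟩⟩
  | add a b _ _ ha hb =>
    obtain ⟨m, hm⟩ := ha
    obtain ⟨n, hn⟩ := hb
    exact ⟨m + n, Submodule.add_mem _ (fil_mono (by omega) hm) (fil_mono (by omega) hn)⟩
  | mul a b _ _ ha hb =>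
    obtain ⟨m, hm⟩ := ha
    obtain ⟨n, hn⟩ := hb
    exact ⟨m + n, mul_mem_fil hm hn⟩

/-- The subspace `V ⊗ 1 + 1 ⊗ V` of `A ⊗ A`. -/
def tensorSup (V : Submodule k A) : Submodule k (A ⊗[k] A) :=
  V.map (Algebra.TensorProduct.includeLeft : A →ₐ[k] A ⊗[k] A).toLinearMap ⊔
    V.map (Algebra.TensorProduct.includeRight : A →ₐ[k] A ⊗[k] A).toLinearMap

theorem mem_tensorSup {V : Submodule k A} {z : A ⊗[k] A} :
    z ∈ tensorSup V ↔ ∃ v ∈ V, ∃ w ∈ V, v ⊗ₜ[k] (1 : A) + (1 : A) ⊗ₜ[k] w = z := by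
  simp [tensorSup, Submodule.mem_sup]

/-- Makes the results on units and Adams eigenvalues available for `A ⊗ A`, where twists and
cocycles live. -/
theorem PrimGen.tensor {V : Submodule k A} (h : PrimGen V) : PrimGen (tensorSup V) := by
  refine PrimGen.of_adjoin ?_ ?_ ?_
  · intro z hz
    obtain ⟨v, hv, w, hw, rfl⟩ := mem_tensorSup.1 hz
    have hv := h.isPrim v hv
    have hw := h.isPrim w hw
    rw [IsPrim] at *
    rw [map_add, TensorProduct.comul_tmul, TensorProduct.comul_tmul, hv, hw, Bialgebra.comul_one,
      Algebra.TensorProduct.one_def]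
    simp only [TensorProduct.add_tmul, TensorProduct.tmul_add,
      TensorProduct.AlgebraTensorModule.tensorTensorTensorComm_tmul, map_add]
    abel
  · intro z hz z' hz'
    obtain ⟨v, hv, w, hw, rfl⟩ := mem_tensorSup.1 hz
    obtain ⟨v', hv', w', hw', rfl⟩ := mem_tensorSup.1 hz'
    refine mem_tensorSup.2 ⟨_, h.lie_mem v hv v' hv', _, h.lie_mem w hw w' hw', ?_⟩
    simp only [mul_add, add_mul, Algebra.TensorProduct.tmul_mul_tmul, one_mul, mul_one,
      TensorProduct.sub_tmul, TensorProduct.tmul_sub]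
    abel
  · rw [eq_top_iff]
    rintro z -
    have key : ∀ f : A →ₐ[k] A ⊗[k] A, V.map f.toLinearMap ≤ tensorSup V →
        ∀ u, f u ∈ Algebra.adjoin k (tensorSup V : Set (A ⊗[k] A)) := by
      intro f hf u
      obtain ⟨n, hn⟩ := h.exhaust u
      induction n generalizing u with
      | zero =>
        obtain ⟨c, rfl⟩ := mem_fil_zero.1 hn
        rw [map_smul, map_one]
        exact Subalgebra.smul_mem _ (Subalgebra.one_mem _) c
      | succ n ih =>
        refine fil_succ_le (W := (Subalgebra.toSubmodule
          (Algebra.adjoin k (tensorSup V : Set (A ⊗[k] A)))).comap f.toLinearMap)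
          (fun u hu => ih u hu) (fun v hv u hu => ?_) hn
        rw [Submodule.mem_comap, AlgHom.toLinearMap_apply, map_mul]
        exact Subalgebra.mul_mem _ (Algebra.subset_adjoin (hf ⟨v, hv, rfl⟩)) (ih u hu)
    induction z with
    | zero => exact Subalgebra.zero_mem _
    | add x y hx hy => exact Subalgebra.add_mem _ hx hy
    | tmul u v =>
      have : u ⊗ₜ[k] v = (Algebra.TensorProduct.includeLeft : A →ₐ[k] A ⊗[k] A) u *
        (Algebra.TensorProduct.includeRight : A →ₐ[k] A ⊗[k] A) v := by simp
      rw [this]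
      exact Subalgebra.mul_mem _ (key _ le_sup_left u) (key _ le_sup_right v)

end PrimGenTensor

/-! ### The enveloping algebra as a primitively generated bialgebra -/

section Env

variable (k : Type*) (g : Type*) [Field k] [LieRing g] [LieAlgebra k g]

open Coalgebra (comul counit IsCocomm)

attribute [local instance 100] LieRing.ofAssociativeRing

/-- The linear map `g → U(g)`. -/
abbrev envι : g →ₗ[k] UniversalEnvelopingAlgebra k g :=
  LieHom.toLinearMap (UniversalEnvelopingAlgebra.ι k)

variable {g} in
theorem envι_lie (x y : g) : envι k g ⁅x, y⁆ = envι k g x * envι k g y - envι k g y * envι k g x :=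
  LieHom.map_lie (UniversalEnvelopingAlgebra.ι k) x y

variable {g} in
theorem comul_envι (x : g) :
    comul (R := k) (envι k g x) = envι k g x ⊗ₜ[k] 1 + 1 ⊗ₜ envι k g x :=
  envComul_ι k x

variable {g} in
theorem counit_envι (x : g) : counit (R := k) (envι k g x) = 0 := envCounit_ι k x

/-- By the universal property `U(g)` maps to the subalgebra generated by `g`, and following this by
the inclusion gives the identity, as it does so on `g`. -/
theorem adjoin_range_envι :
    Algebra.adjoin k (LinearMap.range (envι k g) : Set (UniversalEnvelopingAlgebra k g)) = ⊤ := by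
  set S := Algebra.adjoin k
    (LinearMap.range (envι k g) : Set (UniversalEnvelopingAlgebra k g)) with hS
  have hmem : ∀ x : g, envι k g x ∈ S := fun x => Algebra.subset_adjoin ⟨x, rfl⟩
  let f : g →ₗ⁅k⁆ S :=
    { toFun := fun x => ⟨envι k g x, hmem x⟩
      map_add' := fun x y => Subtype.ext (map_add _ x y)
      map_smul' := fun c x => Subtype.ext (map_smul _ c x)
      map_lie' := fun {x y} => Subtype.ext (envι_lie k x y) }
  have h : S.val.comp (UniversalEnvelopingAlgebra.lift k f) = AlgHom.id k _ := by
    refine env_algHom_ext k fun x => ?_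
    rw [AlgHom.comp_apply, UniversalEnvelopingAlgebra.lift_ι_apply]
    rfl
  rw [eq_top_iff]
  rintro u -
  have := DFunLike.congr_fun h u
  rw [AlgHom.id_apply] at this
  rw [← this]
  exact (UniversalEnvelopingAlgebra.lift k f u).2

theorem primGen_env : PrimGen (LinearMap.range (envι k g)) := by
  refine PrimGen.of_adjoin ?_ ?_ (adjoin_range_envι k g)
  · rintro _ ⟨x, rfl⟩
    exact comul_envι k x
  · rintro _ ⟨x, rfl⟩ _ ⟨y, rfl⟩
    exact ⟨⁅x, y⁆, envι_lie k x y⟩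

instance env_isCocomm : IsCocomm k (UniversalEnvelopingAlgebra k g) where
  comm_comp_comul := by
    have h : ((Algebra.TensorProduct.comm k _ _).toAlgHom).comp (envComul k g) = envComul k g := by
      refine env_algHom_ext k fun x => ?_
      rw [AlgHom.comp_apply, envComul_ι]
      simp [add_comm, -UniversalEnvelopingAlgebra.ι_apply]
    exact congrArg AlgHom.toLinearMap h

end Env

/-! ### The free Lie algebra embeds into its enveloping algebra -/

section FreeLie

variable {k : Type*} [Field k] {X : Type*}

attribute [local instance 100] LieRing.ofAssociativeRing

theorem freeLie_mem {S : LieSubalgebra k (FreeLieAlgebra k X)}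
    (h : ∀ x, FreeLieAlgebra.of k x ∈ S) (a : FreeLieAlgebra k X) : a ∈ S := by
  have e : S.incl.comp (FreeLieAlgebra.lift k fun x => (⟨FreeLieAlgebra.of k x, h x⟩ : S)) =
      LieHom.id := by
    ext x
    simp
  have := DFunLike.congr_fun e a
  rw [LieHom.id_apply] at this
  rw [← this]
  exact (FreeLieAlgebra.lift k fun x => (⟨FreeLieAlgebra.of k x, h x⟩ : S)) a |>.2

variable (k X) in
/-- The affine action of the free Lie algebra `L` on `L × k` in which a generator `x` acts by
`(l, c) ↦ (⁅x, l⁆ + c x, 0)`. -/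
def affineAction : FreeLieAlgebra k X →ₗ⁅k⁆ Module.End k (FreeLieAlgebra k X × k) :=
  FreeLieAlgebra.lift k fun x => LinearMap.inl k _ k ∘ₗ
    LinearMap.coprod (LieAlgebra.ad k _ (FreeLieAlgebra.of k x))
      (LinearMap.toSpanSingleton k _ (FreeLieAlgebra.of k x))

variable (k X) in
/-- The derivation of the free Lie algebra that is the identity on the generators. -/
def euler : FreeLieAlgebra k X →ₗ[k] FreeLieAlgebra k X where
  toFun a := (affineAction k X a (0, 1)).1
  map_add' a b := by simp
  map_smul' c a := by simp

/-- The elements that act by this formula form a Lie subalgebra containing the generators. For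
brackets the linear part is the Jacobi identity, and the translation part is read off at `(0, 1)`.
-/
theorem affineAction_apply (a l : FreeLieAlgebra k X) (c : k) :
    affineAction k X a (l, c) = (⁅a, l⁆ + c • euler k X a, 0) := by
  let S : LieSubalgebra k (FreeLieAlgebra k X) :=
    { carrier := {a | ∀ l (c : k), affineAction k X a (l, c) = (⁅a, l⁆ + c • euler k X a, 0)}
      add_mem' := fun {a b} ha hb l c => by
        rw [map_add, LinearMap.add_apply, ha, hb]
        simp only [Prod.mk_add_mk, map_add, add_lie, smul_add, add_zero, Prod.mk.injEq, and_true]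
        abel
      zero_mem' := fun l c => by simp; rfl
      smul_mem' := fun t a ha l c => by
        rw [map_smul, LinearMap.smul_apply, ha]
        simp [smul_comm c t]
      lie_mem' := fun {a b} ha hb => by
        have key : ∀ l (c : k), affineAction k X ⁅a, b⁆ (l, c) =
            (⁅⁅a, b⁆, l⁆ + c • (⁅a, euler k X b⁆ - ⁅b, euler k X a⁆), 0) := by
          intro l c
          rw [LieHom.map_lie, LieRing.of_associative_ring_bracket, LinearMap.sub_apply,
            Module.End.mul_apply, Module.End.mul_apply, ha, hb, ha, hb]
          simp only [Prod.mk_sub_mk, sub_self, zero_smul, add_zero, lie_add, lie_smul, lie_lie,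
            smul_sub, Prod.mk.injEq, and_true]
          abel
        have h2 : euler k X ⁅a, b⁆ = ⁅a, euler k X b⁆ - ⁅b, euler k X a⁆ := by
          change (affineAction k X ⁅a, b⁆ (0, 1)).1 = _
          rw [key]
          simp
        intro l c
        rw [key, h2] }
  have hS : ∀ x, FreeLieAlgebra.of k x ∈ S := by
    intro x l c
    have : ∀ l (c : k), affineAction k X (FreeLieAlgebra.of k x) (l, c) =
        (⁅FreeLieAlgebra.of k x, l⁆ + c • FreeLieAlgebra.of k x, 0) := by
      intro l c
      simp [affineAction]
    rw [this]
    simp [euler, this]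
  exact freeLie_mem hS a l c

theorem euler_of (x : X) : euler k X (FreeLieAlgebra.of k x) = FreeLieAlgebra.of k x := by
  simp [euler, affineAction]

theorem euler_lie (a b : FreeLieAlgebra k X) :
    euler k X ⁅a, b⁆ = ⁅euler k X a, b⁆ + ⁅a, euler k X b⁆ := by
  change (affineAction k X ⁅a, b⁆ (0, 1)).1 = _
  rw [LieHom.map_lie, LieRing.of_associative_ring_bracket, LinearMap.sub_apply,
    Module.End.mul_apply, Module.End.mul_apply]
  simp only [affineAction_apply, lie_zero, one_smul, zero_add, zero_smul, add_zero, Prod.mk_sub_mk]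
  rw [← lie_skew (euler k X a) b]
  abel

/-- The eigenvalue is the degree of a bracket monomial. Eigenvalues add under the bracket, so the
sum of the eigenspaces is a Lie subalgebra containing the generators. -/
theorem iSup_eigenspace_euler :
    ⨆ n : ℕ, Module.End.eigenspace (euler k X) ((n : k) + 1) = ⊤ := by
  rw [eq_top_iff]
  rintro a -
  let S : LieSubalgebra k (FreeLieAlgebra k X) :=
    { (⨆ n : ℕ, Module.End.eigenspace (euler k X) ((n : k) + 1)) with
      lie_mem' := fun {a b} ha hb => by
        change ⁅a, b⁆ ∈ ⨆ n : ℕ, Module.End.eigenspace (euler k X) ((n : k) + 1)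
        change a ∈ ⨆ n : ℕ, Module.End.eigenspace (euler k X) ((n : k) + 1) at ha
        change b ∈ ⨆ n : ℕ, Module.End.eigenspace (euler k X) ((n : k) + 1) at hb
        induction ha using Submodule.iSup_induction' with
        | zero => simp
        | add a a' _ _ ha ha' => rw [add_lie]; exact Submodule.add_mem _ ha ha'
        | mem m a ha =>
          induction hb using Submodule.iSup_induction' with
          | zero => simp
          | add b b' _ _ hb hb' => rw [lie_add]; exact Submodule.add_mem _ hb hb'
          | mem n b hb =>
            refine Submodule.mem_iSup_of_mem (m + n + 1) ?_
            rw [Module.End.mem_eigenspace_iff] at ha hb ⊢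
            rw [euler_lie, ha, hb, smul_lie, lie_smul]
            push_cast
            module }
  refine freeLie_mem (S := S) (fun x => ?_) a
  refine Submodule.mem_iSup_of_mem 0 ?_
  rw [Module.End.mem_eigenspace_iff, euler_of]
  simp

/-- The kernel is the eigenspace for 0, which is independent of the eigenspaces for `n + 1 ≠ 0`, and
these already span. -/
theorem euler_eq_zero [CharZero k] {a : FreeLieAlgebra k X} (h : euler k X a = 0) : a = 0 := by
  have hd := (Module.End.eigenspaces_iSupIndep (euler k X)) 0
  refine Submodule.disjoint_def.1 hd a (by simpa using h) ?_
  have hle : ⨆ n : ℕ, Module.End.eigenspace (euler k X) ((n : k) + 1) ≤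
      ⨆ (j : k) (_ : j ≠ 0), Module.End.eigenspace (euler k X) j :=
    iSup_le fun n => le_iSup₂_of_le ((n : k) + 1) (by exact_mod_cast Nat.succ_ne_zero n) le_rfl
  rw [iSup_eigenspace_euler] at hle
  exact hle trivial

/-- The affine action extends to the enveloping algebra. An element that vanishes there acts by
zero, so its Euler derivative, the value at `(0, 1)`, is zero. -/
theorem envι_freeLie_injective [CharZero k] :
    Function.Injective (envι k (FreeLieAlgebra k X)) := by
  rw [← LinearMap.ker_eq_bot, LinearMap.ker_eq_bot']
  intro a ha
  have h1 : affineAction k X a = 0 := by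
    rw [← UniversalEnvelopingAlgebra.lift_ι_apply k (affineAction k X) a]
    exact (congrArg _ ha).trans (map_zero _)
  refine euler_eq_zero ?_
  change (affineAction k X a (0, 1)).1 = 0
  rw [h1]
  rfl

end FreeLie

/-! ### Passing the embedding to quotient Lie algebras -/

section Quotient

variable {k : Type*} [Field k]

attribute [local instance 100] LieRing.ofAssociativeRing

section

variable {A : Type*} [Ring A] [Bialgebra k A] {V r : Submodule k A}

open Coalgebra (comul)

theorem mul_le_left_mono {P Q R : Submodule k A} (h : P ≤ Q) : P * R ≤ Q * R :=
  mul_le_mul_left h R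

/-- Commuting an element of an ideal `r` of the Lie algebra `V` past a product of `n` elements. -/
theorem commutator_mem_filPred_mul (hr : ∀ y ∈ r, ∀ v ∈ V, y * v - v * y ∈ r) {n : ℕ} {b y : A}
    (hb : b ∈ fil V n) (hy : y ∈ r) : y * b - b * y ∈ filPred V n * r := by
  induction n generalizing b y with
  | zero =>
    obtain ⟨c, rfl⟩ := mem_fil_zero.1 hb
    simp
  | succ n ih =>
    have hle : filPred V n * r ≤ fil V n * r := mul_le_left_mono (filPred_le n)
    refine fil_succ_le (W := (filPred V (n + 1) * r).comap
      (LinearMap.mulLeft k y - LinearMap.mulRight k y))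
      (fun b hb => hle (ih hb hy)) (fun v hv b hb => ?_) hb
    have e : (LinearMap.mulLeft k y - LinearMap.mulRight k y) (v * b) =
        v * (y * b - b * y) + (b * (y * v - v * y) +
          ((y * v - v * y) * b - b * (y * v - v * y))) := by
      simp only [LinearMap.sub_apply, LinearMap.mulLeft_apply, LinearMap.mulRight_apply]
      noncomm_ring
    rw [Submodule.mem_comap, e]
    refine Submodule.add_mem _ ?_ (Submodule.add_mem _
      (Submodule.mul_mem_mul hb (hr y hy v hv)) (hle (ih hb (hr y hy v hv))))
    have h1 : v * (y * b - b * y) ∈ fil V 1 * (filPred V n * r) :=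
      Submodule.mul_mem_mul (le_fil_one hv) (ih hb hy)
    rw [← mul_assoc] at h1
    exact mul_le_left_mono (fil_mul_filPred_le (by omega)) h1

/-- The eigenvalue statement relative to the left ideal generated by `r`: `ψ(uy) = 2ψ(u)y +
u₁[y,u₂]`, and since `r` is an ideal of `V` the correction again ends in `r` with a prefix of lower
degree. -/
theorem PrimGen.adams_sub_mem_mul (h : PrimGen V) (hrV : r ≤ V)
    (hr : ∀ y ∈ r, ∀ v ∈ V, y * v - v * y ∈ r) {n : ℕ} {w : A} (hw : w ∈ fil V n * r) :
    adams k A w - (2 : k) ^ (n + 1) • w ∈ filPred V n * r := by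
  have hle : fil V n * r ≤ (filPred V n * r).comap
      (adams k A - (2 : k) ^ (n + 1) • LinearMap.id) := by
    rw [Submodule.mul_le]
    intro u hu y hy
    let L : A ⊗[k] A →ₗ[k] A := LinearMap.mul' k A ∘ₗ
      TensorProduct.map LinearMap.id (LinearMap.mulLeft k y - LinearMap.mulRight k y)
    have e : ∀ z : A ⊗[k] A, LinearMap.mul' k A (z * (y ⊗ₜ[k] 1 + 1 ⊗ₜ y)) =
        (2 : k) • (LinearMap.mul' k A z * y) + L z := by
      intro z
      induction z with
      | zero => simp
      | add a b ha hb => rw [add_mul, map_add, ha, hb, map_add, map_add, add_mul]; module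
      | tmul a b =>
        simp [L, mul_add, two_smul, mul_sub, mul_assoc]
        abel
    have hL : L (comul u) ∈ filPred V n * r := by
      have hle : tensorFil V n ≤ (filPred V n * r).comap L := by
        refine tensorFil_le fun i j hij a ha b hb => ?_
        have e3 : L (a ⊗ₜ b) = a * (y * b - b * y) := by simp [L]
        rw [Submodule.mem_comap, e3]
        have h1 : a * (y * b - b * y) ∈ fil V i * (filPred V j * r) :=
          Submodule.mul_mem_mul ha (commutator_mem_filPred_mul hr hb hy)
        rw [← mul_assoc] at h1
        exact mul_le_left_mono (fil_mul_filPred_le hij) h1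
      exact hle (h.comul_mem hu)
    have e2 : adams k A (u * y) - (2 : k) ^ (n + 1) • (u * y) =
        (2 : k) • ((adams k A u - (2 : k) ^ n • u) * y) + L (comul u) := by
      rw [adams, LinearMap.comp_apply, Bialgebra.comul_mul, h.isPrim y (hrV hy), e,
        LinearMap.comp_apply, sub_mul, smul_mul_assoc, pow_succ']
      module
    change adams k A (u * y) - (2 : k) ^ (n + 1) • (u * y) ∈ filPred V n * r
    rw [e2]
    exact Submodule.add_mem _ (Submodule.smul_mem _ _
      (Submodule.mul_mem_mul (h.adams_sub_mem hu) hy)) hL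
  exact hle hw

/-- The degree descent of `mem_of_isPrim`, inside the filtration `fil V n * r`. -/
theorem PrimGen.mem_of_mem_top_mul [CharZero k] (h : PrimGen V) (hrV : r ≤ V)
    (hr : ∀ y ∈ r, ∀ v ∈ V, y * v - v * y ∈ r) {p : A} (hp : IsPrim k p)
    (hmem : p ∈ (⊤ : Submodule k A) * r) : p ∈ r := by
  have h1 : ∀ n : ℕ, p ∈ fil V n * r → p ∈ r := by
    intro n
    induction n with
    | zero => rw [fil_zero, one_mul]; exact id
    | succ n ih =>
      intro hn
      refine ih ?_
      have := h.adams_sub_mem_mul hrV hr hn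
      rw [hp.adams_eq, ← sub_smul] at this
      refine (Submodule.smul_mem_iff _ ?_).1 this
      have h2 : (2 : k) - 2 ^ (n + 1 + 1) = -(((2 ^ (n + 2) - 2 : ℕ)) : k) := by
        rw [Nat.cast_sub]
        · push_cast; ring
        · rw [pow_succ]; have := Nat.one_le_two_pow (n := n + 1); omega
      rw [h2, neg_ne_zero, Nat.cast_ne_zero]
      have := Nat.one_le_two_pow (n := n)
      rw [pow_add]
      omega
  have h2 : ∃ n, p ∈ fil V n * r := by
    clear h1 hp
    induction hmem using Submodule.mul_induction_on' with
    | mem_mul_mem u _ y hy =>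
      obtain ⟨n, hn⟩ := h.exhaust u
      exact ⟨n, Submodule.mul_mem_mul hn hy⟩
    | add x _ y _ hx hy =>
      obtain ⟨m, hm⟩ := hx
      obtain ⟨n, hn⟩ := hy
      exact ⟨m + n, Submodule.add_mem _
        (mul_le_left_mono (fil_mono (by omega)) hm)
        (mul_le_left_mono (fil_mono (by omega)) hn)⟩
  obtain ⟨n, hn⟩ := h2
  exact h1 n hn

end

variable {L g : Type*} [LieRing L] [LieAlgebra k L] [LieRing g] [LieAlgebra k g]

/-- With `r = ker π`, the algebra `U(L)/U(L)r` receives `g` through a linear section `s` of `π`. If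
`x` dies in `U(g)`, then `s x` is a primitive element of `U(L)r`, so it lies in `r`, and `x = π(s x)
= 0`. -/
theorem envι_injective_of_surjective [CharZero k] (π : L →ₗ⁅k⁆ g) (hπ : Function.Surjective π)
    (hL : Function.Injective (envι k L)) : Function.Injective (envι k g) := by
  set V := LinearMap.range (envι k L) with hV
  set r : Submodule k (UniversalEnvelopingAlgebra k L) :=
    (LinearMap.ker (π : L →ₗ[k] g)).map (envι k L) with hr
  have hPG : PrimGen V := primGen_env k L
  have hrV : r ≤ V := LinearMap.map_le_range
  have hrid : ∀ y ∈ r, ∀ v ∈ V, y * v - v * y ∈ r := by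
    rintro _ ⟨y, hy, rfl⟩ _ ⟨v, rfl⟩
    refine ⟨⁅y, v⁆, ?_, envι_lie k y v⟩
    have : π y = 0 := hy
    simp [this]
  let I : Ideal (UniversalEnvelopingAlgebra k L) :=
    { ((⊤ : Submodule k (UniversalEnvelopingAlgebra k L)) * r).toAddSubmonoid with
      smul_mem' := fun a x hx => by
        have : a * x ∈ (⊤ : Submodule k (UniversalEnvelopingAlgebra k L)) * (⊤ * r) :=
          Submodule.mul_mem_mul trivial hx
        rw [← mul_assoc] at this
        exact mul_le_left_mono le_top this }
  have hI : ∀ a, a ∈ I ↔ a ∈ (⊤ : Submodule k (UniversalEnvelopingAlgebra k L)) * r :=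
    fun a => Iff.rfl
  -- Since `r` is an ideal of `V`, moving an element of `r` to the right past any element costs only
  -- terms that end in `r`.
  have : I.IsTwoSided := ⟨fun {a} b ha => by
    rw [hI] at ha ⊢
    induction ha using Submodule.mul_induction_on' with
    | mem_mul_mem u _ y hy =>
      obtain ⟨n, hn⟩ := hPG.exhaust b
      have e : u * y * b = u * b * y + u * (y * b - b * y) := by noncomm_ring
      rw [e]
      refine Submodule.add_mem _ (Submodule.mul_mem_mul trivial hy) ?_
      have h1 : u * (y * b - b * y) ∈
          (⊤ : Submodule k (UniversalEnvelopingAlgebra k L)) * (filPred V n * r) :=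
        Submodule.mul_mem_mul trivial (commutator_mem_filPred_mul hrid hn hy)
      rw [← mul_assoc] at h1
      exact mul_le_left_mono le_top h1
    | add x _ y _ hx hy => rw [add_mul]; exact Submodule.add_mem _ hx hy⟩
  obtain ⟨s, hs⟩ := (π : L →ₗ[k] g).exists_rightInverse_of_surjective
    (LinearMap.range_eq_top.2 hπ)
  have hs' : ∀ x, π (s x) = x := fun x => LinearMap.congr_fun hs x
  let mk := Ideal.Quotient.mkₐ k I
  have hmk : ∀ l, π l = 0 → mk (envι k L l) = 0 := by
    intro l hl
    refine Ideal.Quotient.eq_zero_iff_mem.2 ((hI _).2 ?_)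
    rw [← one_mul (envι k L l)]
    exact Submodule.mul_mem_mul trivial ⟨l, hl, rfl⟩
  -- The linear section fails to respect brackets only by elements of `ker π`, which die in the
  -- quotient.
  let f : g →ₗ⁅k⁆ (UniversalEnvelopingAlgebra k L ⧸ I) :=
    { mk.toLinearMap ∘ₗ envι k L ∘ₗ s with
      map_lie' := fun {x y} => by
        change mk (envι k L (s ⁅x, y⁆)) =
          mk (envι k L (s x)) * mk (envι k L (s y)) - mk (envι k L (s y)) * mk (envι k L (s x))
        rw [← map_mul mk, ← map_mul mk, ← map_sub mk, ← envι_lie, ← sub_eq_zero, ← map_sub,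
          ← map_sub]
        exact hmk _ (by simp [hs']) }
  rw [← LinearMap.ker_eq_bot, LinearMap.ker_eq_bot']
  intro x hx
  have h1 : mk (envι k L (s x)) = 0 := by
    change f x = 0
    rw [← UniversalEnvelopingAlgebra.lift_ι_apply k f x]
    exact (congrArg _ hx).trans (map_zero _)
  have h2 : envι k L (s x) ∈ I := Ideal.Quotient.eq_zero_iff_mem.1 h1
  obtain ⟨l, hl, e⟩ := hPG.mem_of_mem_top_mul hrV hrid (comul_envι k (s x)) ((hI _).1 h2)
  rw [← hs' x, ← hL e]
  exact hl

variable (k g) in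
/-- A Lie algebra over a field of characteristic zero embeds into its enveloping algebra. -/
theorem envι_injective [CharZero k] : Function.Injective (envι k g) :=
  envι_injective_of_surjective (FreeLieAlgebra.lift k (id : g → g))
    (fun x => ⟨FreeLieAlgebra.of k x, by simp⟩) envι_freeLie_injective

end Quotient

/-! ### Additive 2-cocycles of the cobar complex -/

section Cocycle

variable {k : Type*} {A : Type*} [Field k] [Ring A] [Bialgebra k A]

open Coalgebra (comul counit IsCocomm)

/-- An additive 2-cocycle of the cobar complex. -/
def IsCocycle (f : A ⊗[k] A) : Prop :=
  tensorOne k A f + comulTensor k A f = oneTensor k A f + tensorComul k A f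

theorem tensorOne_tmul (a b : A) : tensorOne k A (a ⊗ₜ b) = a ⊗ₜ (b ⊗ₜ 1) := by
  simp [tensorOne]

theorem oneTensor_apply (z : A ⊗[k] A) : oneTensor k A z = 1 ⊗ₜ z := by
  simp [oneTensor]

theorem tensorComul_tmul (a b : A) : tensorComul k A (a ⊗ₜ b) = a ⊗ₜ comul b := by
  simp [tensorComul]

theorem comulTensor_tmul (a b : A) :
    comulTensor k A (a ⊗ₜ b) = TensorProduct.assoc k A A A (comul a ⊗ₜ b) := by
  simp only [comulTensor, AlgHom.comp_apply, Algebra.TensorProduct.map_tmul]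
  rfl

theorem counitTensor_tmul (a b : A) :
    counitTensor k A (a ⊗ₜ b) = counit (R := k) a • b := by
  simp [counitTensor]

theorem tensorCounit_tmul (a b : A) :
    tensorCounit k A (a ⊗ₜ b) = counit (R := k) b • a := by
  simp [tensorCounit]

section Evaluation

variable {C : Type*} [Ring C] [Algebra k C]

/-- The linear map `a ⊗ b ↦ α(a) β(b)`. -/
def evalPair (α β : A →ₗ[k] C) : A ⊗[k] A →ₗ[k] C := LinearMap.mul' k C ∘ₗ TensorProduct.map α β

@[simp]
theorem evalPair_tmul (α β : A →ₗ[k] C) (a b : A) : evalPair α β (a ⊗ₜ b) = α a * β b := by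
  simp [evalPair]

/-- The convolution product `u ↦ α(u₁) β(u₂)`. -/
def conv (α β : A →ₗ[k] C) : A →ₗ[k] C := evalPair α β ∘ₗ comul

theorem conv_apply (α β : A →ₗ[k] C) (u : A) : conv α β u = evalPair α β (comul u) := rfl

theorem conv_one {α β : A →ₗ[k] C} (hα : α 1 = 1) (hβ : β 1 = 1) : conv α β 1 = 1 := by
  simp [conv, hα, hβ, Algebra.TensorProduct.one_def]

/-- The linear map `a ⊗ b ⊗ c ↦ α(a) β(b) γ(c)`. -/
def evalTriple (α β γ : A →ₗ[k] C) : A ⊗[k] (A ⊗[k] A) →ₗ[k] C :=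
  LinearMap.mul' k C ∘ₗ TensorProduct.map α (evalPair β γ)

@[simp]
theorem evalTriple_tmul (α β γ : A →ₗ[k] C) (a : A) (z : A ⊗[k] A) :
    evalTriple α β γ (a ⊗ₜ z) = α a * evalPair β γ z := by
  simp [evalTriple]

theorem evalTriple_tensorOne (α β : A →ₗ[k] C) {γ : A →ₗ[k] C} (hγ : γ 1 = 1) (f : A ⊗[k] A) :
    evalTriple α β γ (tensorOne k A f) = evalPair α β f := by
  induction f with
  | zero => simp
  | add x y hx hy => simp only [map_add, hx, hy]
  | tmul a b => simp [tensorOne_tmul, hγ]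

theorem evalTriple_oneTensor {α : A →ₗ[k] C} (β γ : A →ₗ[k] C) (hα : α 1 = 1) (f : A ⊗[k] A) :
    evalTriple α β γ (oneTensor k A f) = evalPair β γ f := by
  simp [oneTensor_apply, hα]

theorem evalTriple_tensorComul (α β γ : A →ₗ[k] C) (f : A ⊗[k] A) :
    evalTriple α β γ (tensorComul k A f) = evalPair α (conv β γ) f := by
  induction f with
  | zero => simp
  | add x y hx hy => simp only [map_add, hx, hy]
  | tmul a b => simp [tensorComul_tmul, conv_apply]

theorem evalTriple_comulTensor (α β γ : A →ₗ[k] C) (f : A ⊗[k] A) :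
    evalTriple α β γ (comulTensor k A f) = evalPair (conv α β) γ f := by
  induction f with
  | zero => simp
  | add x y hx hy => simp only [map_add, hx, hy]
  | tmul a b =>
    rw [comulTensor_tmul, evalPair_tmul, conv_apply]
    induction comul (R := k) a with
    | zero => simp
    | add x y hx hy => simp only [TensorProduct.add_tmul, map_add, hx, hy, add_mul]
    | tmul c d => simp [mul_assoc]

theorem conv_assoc (α β γ : A →ₗ[k] C) : conv (conv α β) γ = conv α (conv β γ) := by
  ext u
  rw [conv_apply, conv_apply, ← evalTriple_tensorComul, ← evalTriple_comulTensor]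
  exact congrArg _ (Coalgebra.coassoc_apply u)

/-- Linear maps to a test algebra `C` are treated as points that multiply by convolution; the
cocycle equation becomes the group 2-cocycle identity `f(α,β) + f(αβ,γ) = f(β,γ) + f(α,βγ)`. The
normalisations at 1 remove the idle tensor factor. -/
theorem IsCocycle.evalPair_add {f : A ⊗[k] A} (hf : IsCocycle f) {α γ : A →ₗ[k] C}
    (β : A →ₗ[k] C) (hα : α 1 = 1) (hγ : γ 1 = 1) :
    evalPair α β f + evalPair (conv α β) γ f = evalPair β γ f + evalPair α (conv β γ) f := by
  have := congrArg (evalTriple α β γ) hf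
  rwa [map_add, map_add, evalTriple_tensorOne α β hγ, evalTriple_comulTensor,
    evalTriple_oneTensor β γ hα, evalTriple_tensorComul] at this

theorem evalPair_swap {α β : A →ₗ[k] C} (h : ∀ a b, Commute (α a) (β b)) (f : A ⊗[k] A) :
    evalPair β α f = evalPair α β (TensorProduct.comm k A A f) := by
  induction f with
  | zero => simp
  | add x y hx hy => simp only [map_add, hx, hy]
  | tmul a b => simp [(h b a).eq]

theorem conv_swap [IsCocomm k A] {α β : A →ₗ[k] C} (h : ∀ a b, Commute (α a) (β b)) :
    conv β α = conv α β := by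
  ext u
  rw [conv_apply, conv_apply, evalPair_swap h, Coalgebra.comm_comul]

theorem commute_conv {α β γ : A →ₗ[k] C} (h1 : ∀ a b, Commute (α a) (γ b))
    (h2 : ∀ a b, Commute (β a) (γ b)) (u b : A) : Commute (conv α β u) (γ b) := by
  rw [conv_apply]
  induction comul (R := k) u with
  | zero => simp
  | add x y hx hy => rw [map_add]; exact hx.add_left hy
  | tmul c d => rw [evalPair_tmul]; exact (h1 c b).mul_left (h2 d b)

/-- A skew-symmetric cocycle is additive in the first argument. -/
theorem IsCocycle.evalPair_conv_of_skew [CharZero k] [IsCocomm k A] {f : A ⊗[k] A}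
    (hf : IsCocycle f) (hskew : TensorProduct.comm k A A f = -f) {α β γ : A →ₗ[k] C}
    (hα : α 1 = 1) (hβ : β 1 = 1) (hγ : γ 1 = 1) (hαβ : ∀ a b, Commute (α a) (β b))
    (hβγ : ∀ a b, Commute (β a) (γ b)) (hαγ : ∀ a b, Commute (α a) (γ b)) :
    evalPair (conv α β) γ f = evalPair α γ f + evalPair β γ f := by
  have hsw : ∀ {α β : A →ₗ[k] C}, (∀ a b, Commute (α a) (β b)) →
      evalPair β α f = -evalPair α β f := fun h => by rw [evalPair_swap h, hskew, map_neg]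
  have hγα : ∀ a b, Commute (γ a) (α b) := fun a b => (hαγ b a).symm
  -- The identity at the three cyclic rotations of `(α, β, γ)`: in the first plus the third minus
  -- the second, skew symmetry leaves twice the claim.
  have e1 := hf.evalPair_add β hα hγ
  have e2 := hf.evalPair_add γ hβ hα
  have e3 := hf.evalPair_add α hγ hβ
  rw [hsw (commute_conv (fun a b => (hαβ b a).symm) hγα)] at e1
  rw [hsw (commute_conv (fun a b => (hβγ b a).symm) hαβ)] at e2
  rw [hsw (commute_conv hαγ hβγ)] at e3
  rw [hsw hαγ] at e2 e3
  have e4 : (2 : k) • evalPair (conv α β) γ f = (2 : k) • (evalPair α γ f + evalPair β γ f) := by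
    simp only [two_smul]
    have := congrArg₂ (· - ·) (congrArg₂ (· + ·) e1 e3) e2
    rw [← sub_eq_zero] at this ⊢
    rw [← this]
    abel
  exact smul_right_injective _ (two_ne_zero) e4

end Evaluation

variable (k) in
/-- The coboundary `a ↦ a ⊗ 1 + 1 ⊗ a - Δ(a)`. -/
def cobd : A →ₗ[k] A ⊗[k] A :=
  (Algebra.TensorProduct.includeLeft : A →ₐ[k] A ⊗[k] A).toLinearMap +
    (Algebra.TensorProduct.includeRight : A →ₐ[k] A ⊗[k] A).toLinearMap - comul

theorem cobd_apply (a : A) : cobd k a = a ⊗ₜ 1 + 1 ⊗ₜ a - comul a := rfl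

theorem isCocycle_cobd (a : A) : IsCocycle (cobd k a) := by
  have h : comulTensor k A (comul a) = tensorComul k A (comul a) := Coalgebra.coassoc_apply a
  have h1 : comulTensor k A ((1 : A) ⊗ₜ a) = 1 ⊗ₜ (1 ⊗ₜ a) := by
    rw [comulTensor_tmul, Bialgebra.comul_one, Algebra.TensorProduct.one_def,
      TensorProduct.assoc_tmul]
  have h2 : comulTensor k A (a ⊗ₜ (1 : A)) = tensorOne k A (comul a) := by
    rw [comulTensor_tmul]
    simp [tensorOne]
    rfl
  rw [IsCocycle, cobd_apply]
  simp only [map_sub, map_add, h, h1, h2, tensorOne_tmul, oneTensor_apply, tensorComul_tmul,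
    Bialgebra.comul_one, Algebra.TensorProduct.one_def]
  abel

theorem comm_cobd [IsCocomm k A] (a : A) :
    TensorProduct.comm k A A (cobd k a) = cobd k a := by
  rw [cobd_apply, map_sub, Coalgebra.comm_comul]
  simp [add_comm]

theorem counitTensor_comul (a : A) : counitTensor k A (comul a) = a := by
  have := Coalgebra.rTensor_counit_comul (R := k) a
  change TensorProduct.lid k A (LinearMap.rTensor A counit (comul a)) = a
  rw [this]; simp

theorem tensorCounit_comul (a : A) : tensorCounit k A (comul a) = a := by
  have := Coalgebra.lTensor_counit_comul (R := k) a
  change TensorProduct.rid k A (LinearMap.lTensor A counit (comul a)) = a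
  rw [this]; simp

theorem counitTensor_cobd {a : A} (ha : counit (R := k) a = 0) :
    counitTensor k A (cobd k a) = 0 := by
  rw [cobd_apply, map_sub, map_add, counitTensor_comul, counitTensor_tmul, counitTensor_tmul, ha]
  simp

theorem tensorCounit_cobd {a : A} (ha : counit (R := k) a = 0) :
    tensorCounit k A (cobd k a) = 0 := by
  rw [cobd_apply, map_sub, map_add, tensorCounit_comul, tensorCounit_tmul, tensorCounit_tmul, ha]
  simp

variable (k A) in
/-- The central elements of counit zero. -/
def centralAug : Submodule k A :=
  Subalgebra.toSubmodule (Subalgebra.center k A) ⊓ LinearMap.ker (counit (R := k))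

theorem mem_centralAug {a : A} :
    a ∈ centralAug k A ↔ (∀ u, u * a = a * u) ∧ counit (R := k) a = 0 := by
  simp [centralAug, Subalgebra.mem_center_iff]

theorem commute_tmul_one {a : A} (ha : ∀ u, u * a = a * u) (z : A ⊗[k] A) :
    Commute z (a ⊗ₜ 1) := by
  induction z with
  | zero => simp
  | add x y hx hy => exact hx.add_left hy
  | tmul u v => simp [Commute, SemiconjBy, ha u]

theorem commute_one_tmul {a : A} (ha : ∀ u, u * a = a * u) (z : A ⊗[k] A) :
    Commute z (1 ⊗ₜ a) := by
  induction z with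
  | zero => simp
  | add x y hx hy => exact hx.add_left hy
  | tmul u v => simp [Commute, SemiconjBy, ha v]

theorem commute_comul_cobd {a : A} (ha : ∀ u, u * a = a * u) (u : A) :
    Commute (comul (R := k) u) (cobd k a) := by
  rw [cobd_apply]
  refine ((commute_tmul_one ha _).add_right (commute_one_tmul ha _)).sub_right ?_
  rw [Commute, SemiconjBy, ← Bialgebra.comul_mul, ← Bialgebra.comul_mul, ha]

/-- The Adams operation on a symmetric cocycle. -/
theorem IsCocycle.map_adams [IsCocomm k A] {f : A ⊗[k] A} (hf : IsCocycle f)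
    (hsym : TensorProduct.comm k A A f = f) :
    TensorProduct.map (adams k A) (adams k A) f =
      (2 : k) • f - cobd k (LinearMap.mul' k A f) := by
  let x : A →ₗ[k] A ⊗[k] A := (Algebra.TensorProduct.includeLeft : A →ₐ[k] A ⊗[k] A).toLinearMap
  let y : A →ₗ[k] A ⊗[k] A := (Algebra.TensorProduct.includeRight : A →ₐ[k] A ⊗[k] A).toLinearMap
  have hx : ∀ a, x a = a ⊗ₜ 1 := fun _ => rfl
  have hy : ∀ a, y a = 1 ⊗ₜ a := fun _ => rfl
  have hx1 : x 1 = 1 := rfl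
  have hy1 : y 1 = 1 := rfl
  have hcomm : ∀ a b, Commute (x a) (y b) := fun a b => by
    simp [hx, hy, Commute, SemiconjBy]
  have hid : evalPair x y = LinearMap.id := by
    ext a b; simp [hx, hy]
  have hxy : conv x y = comul := by rw [conv, hid, LinearMap.id_comp]
  have hyx : conv y x = conv x y := conv_swap hcomm
  have hxx : ∀ z, evalPair x x z = x (LinearMap.mul' k A z) := fun z => by
    induction z with
    | zero => simp
    | add a b ha hb => simp only [map_add, ha, hb]
    | tmul a b => simp [hx]
  have hyy : ∀ z, evalPair y y z = y (LinearMap.mul' k A z) := fun z => by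
    induction z with
    | zero => simp
    | add a b ha hb => simp only [map_add, ha, hb]
    | tmul a b => simp [hy]
  have hΔΔ : ∀ z, evalPair (conv x y) (conv x y) z = comul (LinearMap.mul' k A z) := fun z => by
    rw [hxy]
    induction z with
    | zero => simp
    | add a b ha hb => simp only [map_add, ha, hb]
    | tmul a b => simp
  have hψ : ∀ z, evalPair (conv x x) (conv y y) z =
      TensorProduct.map (adams k A) (adams k A) z := fun z => by
    induction z with
    | zero => simp
    | add a b ha hb => simp only [map_add, ha, hb]
    | tmul a b => simp [conv_apply, hxx, hyy, hx, hy, adams]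
  -- The cocycle identity at `(x, x, y²)`, `(x, y, xy)` and `(y, y, x)`. In the first plus the third
  -- minus the second, symmetry gives `f(x²,y²) = 2f - (f(x,x) + f(y,y) - f(xy,xy))`, where `f(x,y)`
  -- is `f` itself and the bracket is the coboundary of the product of `f`.
  have e1 := hf.evalPair_add (α := x) (γ := conv y y) x hx1 (conv_one hy1 hy1)
  have e2 := hf.evalPair_add (α := x) (γ := conv x y) y hx1 (conv_one hx1 hy1)
  have e3 := hf.evalPair_add (α := y) (γ := x) y hy1 hx1
  have e4 : conv x (conv y y) = conv y (conv x y) := by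
    rw [← conv_assoc, ← hyx, conv_assoc, hyx]
  have e5 : evalPair y x f = f := by
    rw [evalPair_swap hcomm, hsym, hid, LinearMap.id_apply]
  have e6 : evalPair (conv y y) x f = evalPair x (conv y y) f := by
    rw [evalPair_swap (fun a b => (commute_conv (fun a b => (hcomm b a).symm)
      (fun a b => (hcomm b a).symm) b a).symm), hsym]
  rw [hyx, e5, e6] at e3
  rw [e4, hψ, hxx] at e1
  rw [hid, LinearMap.id_apply, hΔΔ] at e2
  rw [hyy] at e3
  rw [cobd_apply, two_smul, ← hx, ← hy]
  have := congrArg₂ (· - ·) (congrArg₂ (· + ·) e1 e3) e2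
  rw [← sub_eq_zero] at this ⊢
  rw [← this]
  abel

theorem adams_tensor (f : A ⊗[k] A) :
    adams k (A ⊗[k] A) f = TensorProduct.map (adams k A) (adams k A) f := by
  induction f with
  | zero => simp
  | add x y hx hy => simp only [map_add, hx, hy]
  | tmul a b =>
    rw [adams, LinearMap.comp_apply, TensorProduct.comul_tmul, TensorProduct.map_tmul, adams,
      LinearMap.comp_apply, LinearMap.comp_apply]
    induction comul (R := k) a with
    | zero => simp
    | add x y hx hy => simp only [TensorProduct.add_tmul, map_add, hx, hy]
    | tmul a a' =>
      induction comul (R := k) b with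
      | zero => simp
      | add x y hx hy => simp only [TensorProduct.tmul_add, map_add, hx, hy]
      | tmul b b' => simp

theorem PrimGen.central_of_commute {V : Submodule k A} (h : PrimGen V) {a : A}
    (ha : ∀ v ∈ V, v * a = a * v) (u : A) : u * a = a * u := by
  obtain ⟨n, hn⟩ := h.exhaust u
  induction n generalizing u with
  | zero =>
    obtain ⟨c, rfl⟩ := mem_fil_zero.1 hn
    simp
  | succ n ih =>
    have hle : fil V (n + 1) ≤ LinearMap.ker (LinearMap.mulRight k a - LinearMap.mulLeft k a) := by
      refine fil_succ_le (fun u hu => ?_) (fun v hv u hu => ?_)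
      · simp [ih u hu]
      · simp only [LinearMap.mem_ker, LinearMap.sub_apply, LinearMap.mulRight_apply,
          LinearMap.mulLeft_apply]
        rw [mul_assoc, ih u hu, ← mul_assoc, ha v hv, mul_assoc, sub_self]
    simpa [sub_eq_zero] using hle hn

/-- Multiplying out the commutator of `Δ(v)` with `f`, for `v` primitive, leaves the commutator of
`v` with the product of `f`. -/
theorem PrimGen.mul_mem_centralAug {V : Submodule k A} (h : PrimGen V) {f : A ⊗[k] A}
    (hinv : ∀ u, Commute (comul (R := k) u) f) (hcounit : counitTensor k A f = 0) :
    LinearMap.mul' k A f ∈ centralAug k A := by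
  refine mem_centralAug.2 ⟨h.central_of_commute fun v hv => ?_, ?_⟩
  · have h1 := (hinv v).eq
    rw [h.isPrim v hv] at h1
    have h2 : ∀ z : A ⊗[k] A, LinearMap.mul' k A ((v ⊗ₜ 1 + 1 ⊗ₜ v) * z) -
        LinearMap.mul' k A (z * (v ⊗ₜ 1 + 1 ⊗ₜ v)) =
        v * LinearMap.mul' k A z - LinearMap.mul' k A z * v := by
      intro z
      induction z with
      | zero => simp
      | add x y hx hy =>
        simp only [map_add, mul_add, add_mul] at hx hy ⊢
        rw [← sub_eq_zero] at hx hy ⊢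
        rw [← add_zero (0 : A)]
        nth_rewrite 1 [← hx]
        rw [← hy]
        abel
      | tmul a b =>
        simp [add_mul, mul_add]
        noncomm_ring
    have h3 := h2 f
    rw [h1, sub_self, eq_comm, sub_eq_zero] at h3
    exact h3
  · have : ∀ z : A ⊗[k] A, counit (R := k) (LinearMap.mul' k A z) =
        counit (R := k) (counitTensor k A z) := by
      intro z
      induction z with
      | zero => simp
      | add x y hx hy => simp only [map_add, hx, hy]
      | tmul a b => simp [counitTensor_tmul]
    rw [this, hcounit, map_zero]

/-- A symmetric invariant cocycle is the coboundary of a central element. -/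
theorem PrimGen.exists_cobd_eq [CharZero k] [IsCocomm k A] {V : Submodule k A} (h : PrimGen V)
    {f : A ⊗[k] A} (hf : IsCocycle f) (hsym : TensorProduct.comm k A A f = f)
    (hinv : ∀ u, Commute (comul (R := k) u) f) (hl : counitTensor k A f = 0)
    (hr : tensorCounit k A f = 0) : ∃ a ∈ centralAug k A, cobd k a = f := by
  -- Induction on the degree in `A ⊗ A`. The Adams operation gives `2f - cobd(m(f))` by symmetry and
  -- `2^(n+2) f` up to lower degree, so `(2 - 2^(n+2)) f - cobd(m(f))` is a cocycle of the same kind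
  -- and of lower degree.
  have key : ∀ n : ℕ, ∀ f : A ⊗[k] A, f ∈ fil (tensorSup V) (n + 1) → IsCocycle f →
      TensorProduct.comm k A A f = f → (∀ u, Commute (comul (R := k) u) f) →
      counitTensor k A f = 0 → tensorCounit k A f = 0 → ∃ a ∈ centralAug k A, cobd k a = f := by
    intro n
    induction n with
    | zero =>
      intro f hmem hf hsym hinv hl hr
      -- In degree at most 1 the cocycle is `c + v ⊗ 1 + 1 ⊗ w`, and the two counit conditions make
      -- it zero.
      refine ⟨0, Submodule.zero_mem _, ?_⟩
      rw [zero_add, fil, pow_one] at hmem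
      obtain ⟨c, hc, z, hz, rfl⟩ := Submodule.mem_sup.1 hmem
      obtain ⟨c, rfl⟩ := Submodule.mem_one.1 hc
      obtain ⟨v, hv, w, hw, rfl⟩ := mem_tensorSup.1 hz
      rw [map_add, map_add, AlgHom.commutes, counitTensor_tmul, counitTensor_tmul,
        (h.isPrim v hv).counit_eq_zero] at hl
      rw [map_add, map_add, AlgHom.commutes, tensorCounit_tmul, tensorCounit_tmul,
        (h.isPrim w hw).counit_eq_zero] at hr
      simp only [zero_smul, zero_add, Bialgebra.counit_one, one_smul, add_zero] at hl hr
      have hc0 := congrArg (counit (R := k)) hl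
      rw [map_add, Bialgebra.counit_algebraMap, (h.isPrim w hw).counit_eq_zero, add_zero,
        map_zero] at hc0
      rw [hc0, map_zero, zero_add] at hl hr
      simp [hl, hr, hc0]
    | succ n ih =>
      intro f hmem hf hsym hinv hl hr
      have hm := h.mul_mem_centralAug hinv hl
      obtain ⟨hm1, hm2⟩ := mem_centralAug.1 hm
      have hlow := h.tensor.adams_sub_mem hmem
      rw [adams_tensor, hf.map_adams hsym] at hlow
      set d : k := 2 - 2 ^ (n + 1 + 1) with hd
      have hd0 : d ≠ 0 := by
        have h2 : d = -(((2 ^ (n + 2) - 2 : ℕ)) : k) := by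
          rw [hd, Nat.cast_sub]
          · push_cast; ring
          · rw [pow_succ]; have := Nat.one_le_two_pow (n := n + 1); omega
        rw [h2, neg_ne_zero, Nat.cast_ne_zero]
        have := Nat.one_le_two_pow (n := n)
        rw [pow_add]
        omega
      have e : (2 : k) • f - cobd k (LinearMap.mul' k A f) - (2 : k) ^ (n + 1 + 1) • f =
          d • f - cobd k (LinearMap.mul' k A f) := by rw [hd]; module
      rw [e] at hlow
      have hcoc : IsCocycle (d • f - cobd k (LinearMap.mul' k A f)) := by
        have h1 := isCocycle_cobd (k := k) (LinearMap.mul' k A f)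
        rw [IsCocycle] at hf h1 ⊢
        simp only [map_sub, map_smul]
        rw [sub_add_sub_comm, ← smul_add, hf, h1, smul_add, add_sub_add_comm]
      obtain ⟨a, ha, hae⟩ := ih _ hlow hcoc (by rw [map_sub, map_smul, hsym, comm_cobd])
        (fun u => ((hinv u).smul_right d).sub_right (commute_comul_cobd hm1 u))
        (by rw [map_sub, map_smul, hl, smul_zero, counitTensor_cobd hm2, sub_zero])
        (by rw [map_sub, map_smul, hr, smul_zero, tensorCounit_cobd hm2, sub_zero])
      refine ⟨d⁻¹ • (a + LinearMap.mul' k A f),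
        Submodule.smul_mem _ _ (Submodule.add_mem _ ha hm), ?_⟩
      rw [map_smul, map_add, hae, sub_add_cancel, smul_smul, inv_mul_cancel₀ hd0, one_smul]
  obtain ⟨n, hn⟩ := h.tensor.exhaust f
  exact key n f (fil_mono (Nat.le_succ n) hn) hf hsym hinv hl hr

/-- The cocycle identity evaluated at the three tensor embeddings in reverse order. Cocommutativity
makes the reversed coproducts equal to the original ones, and the two sides change places. -/
theorem IsCocycle.comm [IsCocomm k A] {f : A ⊗[k] A} (hf : IsCocycle f) :
    IsCocycle (TensorProduct.comm k A A f) := by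
  let i : A →ₗ[k] A ⊗[k] (A ⊗[k] A) :=
    (Algebra.TensorProduct.includeLeft : A →ₐ[k] A ⊗[k] (A ⊗[k] A)).toLinearMap
  let j : A →ₗ[k] A ⊗[k] (A ⊗[k] A) := ((oneTensor k A).comp
    (Algebra.TensorProduct.includeLeft : A →ₐ[k] A ⊗[k] A)).toLinearMap
  let l : A →ₗ[k] A ⊗[k] (A ⊗[k] A) := ((oneTensor k A).comp
    (Algebra.TensorProduct.includeRight : A →ₐ[k] A ⊗[k] A)).toLinearMap
  have hi : ∀ a, i a = a ⊗ₜ 1 := fun _ => rfl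
  have hj : ∀ a, j a = 1 ⊗ₜ (a ⊗ₜ 1) := fun _ => rfl
  have hl : ∀ a, l a = 1 ⊗ₜ (1 ⊗ₜ a) := fun _ => rfl
  have hij : ∀ a b, Commute (i a) (j b) := fun a b => by simp [hi, hj, Commute, SemiconjBy]
  have hjl : ∀ a b, Commute (j a) (l b) := fun a b => by simp [hj, hl, Commute, SemiconjBy]
  have e1 : conv l j = (oneTensor k A).toLinearMap ∘ₗ comul := by
    rw [conv_swap hjl, conv]
    congr 1
    ext a b
    simp [hj, hl, oneTensor_apply]
  have e2 : conv j i = (tensorOne k A).toLinearMap ∘ₗ comul := by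
    rw [conv_swap hij, conv]
    congr 1
    ext a b
    simp [hi, hj, tensorOne_tmul]
  have e := hf.evalPair_add (α := l) (γ := i) j rfl rfl
  rw [e1, e2] at e
  have h1 : ∀ z, evalPair l j z = oneTensor k A (TensorProduct.comm k A A z) := fun z => by
    induction z with
    | zero => simp
    | add x y hx hy => simp only [map_add, hx, hy]
    | tmul a b => simp [hj, hl, oneTensor_apply]
  have h2 : ∀ z, evalPair j i z = tensorOne k A (TensorProduct.comm k A A z) := fun z => by
    induction z with
    | zero => simp
    | add x y hx hy => simp only [map_add, hx, hy]
    | tmul a b => simp [hj, hi, tensorOne_tmul]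
  have h3 : ∀ z, evalPair ((oneTensor k A).toLinearMap ∘ₗ comul) i z =
      tensorComul k A (TensorProduct.comm k A A z) := fun z => by
    induction z with
    | zero => simp
    | add x y hx hy => simp only [map_add, hx, hy]
    | tmul a b => simp [hi, oneTensor_apply, tensorComul_tmul]
  have h4 : ∀ z, evalPair l ((tensorOne k A).toLinearMap ∘ₗ comul) z =
      comulTensor k A (TensorProduct.comm k A A z) := fun z => by
    induction z with
    | zero => simp
    | add x y hx hy => simp only [map_add, hx, hy]
    | tmul a b =>
      simp only [TensorProduct.comm_tmul, comulTensor_tmul, evalPair_tmul, hl,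
        LinearMap.comp_apply, AlgHom.toLinearMap_apply]
      induction comul (R := k) b with
      | zero => simp
      | add x y hx hy => simp only [TensorProduct.add_tmul, map_add, hx, hy, mul_add]
      | tmul c d => simp [tensorOne_tmul]
  rw [h1, h2, h3, h4] at e
  exact e.symm

theorem tensorCounit_comm (f : A ⊗[k] A) :
    tensorCounit k A (TensorProduct.comm k A A f) = counitTensor k A f := by
  induction f with
  | zero => simp
  | add x y hx hy => simp only [map_add, hx, hy]
  | tmul a b => simp [tensorCounit_tmul, counitTensor_tmul]

theorem commute_comm [IsCocomm k A] {f : A ⊗[k] A} (hinv : ∀ u, Commute (comul (R := k) u) f)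
    (u : A) : Commute (comul (R := k) u) (TensorProduct.comm k A A f) := by
  have h := (hinv u).map (Algebra.TensorProduct.comm k A A)
  change Commute (TensorProduct.comm k A A (comul (R := k) u)) (TensorProduct.comm k A A f) at h
  rwa [Coalgebra.comm_comul] at h

end Cocycle

/-! ### Invariant cocycles on the enveloping algebra -/

section EnvCocycle

variable {k : Type*} {g : Type*} [Field k] [LieRing g] [LieAlgebra k g]

open Coalgebra (comul counit IsCocomm)

attribute [local instance 100] LieRing.ofAssociativeRing

variable (k g) in
/-- The linear map `g ⊗ g → U(g) ⊗ U(g)`. -/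
abbrev envι₂ : g ⊗[k] g →ₗ[k] UniversalEnvelopingAlgebra k g ⊗[k] UniversalEnvelopingAlgebra k g :=
  TensorProduct.map (envι k g) (envι k g)

theorem envι₂_lie (x : g) (X : g ⊗[k] g) :
    envι₂ k g ⁅x, X⁆ = comul (R := k) (envι k g x) * envι₂ k g X -
      envι₂ k g X * comul (R := k) (envι k g x) := by
  rw [comul_envι]
  induction X with
  | zero => simp
  | add X Y hX hY =>
    rw [lie_add, map_add, hX, hY, map_add]
    simp only [mul_add, add_mul]
    abel
  | tmul a b =>
    rw [TensorProduct.LieModule.lie_tmul_right, map_add, TensorProduct.map_tmul,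
      TensorProduct.map_tmul, TensorProduct.map_tmul, envι_lie, envι_lie]
    simp only [add_mul, mul_add, Algebra.TensorProduct.tmul_mul_tmul, one_mul, mul_one,
      TensorProduct.sub_tmul, TensorProduct.tmul_sub]
    abel

theorem envι₂_comm (X : g ⊗[k] g) :
    TensorProduct.comm k _ _ (envι₂ k g X) = envι₂ k g (TensorProduct.comm k g g X) := by
  induction X with
  | zero => simp
  | add X Y hX hY => simp only [map_add, hX, hY]
  | tmul a b => simp

variable (k g) in
theorem envι₂_injective [CharZero k] : Function.Injective (envι₂ k g) :=
  TensorProduct.map_injective_of_flat_flat _ _ (envι_injective k g) (envι_injective k g)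

theorem mem_invariantBivectors {X : g ⊗[k] g} :
    X ∈ invariantBivectors k g ↔ (∀ x : g, ⁅x, X⁆ = 0) ∧ TensorProduct.comm k g g X = -X := by
  simp [invariantBivectors, eq_neg_iff_add_eq_zero]

/-- A skew-symmetric invariant cocycle is an invariant bivector. -/
theorem exists_envι₂_eq [CharZero k]
    {f : UniversalEnvelopingAlgebra k g ⊗[k] UniversalEnvelopingAlgebra k g} (hf : IsCocycle f)
    (hskew : TensorProduct.comm k _ _ f = -f) (hinv : ∀ u, Commute (comul (R := k) u) f) :
    ∃ X ∈ invariantBivectors k g, envι₂ k g X = f := by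
  set U := UniversalEnvelopingAlgebra k g
  let x : U →ₗ[k] U ⊗[k] U := (Algebra.TensorProduct.includeLeft : U →ₐ[k] U ⊗[k] U).toLinearMap
  let y : U →ₗ[k] U ⊗[k] U := (Algebra.TensorProduct.includeRight : U →ₐ[k] U ⊗[k] U).toLinearMap
  let inl : U ⊗[k] U →ₗ[k] (U ⊗[k] U) ⊗[k] U :=
    (Algebra.TensorProduct.includeLeft : U ⊗[k] U →ₐ[k] (U ⊗[k] U) ⊗[k] U).toLinearMap
  let γ : U →ₗ[k] (U ⊗[k] U) ⊗[k] U :=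
    (Algebra.TensorProduct.includeRight : U →ₐ[k] (U ⊗[k] U) ⊗[k] U).toLinearMap
  have hx : ∀ a, x a = a ⊗ₜ 1 := fun _ => rfl
  have hy : ∀ a, y a = 1 ⊗ₜ a := fun _ => rfl
  have hinl : ∀ a, inl a = a ⊗ₜ 1 := fun _ => rfl
  have hγ : ∀ a, γ a = 1 ⊗ₜ a := fun _ => rfl
  -- Additivity at the universal points of `(U ⊗ U) ⊗ U`: `(Δ ⊗ I) f` is `f` placed in factors 1, 3
  -- plus `f` placed in factors 2, 3.
  have h1 := hf.evalPair_conv_of_skew hskew (α := inl ∘ₗ x) (β := inl ∘ₗ y) (γ := γ) rfl rfl rfl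
    (fun a b => by simp [hx, hy, hinl, Commute, SemiconjBy])
    (fun a b => by simp [hγ, hinl, Commute, SemiconjBy])
    (fun a b => by simp [hγ, hinl, Commute, SemiconjBy])
  have h2 : ∀ (α : U →ₗ[k] U ⊗[k] U) (z : U ⊗[k] U),
      evalPair (inl ∘ₗ α) γ z = LinearMap.rTensor U α z := by
    intro α z
    induction z with
    | zero => simp
    | add a b ha hb => simp only [map_add, ha, hb]
    | tmul a b => simp [hγ, hinl]
  have h3 : conv (inl ∘ₗ x) (inl ∘ₗ y) = inl ∘ₗ comul := by
    rw [conv]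
    congr 1
    ext a b
    simp [hinl, hx, hy]
  rw [h3, h2, h2, h2] at h1
  have h4 : LinearMap.rTensor U (cobd k (A := U)) f = 0 := by
    have : cobd k (A := U) = x + y - comul := rfl
    rw [this, LinearMap.rTensor_sub, LinearMap.rTensor_add, LinearMap.sub_apply,
      LinearMap.add_apply, h1, sub_self]
  -- Primitives are the kernel of the coboundary, and tensoring with `U` over a field is exact; so
  -- `f` lies in the image of `g ⊗ U`.
  have hex : Function.Exact (envι k g) (cobd k (A := U)) := by
    intro p
    rw [cobd_apply, sub_eq_zero, eq_comm]
    constructor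
    · intro hp
      exact (primGen_env k g).mem_of_isPrim hp
    · rintro ⟨v, rfl⟩
      exact comul_envι k v
  obtain ⟨z, hz⟩ := (Module.Flat.rTensor_exact U hex f).1 h4
  obtain ⟨p, hp⟩ := (envι k g).exists_leftInverse_of_injective
    (LinearMap.ker_eq_bot.2 (envι_injective k g))
  have hL : TensorProduct.map (envι k g ∘ₗ p) LinearMap.id f = f := by
    rw [← hz, LinearMap.rTensor, ← LinearMap.comp_apply, ← TensorProduct.map_comp,
      LinearMap.comp_assoc, hp, LinearMap.comp_id, LinearMap.id_comp]
  -- By skew symmetry `f` also lies in the image of `U ⊗ g`; applying the projection to `g` in both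
  -- factors puts it in that of `g ⊗ g`.
  have hR : TensorProduct.map LinearMap.id (envι k g ∘ₗ p) f = f := by
    have h5 : ∀ z : U ⊗[k] U, TensorProduct.map LinearMap.id (envι k g ∘ₗ p) z =
        TensorProduct.comm k _ _ (TensorProduct.map (envι k g ∘ₗ p) LinearMap.id
          (TensorProduct.comm k _ _ z)) := by
      intro z
      induction z with
      | zero => simp
      | add a b ha hb => simp only [map_add, ha, hb]
      | tmul a b => simp
    rw [h5, hskew, map_neg, map_neg, hL, hskew, neg_neg]
  have hX : envι₂ k g (TensorProduct.map p p f) = f := by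
    rw [← LinearMap.comp_apply, ← TensorProduct.map_comp]
    conv_rhs => rw [← hL, ← hR]
    rw [← LinearMap.comp_apply, ← TensorProduct.map_comp, LinearMap.comp_id, LinearMap.id_comp]
  refine ⟨TensorProduct.map p p f, mem_invariantBivectors.2 ⟨fun v => ?_, ?_⟩, hX⟩
  · refine envι₂_injective k g ?_
    rw [envι₂_lie, hX, (hinv _).eq, sub_self, map_zero]
  · refine envι₂_injective k g ?_
    rw [← envι₂_comm, map_neg, hX, hskew]

/-- An invariant normalised cocycle is the sum of an invariant bivector and the coboundary of a
central element. -/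
theorem exists_envι₂_add_cobd_eq [CharZero k]
    {f : UniversalEnvelopingAlgebra k g ⊗[k] UniversalEnvelopingAlgebra k g} (hf : IsCocycle f)
    (hinv : ∀ u, Commute (comul (R := k) u) f)
    (hl : counitTensor k (UniversalEnvelopingAlgebra k g) f = 0)
    (hr : tensorCounit k (UniversalEnvelopingAlgebra k g) f = 0) :
    ∃ X ∈ invariantBivectors k g, ∃ a ∈ centralAug k (UniversalEnvelopingAlgebra k g),
      envι₂ k g X + cobd k a = f := by
  set τ := TensorProduct.comm k (UniversalEnvelopingAlgebra k g) (UniversalEnvelopingAlgebra k g)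
  have hττ : τ (τ f) = f := by
    change (TensorProduct.comm k _ _) ((TensorProduct.comm k _ _) f) = f
    simp
  have hτ : IsCocycle (τ f) := hf.comm
  have hτinv : ∀ u, Commute (comul (R := k) u) (τ f) := commute_comm hinv
  have hτr : tensorCounit k (UniversalEnvelopingAlgebra k g) (τ f) = 0 := by
    rw [tensorCounit_comm, hl]
  have hτl : counitTensor k (UniversalEnvelopingAlgebra k g) (τ f) = 0 := by
    rw [← tensorCounit_comm]
    change tensorCounit k _ (τ (τ f)) = 0
    rw [hττ, hr]
  rw [IsCocycle] at hf hτ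
  -- The skew half of `f` gives the bivector; the symmetric half gives the coboundary.
  obtain ⟨X, hX, hXe⟩ := exists_envι₂_eq (f := (2 : k)⁻¹ • (f - τ f))
    (by
      rw [IsCocycle]
      simp only [map_smul, map_sub]
      rw [← smul_add, ← smul_add, sub_add_sub_comm, hf, hτ, add_sub_add_comm])
    (by
      change τ _ = _
      rw [map_smul, map_sub, hττ, ← smul_neg, neg_sub])
    (fun u => ((hinv u).sub_right (hτinv u)).smul_right _)
  obtain ⟨a, ha, hae⟩ := (primGen_env k g).exists_cobd_eq (f := (2 : k)⁻¹ • (f + τ f))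
    (by
      rw [IsCocycle]
      simp only [map_smul, map_add]
      rw [← smul_add, ← smul_add, add_add_add_comm, hf, hτ, add_add_add_comm])
    (by
      change τ _ = _
      rw [map_smul, map_add, hττ, add_comm])
    (fun u => ((hinv u).add_right (hτinv u)).smul_right _)
    (by rw [map_smul, map_add, hl, hτl, add_zero, smul_zero])
    (by rw [map_smul, map_add, hr, hτr, add_zero, smul_zero])
  refine ⟨X, hX, a, ha, ?_⟩
  rw [hXe, hae, ← smul_add, sub_add_add_cancel, ← two_smul k f, smul_smul,
    inv_mul_cancel₀ two_ne_zero, one_smul]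

end EnvCocycle

/-! ### The commutator of two invariant bivectors is a coboundary -/

section Bracket

variable {k : Type*} {g : Type*} [Field k] [LieRing g] [LieAlgebra k g]

open Coalgebra (comul counit IsCocomm)

attribute [local instance 100] LieRing.ofAssociativeRing

variable (k g) in
/-- The bilinear map `(a ⊗ b, c ⊗ d) ↦ a ⊗ ⁅b, c⁆ ⊗ d`. -/
def middleBracket : g ⊗[k] g →ₗ[k] g ⊗[k] g →ₗ[k] g ⊗[k] (g ⊗[k] g) :=
  TensorProduct.lift (LinearMap.mk₂ k
    (fun a b => TensorProduct.mk k g (g ⊗[k] g) a ∘ₗ LinearMap.rTensor g (LieAlgebra.ad k g b))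
    (fun a a' b => by simp [LinearMap.add_comp])
    (fun c a b => by simp [LinearMap.smul_comp])
    (fun a b b' => by simp [LinearMap.rTensor_add, LinearMap.comp_add])
    (fun c a b => by simp [LinearMap.rTensor_smul, LinearMap.comp_smul]))

theorem middleBracket_tmul (a b : g) (Y : g ⊗[k] g) :
    middleBracket k g (a ⊗ₜ b) Y = a ⊗ₜ LinearMap.rTensor g (LieAlgebra.ad k g b) Y := by
  simp [middleBracket]

theorem middleBracket_tmul_tmul (a b c d : g) :
    middleBracket k g (a ⊗ₜ b) (c ⊗ₜ d) = a ⊗ₜ (⁅b, c⁆ ⊗ₜ d) := by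
  simp [middleBracket_tmul]

theorem middleBracket_tmul_right (X : g ⊗[k] g) (c d : g) :
    middleBracket k g X (c ⊗ₜ d) = -TensorProduct.assoc k g g g
      (LinearMap.lTensor g (LieAlgebra.ad k g c) X ⊗ₜ d) := by
  induction X with
  | zero => simp
  | add X Y hX hY =>
    simp only [map_add, LinearMap.add_apply, hX, hY, TensorProduct.add_tmul, neg_add]
  | tmul a b =>
    rw [middleBracket_tmul_tmul, LinearMap.lTensor_tmul, TensorProduct.assoc_tmul,
      LieAlgebra.ad_apply, ← lie_skew b c, TensorProduct.neg_tmul, TensorProduct.tmul_neg]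

variable (k g) in
/-- The exchange of the last two factors. -/
def swapRight : g ⊗[k] (g ⊗[k] g) →ₗ[k] g ⊗[k] (g ⊗[k] g) :=
  LinearMap.lTensor g (TensorProduct.comm k g g).toLinearMap

variable (k g) in
/-- The exchange of the first two factors. -/
def swapLeft : g ⊗[k] (g ⊗[k] g) →ₗ[k] g ⊗[k] (g ⊗[k] g) :=
  (TensorProduct.leftComm k g g g).toLinearMap

theorem rTensor_ad_of_invariant {X : g ⊗[k] g} (hX : ∀ x : g, ⁅x, X⁆ = 0) (x : g) :
    LinearMap.rTensor g (LieAlgebra.ad k g x) X = -LinearMap.lTensor g (LieAlgebra.ad k g x) X :=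
  eq_neg_of_add_eq_zero_left (hX x)

/-- Flipping `Y` and moving `ad b` to its other factor each cost a sign, the first by skewness and
the second by invariance. With `swapLeft_middleBracket` the tensor is totally symmetric. -/
theorem swapRight_middleBracket (X : g ⊗[k] g) {Y : g ⊗[k] g} (hY : Y ∈ invariantBivectors k g) :
    swapRight k g (middleBracket k g X Y) = middleBracket k g X Y := by
  obtain ⟨h1, h2⟩ := mem_invariantBivectors.1 hY
  induction X with
  | zero => simp
  | add X Y hX hY => simp only [map_add, LinearMap.add_apply, hX, hY]
  | tmul a b =>
    have h3 : ∀ z : g ⊗[k] g, TensorProduct.comm k g g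
        (LinearMap.rTensor g (LieAlgebra.ad k g b) z) =
        LinearMap.lTensor g (LieAlgebra.ad k g b) (TensorProduct.comm k g g z) := by
      intro z
      induction z with
      | zero => simp
      | add x y hx hy => simp only [map_add, hx, hy]
      | tmul a b => simp
    rw [middleBracket_tmul, swapRight, LinearMap.lTensor_tmul, LinearEquiv.coe_coe, h3, h2,
      map_neg, rTensor_ad_of_invariant h1]

theorem swapLeft_middleBracket {X : g ⊗[k] g} (hX : X ∈ invariantBivectors k g) (Y : g ⊗[k] g) :
    swapLeft k g (middleBracket k g X Y) = middleBracket k g X Y := by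
  obtain ⟨h1, h2⟩ := mem_invariantBivectors.1 hX
  induction Y with
  | zero => simp
  | add X Y hX hY => simp only [map_add, hX, hY]
  | tmul c d =>
    have h3 : ∀ z : g ⊗[k] g, LinearMap.lTensor g (LieAlgebra.ad k g c)
        (TensorProduct.comm k g g z) = TensorProduct.comm k g g
        (LinearMap.rTensor g (LieAlgebra.ad k g c) z) := by
      intro z
      induction z with
      | zero => simp
      | add x y hx hy => simp only [map_add, hx, hy]
      | tmul a b => simp
    have h4 : ∀ z : g ⊗[k] g, swapLeft k g (TensorProduct.assoc k g g g (z ⊗ₜ d)) =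
        TensorProduct.assoc k g g g (TensorProduct.comm k g g z ⊗ₜ d) := by
      intro z
      induction z with
      | zero => simp
      | add x y hx hy => simp only [map_add, TensorProduct.add_tmul, hx, hy]
      | tmul a b => simp [swapLeft]
    have h5 : LinearMap.lTensor g (LieAlgebra.ad k g c) X =
        TensorProduct.comm k g g (LinearMap.lTensor g (LieAlgebra.ad k g c) X) := by
      have h6 := h3 X
      rw [h2, map_neg, rTensor_ad_of_invariant h1, map_neg, neg_inj] at h6
      exact h6
    rw [middleBracket_tmul_right, map_neg, h4, ← h5]

theorem lie_middleBracket (x : g) (X Y : g ⊗[k] g) :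
    ⁅x, middleBracket k g X Y⁆ = middleBracket k g ⁅x, X⁆ Y + middleBracket k g X ⁅x, Y⁆ := by
  induction X with
  | zero => simp
  | add X X' hX hX' =>
    simp only [map_add, lie_add, LinearMap.add_apply, hX, hX']
    abel
  | tmul a b =>
    induction Y with
    | zero => simp
    | add Y Y' hY hY' =>
      simp only [map_add, lie_add, hY, hY']
      abel
    | tmul c d =>
      simp only [TensorProduct.LieModule.lie_tmul_right, map_add, LinearMap.add_apply,
        middleBracket_tmul_tmul, leibniz_lie x b c, TensorProduct.add_tmul, TensorProduct.tmul_add]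
      abel

local notation "U" => UniversalEnvelopingAlgebra k g

variable (k g) in
/-- The product `a ⊗ b ⊗ c ↦ a b c` in `U(g)`. -/
def tripleProd : g ⊗[k] (g ⊗[k] g) →ₗ[k] U :=
  LinearMap.mul' k U ∘ₗ TensorProduct.map (envι k g) (LinearMap.mul' k U ∘ₗ envι₂ k g)

theorem tripleProd_tmul (a b c : g) :
    tripleProd k g (a ⊗ₜ (b ⊗ₜ c)) = envι k g a * (envι k g b * envι k g c) := by
  simp [tripleProd, -UniversalEnvelopingAlgebra.ι_apply]

variable (k g) in
/-- The map `a ⊗ b ⊗ c ↦ a b ⊗ c`. -/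
def prodLeft : g ⊗[k] (g ⊗[k] g) →ₗ[k] U ⊗[k] U :=
  TensorProduct.map (LinearMap.mul' k U ∘ₗ envι₂ k g) (envι k g) ∘ₗ
    (TensorProduct.assoc k g g g).symm.toLinearMap

variable (k g) in
/-- The map `a ⊗ b ⊗ c ↦ a ⊗ b c`. -/
def prodRight : g ⊗[k] (g ⊗[k] g) →ₗ[k] U ⊗[k] U :=
  TensorProduct.map (envι k g) (LinearMap.mul' k U ∘ₗ envι₂ k g)

theorem prodLeft_tmul (a b c : g) :
    prodLeft k g (a ⊗ₜ (b ⊗ₜ c)) = (envι k g a * envι k g b) ⊗ₜ envι k g c := by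
  simp [prodLeft, -UniversalEnvelopingAlgebra.ι_apply]

theorem prodRight_tmul (a b c : g) :
    prodRight k g (a ⊗ₜ (b ⊗ₜ c)) = envι k g a ⊗ₜ (envι k g b * envι k g c) := by
  simp [prodRight, -UniversalEnvelopingAlgebra.ι_apply]

theorem tensor_triple_induction {P : g ⊗[k] (g ⊗[k] g) → Prop} (h0 : P 0)
    (hadd : ∀ x y, P x → P y → P (x + y)) (h : ∀ a b c, P (a ⊗ₜ (b ⊗ₜ c))) (T) : P T := by
  induction T with
  | zero => exact h0
  | add x y hx hy => exact hadd x y hx hy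
  | tmul a z =>
    induction z with
    | zero => simpa using h0
    | add x y hx hy => rw [TensorProduct.tmul_add]; exact hadd _ _ hx hy
    | tmul b c => exact h a b c

/-- The coproduct of `abc` has three mixed terms of type `(2,1)` and three of type `(1,2)`; total
symmetry identifies the terms of each type, whence the factor 3. -/
theorem cobd_tripleProd {T : g ⊗[k] (g ⊗[k] g)} (hl : swapLeft k g T = T)
    (hr : swapRight k g T = T) :
    cobd k (tripleProd k g T) = -((3 : k) • (prodLeft k g T + prodRight k g T)) := by
  have key : ∀ T : g ⊗[k] (g ⊗[k] g), cobd k (tripleProd k g T) =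
      -(prodLeft k g T + prodLeft k g (swapRight k g T) +
        prodLeft k g (swapRight k g (swapLeft k g T)) + (prodRight k g T +
        prodRight k g (swapLeft k g T) + prodRight k g (swapLeft k g (swapRight k g T)))) := by
    intro T
    induction T using tensor_triple_induction with
    | h0 => simp
    | hadd x y hx hy =>
      simp only [map_add, hx, hy]
      abel
    | h a b c =>
      rw [tripleProd_tmul, cobd_apply]
      simp only [Bialgebra.comul_mul, comul_envι]
      simp only [swapLeft, swapRight, LinearMap.lTensor_tmul, LinearEquiv.coe_coe,
        TensorProduct.comm_tmul, TensorProduct.leftComm_tmul, prodLeft_tmul, prodRight_tmul,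
        add_mul, mul_add, Algebra.TensorProduct.tmul_mul_tmul, one_mul, mul_one]
      abel
  rw [key]
  simp only [hl, hr]
  module

theorem commute_tripleProd {T : g ⊗[k] (g ⊗[k] g)} (hT : ∀ x : g, ⁅x, T⁆ = 0) (x : g) :
    envι k g x * tripleProd k g T = tripleProd k g T * envι k g x := by
  have key : ∀ T : g ⊗[k] (g ⊗[k] g), tripleProd k g ⁅x, T⁆ =
      envι k g x * tripleProd k g T - tripleProd k g T * envι k g x := by
    intro T
    induction T using tensor_triple_induction with
    | h0 => simp
    | hadd y z hy hz =>
      simp only [lie_add, map_add, hy, hz, mul_add, add_mul]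
      abel
    | h a b c =>
      simp only [TensorProduct.LieModule.lie_tmul_right, TensorProduct.tmul_add, map_add,
        tripleProd_tmul, envι_lie]
      noncomm_ring
  rw [← sub_eq_zero, ← key, hT, map_zero]

/-- From `[a ⊗ b, c ⊗ d] = ac ⊗ [b,d] + [a,c] ⊗ db`. Flipping `Y` in the first term and `X` in the
second produces the sign, and symmetry removes the permutations. -/
theorem envι₂_mul_sub_mul {X Y : g ⊗[k] g} (hX : X ∈ invariantBivectors k g)
    (hY : Y ∈ invariantBivectors k g) :
    envι₂ k g X * envι₂ k g Y - envι₂ k g Y * envι₂ k g X =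
      -(prodLeft k g (middleBracket k g X Y) + prodRight k g (middleBracket k g X Y)) := by
  have key : ∀ X Y : g ⊗[k] g, envι₂ k g X * envι₂ k g Y - envι₂ k g Y * envι₂ k g X =
      prodLeft k g (swapRight k g (middleBracket k g X (TensorProduct.comm k g g Y))) +
      prodRight k g (swapRight k g (swapLeft k g
        (middleBracket k g (TensorProduct.comm k g g X) Y))) := by
    intro X Y
    induction X with
    | zero => simp
    | add X X' hX hX' =>
      simp only [map_add, add_mul, mul_add, LinearMap.add_apply] at hX hX' ⊢
      rw [add_sub_add_comm, hX, hX']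
      abel
    | tmul a b =>
      induction Y with
      | zero => simp
      | add Y Y' hY hY' =>
        simp only [map_add, add_mul, mul_add] at hY hY' ⊢
        rw [add_sub_add_comm, hY, hY']
        abel
      | tmul c d =>
        simp only [TensorProduct.comm_tmul, middleBracket_tmul_tmul, swapLeft, swapRight,
          LinearMap.lTensor_tmul, LinearEquiv.coe_coe, TensorProduct.leftComm_tmul,
          TensorProduct.map_tmul, prodLeft_tmul, prodRight_tmul, envι_lie,
          Algebra.TensorProduct.tmul_mul_tmul, TensorProduct.sub_tmul, TensorProduct.tmul_sub]
        abel
  rw [key, (mem_invariantBivectors.1 hX).2, (mem_invariantBivectors.1 hY).2]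
  simp only [map_neg, LinearMap.neg_apply]
  rw [swapRight_middleBracket _ hY, swapLeft_middleBracket hX, swapRight_middleBracket _ hY]
  abel

variable (k g) in
/-- The central element `∑ a ⁅b, c⁆ d`, divided by three, whose coboundary is the commutator of
the invariant bivectors `∑ a ⊗ b` and `∑ c ⊗ d`. -/
def cubic : g ⊗[k] g →ₗ[k] g ⊗[k] g →ₗ[k] U :=
  (middleBracket k g).compr₂ ((3 : k)⁻¹ • tripleProd k g)

theorem cobd_cubic [CharZero k] {X Y : g ⊗[k] g} (hX : X ∈ invariantBivectors k g)
    (hY : Y ∈ invariantBivectors k g) :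
    cobd k (cubic k g X Y) = envι₂ k g X * envι₂ k g Y - envι₂ k g Y * envι₂ k g X := by
  rw [envι₂_mul_sub_mul hX hY, cubic, LinearMap.compr₂_apply, LinearMap.smul_apply, map_smul,
    cobd_tripleProd (swapLeft_middleBracket hX Y) (swapRight_middleBracket X hY), smul_neg,
    smul_smul, inv_mul_cancel₀ three_ne_zero, one_smul]

theorem cubic_mem_centralAug {X Y : g ⊗[k] g} (hX : X ∈ invariantBivectors k g)
    (hY : Y ∈ invariantBivectors k g) : cubic k g X Y ∈ centralAug k U := by
  refine Submodule.smul_mem _ _ (mem_centralAug.2 ⟨(primGen_env k g).central_of_commute ?_, ?_⟩)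
  · rintro _ ⟨x, rfl⟩
    refine commute_tripleProd (fun x => ?_) x
    rw [lie_middleBracket, (mem_invariantBivectors.1 hX).1, (mem_invariantBivectors.1 hY).1]
    simp
  · induction middleBracket k g X Y using tensor_triple_induction with
    | h0 => simp
    | hadd x y hx hy => rw [map_add, map_add, hx, hy, add_zero]
    | h a b c => rw [tripleProd_tmul, Bialgebra.counit_mul, counit_envι, zero_mul]

end Bracket

/-! ### Twists as exponentials of additive cocycles; the boundary map -/

section ExponentialTwists

theorem constantCoeff_extendh {k A B : Type*} [Field k] [Ring A] [Algebra k A] [Ring B]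
    [Algebra k B] (f : A →ₐ[k] B) (Y : PowerSeries A) :
    PowerSeries.constantCoeff (extendh f Y) = f (PowerSeries.constantCoeff Y) := by
  rw [← PowerSeries.coeff_zero_eq_constantCoeff_apply, PowerSeries.coeff_map,
    PowerSeries.coeff_zero_eq_constantCoeff_apply]
  rfl

variable {k : Type*} {A : Type*} [Field k] [Ring A] [Bialgebra k A]

open Coalgebra (comul counit IsCocomm)

variable (k A) in
/-- The normalised additive 2-cocycles that commute with the image of the coproduct. -/
def invCocycles : Submodule k (A ⊗[k] A) where
  carrier := {f | IsCocycle f ∧ (∀ u, Commute (comul (R := k) u) f) ∧ counitTensor k A f = 0 ∧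
    tensorCounit k A f = 0}
  zero_mem' := by simp [IsCocycle]
  add_mem' := by
    rintro f f' ⟨h1, h2, h3, h4⟩ ⟨h1', h2', h3', h4'⟩
    refine ⟨?_, fun u => (h2 u).add_right (h2' u), by rw [map_add, h3, h3', add_zero],
      by rw [map_add, h4, h4', add_zero]⟩
    rw [IsCocycle] at *
    simp only [map_add]
    rw [add_add_add_comm, h1, h1', add_add_add_comm]
  smul_mem' := by
    rintro c f ⟨h1, h2, h3, h4⟩
    refine ⟨?_, fun u => (h2 u).smul_right c, by rw [map_smul, h3, smul_zero],
      by rw [map_smul, h4, smul_zero]⟩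
    rw [IsCocycle] at *
    simp only [map_smul, ← smul_add, h1]

theorem commute_comulh {Y : PowerSeries (A ⊗[k] A)}
    (h : ∀ n u, Commute (comul (R := k) u) (PowerSeries.coeff n Y)) (x : PowerSeries A) :
    Commute (comulh k A x) Y := by
  refine commute_of_coeff fun i j => ?_
  rw [PowerSeries.coeff_map]
  exact h j _

/-- Invariance makes the two factors on each side of the twist equation commute, so that their
logarithms add and the additive cocycle condition suffices. -/
theorem isInvariantTwist_exphUnit [CharZero k] {Y : PowerSeries (A ⊗[k] A)}
    (h0 : PowerSeries.constantCoeff Y = 0) (h : ∀ n, PowerSeries.coeff n Y ∈ invCocycles k A) :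
    IsInvariantTwist k (exphUnit (k := k) h0) := by
  have hinv : ∀ x, comulh k A x * Y = Y * comulh k A x := fun x =>
    (commute_comulh (fun n => (h n).2.1) x).eq
  have hc : ∀ {B : Type _} [Ring B] [Algebra k B] (f : A ⊗[k] A →ₐ[k] B),
      PowerSeries.constantCoeff (extendh f Y) = 0 := fun f => by
    rw [constantCoeff_extendh, h0, map_zero]
  refine ⟨fun x => (commute_exph h0 (hinv x)).eq, ?_, ?_, ?_⟩
  · change extendh _ (exph k Y) * extendh _ (exph k Y) =
      extendh _ (exph k Y) * extendh _ (exph k Y)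
    rw [map_exph, map_exph, map_exph, map_exph,
      ← exph_add (hc _) (hc _) (commute_comulTensor hinv Y),
      ← exph_add (hc _) (hc _) (commute_tensorComul hinv Y)]
    congr 1
    ext n
    simp only [map_add, PowerSeries.coeff_map]
    exact (h n).1
  · change extendh _ (exph k Y) = 1
    rw [map_exph, ← exph_zero (k := k)]
    congr 1
    ext n
    simpa using (h n).2.2.1
  · change extendh _ (exph k Y) = 1
    rw [map_exph, ← exph_zero (k := k)]
    congr 1
    ext n
    simpa using (h n).2.2.2

/-- The invariant twist `exp(Y)` attached to a series of additive cocycles. -/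
def exphTwist [CharZero k] {Y : PowerSeries (A ⊗[k] A)} (h0 : PowerSeries.constantCoeff Y = 0)
    (h : ∀ n, PowerSeries.coeff n Y ∈ invCocycles k A) : invariantTwists k A :=
  ⟨exphUnit h0, isInvariantTwist_exphUnit h0 h⟩

/-- The logarithm of an invariant twist with constant term `1` is a series of additive cocycles. -/
theorem coeff_mem_invCocycles [CharZero k] {F : (PowerSeries (A ⊗[k] A))ˣ}
    (hF : IsInvariantTwist k F) {Y : PowerSeries (A ⊗[k] A)}
    (h0 : PowerSeries.constantCoeff Y = 0) (hY : exph k Y = F.1) (n : ℕ) :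
    PowerSeries.coeff n Y ∈ invCocycles k A := by
  induction n using Nat.strong_induction_on with
  | _ n ih =>
    rcases Nat.eq_zero_or_pos n with rfl | hn
    · rw [PowerSeries.coeff_zero_eq_constantCoeff_apply, h0]
      exact Submodule.zero_mem _
    -- The exponential of the logarithm truncated below `n` is a twist by induction. It agrees with
    -- `F` below `h^n` and differs there by the coefficient `Y_n`, which therefore satisfies the
    -- linearised twist conditions.
    set Z : PowerSeries (A ⊗[k] A) :=
      PowerSeries.mk fun i => if i < n then PowerSeries.coeff i Y else 0 with hZ
    have hZ0 : PowerSeries.constantCoeff Z = 0 := by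
      rw [← PowerSeries.coeff_zero_eq_constantCoeff_apply, hZ, PowerSeries.coeff_mk, if_pos hn,
        PowerSeries.coeff_zero_eq_constantCoeff_apply, h0]
    have hZm : ∀ i, PowerSeries.coeff i Z ∈ invCocycles k A := by
      intro i
      rw [hZ, PowerSeries.coeff_mk]
      split_ifs with hi
      · exact ih i hi
      · exact Submodule.zero_mem _
    have hYZ : ∀ i < n, PowerSeries.coeff i Y = PowerSeries.coeff i Z := by
      intro i hi
      rw [hZ, PowerSeries.coeff_mk, if_pos hi]
    have hG := isInvariantTwist_exphUnit hZ0 hZm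
    set G := exphUnit (k := k) hZ0 with hGdef
    have hlow : ∀ i < n, PowerSeries.coeff i F.1 = PowerSeries.coeff i G.1 := by
      rw [← hY]
      exact coeff_exph_congr h0 hYZ
    have hdiff : PowerSeries.coeff n F.1 - PowerSeries.coeff n G.1 = PowerSeries.coeff n Y := by
      rw [← hY]
      refine (coeff_exph_sub h0 hYZ hn.ne').trans ?_
      rw [hZ, PowerSeries.coeff_mk, if_neg (lt_irrefl n), sub_zero]
    have hF1 : PowerSeries.constantCoeff F.1 = 1 := by rw [← hY, constantCoeff_exph]
    have hmul : ∀ f f' : A ⊗[k] A →ₐ[k] A ⊗[k] (A ⊗[k] A),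
        PowerSeries.coeff n (extendh f F.1 * extendh f' F.1) -
          PowerSeries.coeff n (extendh f G.1 * extendh f' G.1) =
        f (PowerSeries.coeff n Y) + f' (PowerSeries.coeff n Y) := by
      intro f f'
      rw [coeff_mul_sub_coeff_mul hn.ne' (fun i hi => by simp [hlow i hi])
        (fun i hi => by simp [hlow i hi]), ← hdiff, constantCoeff_extendh, constantCoeff_extendh,
        hF1]
      simp
    refine ⟨?_, fun u => ?_, ?_, ?_⟩
    · rw [IsCocycle, ← hmul, ← hmul, hF.cocycle, hG.cocycle]
    · rw [← hdiff]
      exact (coeff_commute_comul hF.invariant u n).sub_right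
        (coeff_commute_comul hG.invariant u n)
    · have e1 := congrArg (PowerSeries.coeff n) (hF.counit_left.trans hG.counit_left.symm)
      rw [PowerSeries.coeff_map, PowerSeries.coeff_map] at e1
      rw [← hdiff, map_sub]
      exact sub_eq_zero.2 e1
    · have e1 := congrArg (PowerSeries.coeff n) (hF.counit_right.trans hG.counit_right.symm)
      rw [PowerSeries.coeff_map, PowerSeries.coeff_map] at e1
      rw [← hdiff, map_sub]
      exact sub_eq_zero.2 e1

variable (k) in
/-- The coboundary `s ⊗ 1 + 1 ⊗ s - Δ(s)` of a power series. -/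
def cobdh (s : PowerSeries A) : PowerSeries (A ⊗[k] A) :=
  extendh (Algebra.TensorProduct.includeLeft : A →ₐ[k] A ⊗[k] A) s +
    extendh (Algebra.TensorProduct.includeRight : A →ₐ[k] A ⊗[k] A) s - comulh k A s

theorem coeff_cobdh (s : PowerSeries A) (n : ℕ) :
    PowerSeries.coeff n (cobdh k s) = cobd k (PowerSeries.coeff n s) := by
  simp [cobdh, cobd_apply]

theorem cobdh_smul (c : k) (s : PowerSeries A) : cobdh k (c • s) = c • cobdh k s := by
  ext n
  rw [coeff_cobdh, PowerSeries.coeff_smul, PowerSeries.coeff_smul, map_smul, coeff_cobdh]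

variable (k A) in
/-- The series without constant term whose coefficients are central of counit zero. -/
def centralSeries : Submodule k (PowerSeries A) where
  carrier := {s | PowerSeries.constantCoeff s = 0 ∧ ∀ n, PowerSeries.coeff n s ∈ centralAug k A}
  zero_mem' := ⟨map_zero _, fun n => by simp⟩
  add_mem' := by
    rintro s t ⟨hs, hs'⟩ ⟨ht, ht'⟩
    refine ⟨by rw [map_add, hs, ht, add_zero], fun n => ?_⟩
    rw [map_add]
    exact Submodule.add_mem _ (hs' n) (ht' n)
  smul_mem' := by
    rintro c s ⟨hs, hs'⟩
    refine ⟨?_, fun n => ?_⟩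
    · rw [← PowerSeries.coeff_zero_eq_constantCoeff_apply, PowerSeries.coeff_smul,
        PowerSeries.coeff_zero_eq_constantCoeff_apply, hs, smul_zero]
    · rw [PowerSeries.coeff_smul]
      exact Submodule.smul_mem _ _ (hs' n)

theorem constantCoeff_cobdh {s : PowerSeries A} (hs : PowerSeries.constantCoeff s = 0) :
    PowerSeries.constantCoeff (cobdh k s) = 0 := by
  rw [← PowerSeries.coeff_zero_eq_constantCoeff_apply, coeff_cobdh,
    PowerSeries.coeff_zero_eq_constantCoeff_apply, hs, map_zero]

theorem commute_cobdh {s : PowerSeries A} (hs : s ∈ centralSeries k A)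
    {Y : PowerSeries (A ⊗[k] A)} (h : ∀ n u, Commute (comul (R := k) u) (PowerSeries.coeff n Y)) :
    Commute (cobdh k s) Y := by
  refine commute_of_coeff fun i j => ?_
  have hi := (mem_centralAug.1 (hs.2 i)).1
  rw [coeff_cobdh, cobd_apply]
  exact ((commute_tmul_one hi _).symm.add_left (commute_one_tmul hi _).symm).sub_left (h j _)

theorem central_of_mem_centralSeries {s : PowerSeries A} (hs : s ∈ centralSeries k A)
    (x : PowerSeries A) : Commute x s :=
  commute_of_coeff fun _ j => (mem_centralAug.1 (hs.2 j)).1 _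

variable (k A) in
/-- The exponential of central series. -/
def expCentral [CharZero k] : Multiplicative (centralSeries k A) →* centralUnits k A where
  toFun s := ⟨exphUnit (k := k) s.toAdd.2.1,
    Subring.mem_center_iff.2 fun x => (commute_exph s.toAdd.2.1
      (central_of_mem_centralSeries s.toAdd.2 x)).eq, by
    change extendh _ (exph k s.toAdd.1) = 1
    rw [map_exph, ← exph_zero (k := k)]
    congr 1
    ext n
    simpa using (mem_centralAug.1 (s.toAdd.2.2 n)).2⟩
  map_one' := Subtype.ext (Units.ext exph_zero)
  map_mul' s t := Subtype.ext (Units.ext (exph_add s.toAdd.2.1 t.toAdd.2.1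
    (central_of_mem_centralSeries t.toAdd.2 _)))

/-- For central `s` the series `s ⊗ 1`, `1 ⊗ s` and `Δ(s)` commute, so the exponentials combine. -/
theorem boundary_expCentral [CharZero k] (s : centralSeries k A) :
    (boundary k A (expCentral k A (Multiplicative.ofAdd s))).1.1 = exph k (cobdh k s.1) := by
  have hs := s.2.1
  have hc : ∀ {B : Type _} [Ring B] [Algebra k B] (f : A →ₐ[k] B),
      PowerSeries.constantCoeff (extendh f s.1) = 0 := fun f => by
    rw [constantCoeff_extendh, hs, map_zero]
  have key : tensorSelfUnit (expCentral k A (Multiplicative.ofAdd s)) *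
      (comulUnit (expCentral k A (Multiplicative.ofAdd s)))⁻¹ =
        exphUnit (k := k) (constantCoeff_cobdh (k := k) hs) := by
    rw [mul_inv_eq_iff_eq_mul]
    ext1
    change extendh _ (exph k s.1) * extendh _ (exph k s.1) =
      exph k (cobdh k s.1) * extendh _ (exph k s.1)
    rw [map_exph, map_exph, map_exph, ← exph_add (hc _) (hc _), ← exph_add
      (constantCoeff_cobdh hs) (hc _), cobdh, sub_add_cancel]
    · refine commute_cobdh s.2 fun n u => ?_
      rw [PowerSeries.coeff_map]
      change Commute (comul u) (comul (PowerSeries.coeff n s.1))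
      rw [Commute, SemiconjBy, ← Bialgebra.comul_mul, ← Bialgebra.comul_mul,
        (mem_centralAug.1 (s.2.2 n)).1]
    · exact commute_of_coeff fun m n => by simp [Commute, SemiconjBy]
  exact congrArg Units.val key

/-- Cocommutativity makes boundaries symmetric. This separates them from the `exp(hX)`, which the
flip inverts. -/
theorem extendh_comm_boundary [IsCocomm k A] (x : centralUnits k A) :
    extendh (Algebra.TensorProduct.comm k A A).toAlgHom (boundary k A x).1.1 =
      (boundary k A x).1.1 := by
  let τ : A ⊗[k] A →ₐ[k] A ⊗[k] A := (Algebra.TensorProduct.comm k A A).toAlgHom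
  have h1 : Units.map (extendh τ).toMonoidHom (tensorSelfUnit x) = tensorSelfUnit x := by
    ext1
    change extendh τ (extendh _ x.1.1 * extendh _ x.1.1) = extendh _ x.1.1 * extendh _ x.1.1
    rw [map_mul, extendh_comp_apply, extendh_comp_apply]
    have e1 : τ.comp (Algebra.TensorProduct.includeLeft : A →ₐ[k] A ⊗[k] A) =
        Algebra.TensorProduct.includeRight := by ext; simp [τ]
    have e2 : τ.comp (Algebra.TensorProduct.includeRight : A →ₐ[k] A ⊗[k] A) =
        Algebra.TensorProduct.includeLeft := by ext; simp [τ]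
    rw [e1, e2]
    exact (commute_of_coeff fun m n => by simp [Commute, SemiconjBy]).eq
  have h2 : Units.map (extendh τ).toMonoidHom (comulUnit x) = comulUnit x := by
    ext1
    change extendh τ (extendh _ x.1.1) = extendh _ x.1.1
    rw [extendh_comp_apply]
    congr 2
    ext u
    exact Coalgebra.comm_comul k u
  have h3 : Units.map (extendh τ).toMonoidHom (tensorSelfUnit x * (comulUnit x)⁻¹) =
      tensorSelfUnit x * (comulUnit x)⁻¹ := by
    rw [map_mul, map_inv, h1, h2]
  exact congrArg Units.val h3

theorem gaugeClass_boundary_mul (x : centralUnits k A) (F : invariantTwists k A) :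
    ((boundary k A x * F : invariantTwists k A) : GaugeClasses k A) = F := by
  have h : (boundary k A x : GaugeClasses k A) = 1 :=
    (QuotientGroup.eq_one_iff (boundary k A x)).2 ⟨x, rfl⟩
  rw [QuotientGroup.mk_mul, h, one_mul]

theorem centralUnits_mul_comm (x y : centralUnits k A) : x * y = y * x :=
  Subtype.ext (Units.ext (Subring.mem_center_iff.1 y.2.1 x.1.1))

/-- Independence of the choice: any section is `∂(b)σ₀`, and `a` then differs from `a₀` by the
coboundary of `b`, which is invisible in the associator, and by a cochain with values in `ker ∂`,
which is the required `c`. -/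
theorem associatorTrivial_of_choice {σ₀ : GaugeClasses k A → invariantTwists k A}
    {a₀ : GaugeClasses k A → GaugeClasses k A → centralUnits k A}
    (h : IsAssociatorChoice k σ₀ a₀)
    (h' : ∀ f g l, a₀ f (g * l) * a₀ g l = a₀ (f * g) l * a₀ f g) :
    AssociatorTrivial k A := by
  intro σ a hσ
  have hb : ∀ f, ∃ b : centralUnits k A, σ f = boundary k A b * σ₀ f := by
    intro f
    have e := (hσ.isSection f).trans (h.isSection f).symm
    obtain ⟨x, hx⟩ := QuotientGroup.eq.1 e.symm
    refine ⟨x, ?_⟩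
    rw [(boundary_commute x (σ₀ f)).eq, hx, mul_inv_cancel_left]
  choose b hb using hb
  have hc : ∀ f g, a f g * (b f * b g) * (b (f * g) * a₀ f g)⁻¹ ∈ (boundary k A).ker := by
    intro f g
    rw [MonoidHom.mem_ker, map_mul, map_inv, mul_inv_eq_one, ← mul_left_inj (σ₀ f * σ₀ g)]
    have e := hσ.boundary_eq f g
    rw [hb, hb, hb, h.boundary_eq] at e
    simp only [map_mul, mul_assoc] at e ⊢
    rw [e, ← mul_assoc (σ₀ f) (boundary k A (b g)), ← (boundary_commute (b g) (σ₀ f)).eq, mul_assoc]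
  refine ⟨fun f g => ⟨_, hc f g⟩, fun f g l => ?_⟩
  let _ : CommGroup (centralUnits k A) := { mul_comm := centralUnits_mul_comm }
  have key : ∀ p q r s bf bg bl bfg bgl bfgl p₀ q₀ r₀ s₀ : centralUnits k A,
      p₀ * q₀ = s₀ * r₀ → p * q * r⁻¹ * s⁻¹ =
      (q * (bg * bl) * (bgl * q₀)⁻¹) * (s * (bfg * bl) * (bfgl * s₀)⁻¹)⁻¹ *
        (p * (bf * bgl) * (bfgl * p₀)⁻¹) * (r * (bf * bg) * (bfg * r₀)⁻¹)⁻¹ := by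
    intro p q r s bf bg bl bfg bgl bfgl p₀ q₀ r₀ s₀ e
    have e' : p₀⁻¹ * q₀⁻¹ * (r₀ * s₀) = 1 := by
      rw [← mul_inv, e, mul_comm r₀, inv_mul_cancel]
    have e2 : (q * (bg * bl) * (bgl * q₀)⁻¹) * (s * (bfg * bl) * (bfgl * s₀)⁻¹)⁻¹ *
        (p * (bf * bgl) * (bfgl * p₀)⁻¹) * (r * (bf * bg) * (bfg * r₀)⁻¹)⁻¹ =
        p * q * r⁻¹ * s⁻¹ * (p₀⁻¹ * q₀⁻¹ * (r₀ * s₀)) := by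
      apply Additive.ofMul.injective
      simp only [ofMul_mul, ofMul_inv]
      abel
    rw [e2, e', mul_one]
  have := key (a f (g * l)) (a g l) (a f g) (a (f * g) l) (b f) (b g) (b l) (b (f * g)) (b (g * l))
    (b (f * (g * l))) _ _ _ _ (h' f g l)
  simp only [Subgroup.coe_mul, Subgroup.coe_inv, mul_assoc f g l]
  exact this

end ExponentialTwists

/-! ### Classification of invariant twists on the enveloping algebra -/

section EnvTwists

variable {k : Type*} {g : Type*} [Field k] [LieRing g] [LieAlgebra k g]

open Coalgebra (comul counit IsCocomm)

attribute [local instance 100] LieRing.ofAssociativeRing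

local notation "U" => UniversalEnvelopingAlgebra k g

theorem commute_comul_envι₂ {X : g ⊗[k] g} (hX : ∀ x : g, ⁅x, X⁆ = 0) (u : U) :
    Commute (comul (R := k) u) (envι₂ k g X) := by
  have hu : u ∈ Algebra.adjoin k (LinearMap.range (envι k g) : Set U) := by
    rw [adjoin_range_envι]
    trivial
  induction hu using Algebra.adjoin_induction with
  | mem u hu =>
    obtain ⟨x, rfl⟩ := hu
    refine sub_eq_zero.1 ?_
    rw [← envι₂_lie, hX, map_zero]
  | algebraMap c =>
    rw [Bialgebra.comul_algebraMap]
    exact Algebra.commutes c _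
  | add u v _ _ hu hv => rw [map_add]; exact hu.add_left hv
  | mul u v _ _ hu hv => rw [Bialgebra.comul_mul]; exact hu.mul_left hv

theorem isCocycle_envι₂ (X : g ⊗[k] g) : IsCocycle (envι₂ k g X) := by
  rw [IsCocycle]
  induction X with
  | zero => simp
  | add X Y hX hY =>
    simp only [map_add]
    rw [add_add_add_comm, hX, hY, add_add_add_comm]
  | tmul a b =>
    rw [TensorProduct.map_tmul, tensorOne_tmul, comulTensor_tmul, oneTensor_apply,
      tensorComul_tmul, comul_envι, comul_envι, TensorProduct.add_tmul, map_add,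
      TensorProduct.assoc_tmul, TensorProduct.assoc_tmul, TensorProduct.tmul_add]
    abel

theorem envι₂_mem_invCocycles {X : g ⊗[k] g} (hX : X ∈ invariantBivectors k g) :
    envι₂ k g X ∈ invCocycles k U := by
  refine ⟨isCocycle_envι₂ X, commute_comul_envι₂ (mem_invariantBivectors.1 hX).1, ?_, ?_⟩
  · clear hX
    induction X with
    | zero => simp
    | add X Y hX hY => rw [map_add, map_add, hX, hY, add_zero]
    | tmul a b => rw [TensorProduct.map_tmul, counitTensor_tmul, counit_envι, zero_smul]
  · clear hX
    induction X with
    | zero => simp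
    | add X Y hX hY => rw [map_add, map_add, hX, hY, add_zero]
    | tmul a b => rw [TensorProduct.map_tmul, tensorCounit_tmul, counit_envι, zero_smul]

/-- The coefficients of `h X`. -/
def shift (X : InvariantBivectorSeries k g) : ℕ → g ⊗[k] g
  | 0 => 0
  | n + 1 => X n

theorem shift_mem (X : InvariantBivectorSeries k g) (n : ℕ) :
    shift X n ∈ invariantBivectors k g := by
  cases n with
  | zero => exact Submodule.zero_mem _
  | succ n => exact (X n).2

theorem shift_add (X Y : InvariantBivectorSeries k g) (n : ℕ) :
    shift (X + Y) n = shift X n + shift Y n := by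
  cases n with
  | zero => exact (add_zero _).symm
  | succ n => rfl

theorem coeff_hMul (X : InvariantBivectorSeries k g) (n : ℕ) :
    PowerSeries.coeff n (hMul X) = envι₂ k g (shift X n) := by
  cases n with
  | zero => simp [hMul, shift]
  | succ n => rw [hMul, PowerSeries.coeff_succ_X_mul, PowerSeries.coeff_mk, shift]

theorem constantCoeff_hMul (X : InvariantBivectorSeries k g) :
    PowerSeries.constantCoeff (hMul X) = 0 := by
  rw [← PowerSeries.coeff_zero_eq_constantCoeff_apply, coeff_hMul, shift, map_zero]

theorem hMul_add (X Y : InvariantBivectorSeries k g) : hMul (X + Y) = hMul X + hMul Y := by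
  ext n
  rw [map_add, coeff_hMul, coeff_hMul, coeff_hMul, shift_add, map_add]

theorem coeff_hMul_mem (X : InvariantBivectorSeries k g) (n : ℕ) :
    PowerSeries.coeff n (hMul X) ∈ invCocycles k U := by
  rw [coeff_hMul]
  exact envι₂_mem_invCocycles (shift_mem X n)

/-- The invariant twist `exp(hX)`. -/
def bivectorTwist [CharZero k] (X : InvariantBivectorSeries k g) : invariantTwists k U :=
  exphTwist (constantCoeff_hMul X) (coeff_hMul_mem X)

theorem bivectorTwist_val [CharZero k] (X : InvariantBivectorSeries k g) :
    (bivectorTwist X).1.1 = exph k (hMul X) := rfl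

/-- The central series whose coboundary is the commutator of `hX` and `hY`. -/
def cubicSeries (X Y : InvariantBivectorSeries k g) : centralSeries k U :=
  ⟨PowerSeries.mk fun n => ∑ p ∈ Finset.HasAntidiagonal.antidiagonal n,
      cubic k g (shift X p.1) (shift Y p.2), by
    rw [← PowerSeries.coeff_zero_eq_constantCoeff_apply]
    simp [shift], fun n => by
    rw [PowerSeries.coeff_mk]
    exact Submodule.sum_mem _ fun p _ => cubic_mem_centralAug (shift_mem X _) (shift_mem Y _)⟩

theorem cubicSeries_add_left (X X' Y : InvariantBivectorSeries k g) :
    cubicSeries (X + X') Y = cubicSeries X Y + cubicSeries X' Y := by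
  ext n
  simp [cubicSeries, shift_add, Finset.sum_add_distrib]

theorem cubicSeries_add_right (X Y Y' : InvariantBivectorSeries k g) :
    cubicSeries X (Y + Y') = cubicSeries X Y + cubicSeries X Y' := by
  ext n
  simp [cubicSeries, shift_add, Finset.sum_add_distrib]

theorem cobdh_cubicSeries [CharZero k] (X Y : InvariantBivectorSeries k g) :
    cobdh k (cubicSeries X Y).1 = hMul X * hMul Y - hMul Y * hMul X := by
  ext n
  rw [coeff_cobdh, cubicSeries, PowerSeries.coeff_mk, map_sub, PowerSeries.coeff_mul,
    PowerSeries.coeff_mul, ← Finset.Nat.sum_antidiagonal_swap (n := n)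
      (f := fun p => PowerSeries.coeff p.1 (hMul Y) * PowerSeries.coeff p.2 (hMul X)),
    ← Finset.sum_sub_distrib, map_sum]
  refine Finset.sum_congr rfl fun p _ => ?_
  simp only [coeff_hMul, Prod.fst_swap, Prod.snd_swap]
  exact cobd_cubic (shift_mem X _) (shift_mem Y _)

theorem commute_cobdh_hMul {s : PowerSeries U} (hs : s ∈ centralSeries k U)
    (X : InvariantBivectorSeries k g) : Commute (cobdh k s) (hMul X) :=
  commute_cobdh hs fun n => (coeff_hMul_mem X n).2.1

/-- The central element which measures the failure of `X ↦ exp(hX)` to be multiplicative. -/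
def bivectorCochain [CharZero k] (X Y : InvariantBivectorSeries k g) : centralUnits k U :=
  expCentral k U (Multiplicative.ofAdd (-((2 : k)⁻¹ • cubicSeries X Y)))

/-- With `s = cubicSeries X Y`, `[hX, hY] = cobdh s` commutes with `hX` and `hY`, so `exp(hX)
exp(hY) = exp(cobdh s / 2) exp(h(X+Y))`, and the first factor is `∂(exp(s/2))`. -/
theorem bivectorTwist_add [CharZero k] (X Y : InvariantBivectorSeries k g) :
    bivectorTwist (X + Y) =
      boundary k U (bivectorCochain X Y) * bivectorTwist X * bivectorTwist Y := by
  have hs := Submodule.smul_mem _ (2 : k)⁻¹ (cubicSeries X Y).2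
  have key : bivectorTwist X * bivectorTwist Y = boundary k U
      (expCentral k U (Multiplicative.ofAdd ((2 : k)⁻¹ • cubicSeries X Y))) *
        bivectorTwist (X + Y) := by
    refine Subtype.ext (Units.ext ?_)
    change exph k (hMul X) * exph k (hMul Y) = (boundary k U _).1.1 * exph k (hMul (X + Y))
    have hcomm := fun Z => commute_cobdh_hMul (cubicSeries X Y).2 Z
    rw [boundary_expCentral, Submodule.coe_smul,
      ← exph_add (constantCoeff_cobdh hs.1) (constantCoeff_hMul _) (commute_cobdh_hMul hs _),
      exph_mul_exph (constantCoeff_hMul X) (constantCoeff_hMul Y)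
      (by rw [← cobdh_cubicSeries]; exact hcomm X) (by rw [← cobdh_cubicSeries]; exact hcomm Y),
      hMul_add, cobdh_smul, cobdh_cubicSeries, add_comm]
  rw [bivectorCochain, ofAdd_neg, map_inv, map_inv, mul_assoc, key, inv_mul_cancel_left]

/-- A biadditive map is a 2-cocycle, and exponentiation of central series is a homomorphism. -/
theorem bivectorCochain_cocycle [CharZero k] (X Y Z : InvariantBivectorSeries k g) :
    bivectorCochain X (Y + Z) * bivectorCochain Y Z =
      bivectorCochain (X + Y) Z * bivectorCochain X Y := by
  simp only [bivectorCochain, ← map_mul, ← ofAdd_add, cubicSeries_add_left, cubicSeries_add_right]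
  refine congrArg (fun s => expCentral k U (Multiplicative.ofAdd s)) ?_
  generalize cubicSeries X Y = a, cubicSeries X Z = b, cubicSeries Y Z = c
  module

variable (k g) in
/-- The homomorphism that sends `X` to the gauge class of `exp(hX)`. -/
def bivectorClass [CharZero k] :
    Multiplicative (InvariantBivectorSeries k g) →* GaugeClasses k U :=
  MonoidHom.mk' (fun X => (bivectorTwist X.toAdd : GaugeClasses k U)) fun X Y => by
    rw [toAdd_mul, bivectorTwist_add, mul_assoc, gaugeClass_boundary_mul, QuotientGroup.mk_mul]

theorem extendh_comm_hMul (X : InvariantBivectorSeries k g) :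
    extendh (Algebra.TensorProduct.comm k U U).toAlgHom (hMul X) = -hMul X := by
  ext n
  rw [PowerSeries.coeff_map, map_neg, coeff_hMul]
  change TensorProduct.comm k U U (envι₂ k g (shift X n)) = _
  rw [envι₂_comm, (mem_invariantBivectors.1 (shift_mem X n)).2, map_neg]

/-- If `exp(hX)` is a boundary it is fixed by the flip, which also sends it to `exp(-hX)`; hence `hX
= -hX`. -/
theorem bivectorClass_injective [CharZero k] : Function.Injective (bivectorClass k g) := by
  rw [injective_iff_map_eq_one]
  intro X hX
  obtain ⟨c, hc⟩ := (QuotientGroup.eq_one_iff (bivectorTwist X.toAdd)).1 hX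
  have h1 := extendh_comm_boundary c
  rw [hc, bivectorTwist_val, map_exph, extendh_comm_hMul] at h1
  have h2 := exph_injective (by rw [map_neg, constantCoeff_hMul, neg_zero])
    (constantCoeff_hMul _) h1
  refine Multiplicative.toAdd.injective (funext fun n => Subtype.ext ?_)
  refine envι₂_injective k g ?_
  have h3 := congrArg (PowerSeries.coeff (n + 1)) h2
  rw [map_neg, coeff_hMul] at h3
  have h4 : (2 : k) • envι₂ k g (shift X.toAdd (n + 1)) = 0 := by
    rw [two_smul]
    nth_rw 1 [← h3]
    exact neg_add_cancel _
  exact ((smul_eq_zero.1 h4).resolve_left two_ne_zero).trans (map_zero _).symm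

/-- The constant term is invertible in `U ⊗ U`, hence a scalar, and the counit normalisation fixes
it. -/
theorem constantCoeff_eq_one [CharZero k] {F : (PowerSeries (U ⊗[k] U))ˣ}
    (hF : IsInvariantTwist k F) : PowerSeries.constantCoeff F.1 = 1 := by
  have h1 : PowerSeries.constantCoeff F.1 * PowerSeries.constantCoeff (F⁻¹).1 = 1 := by
    rw [← map_mul, Units.mul_inv, map_one]
  obtain ⟨c, hc⟩ := (primGen_env k g).tensor.exists_smul_one_of_mul_eq_one h1
  have h2 := congrArg PowerSeries.constantCoeff hF.counit_left
  rw [constantCoeff_extendh, ← hc, map_smul, map_one, map_one] at h2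
  have h3 := congrArg (counit (R := k)) h2
  rw [map_smul, Bialgebra.counit_one, smul_eq_mul, mul_one] at h3
  rw [← hc, h3, one_smul]

/-- Each coefficient of the logarithm is an invariant bivector plus the coboundary of a central
element. The two resulting series commute, so the twist is a boundary times `exp(hX)`. -/
theorem bivectorClass_surjective [CharZero k] : Function.Surjective (bivectorClass k g) := by
  intro f
  obtain ⟨F, rfl⟩ := QuotientGroup.mk_surjective f
  obtain ⟨Y, hY0, hY⟩ := exists_exph_eq (k := k) (constantCoeff_eq_one F.2)
  have hmem := coeff_mem_invCocycles F.2 hY0 hY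
  have hdec : ∀ n, ∃ X : invariantBivectors k g, ∃ a : centralAug k U,
      envι₂ k g X.1 + cobd k a.1 = PowerSeries.coeff (n + 1) Y := by
    intro n
    obtain ⟨h1, h2, h3, h4⟩ := hmem (n + 1)
    obtain ⟨X, hX, a, ha, e⟩ := exists_envι₂_add_cobd_eq h1 h2 h3 h4
    exact ⟨⟨X, hX⟩, ⟨a, ha⟩, e⟩
  choose X a hXa using hdec
  let s : centralSeries k U := ⟨PowerSeries.X * PowerSeries.mk fun n => (a n).1, by simp, by
    rintro (_ | n)
    · simp
    · rw [PowerSeries.coeff_succ_X_mul, PowerSeries.coeff_mk]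
      exact (a n).2⟩
  have hYs : Y = cobdh k s.1 + hMul X := by
    ext n
    rw [map_add, coeff_cobdh, coeff_hMul]
    cases n with
    | zero => simp [hY0, s, shift]
    | succ n =>
      rw [← hXa, PowerSeries.coeff_succ_X_mul, PowerSeries.coeff_mk, shift, add_comm]
  have hF : F = boundary k U (expCentral k U (Multiplicative.ofAdd s)) * bivectorTwist X := by
    refine Subtype.ext (Units.ext ?_)
    change F.1.1 = (boundary k U _).1.1 * exph k (hMul X)
    rw [boundary_expCentral, ← exph_add (constantCoeff_cobdh s.2.1) (constantCoeff_hMul X)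
      (commute_cobdh_hMul s.2 X), ← hYs, hY]
  refine ⟨Multiplicative.ofAdd X, ?_⟩
  rw [hF, gaugeClass_boundary_mul]
  rfl

variable (k g) in
/-- The isomorphism from `(Λ²g)^g[[h]]` to the group of gauge classes. -/
def bivectorEquiv [CharZero k] :
    Multiplicative (InvariantBivectorSeries k g) ≃* GaugeClasses k U :=
  MulEquiv.ofBijective (bivectorClass k g) ⟨bivectorClass_injective, bivectorClass_surjective⟩

variable (k g) in
-- With the section `exp(hX)` the correction `bivectorCochain` is a strict 2-cocycle, so the
-- associator cochain is identically 1.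
theorem associatorTrivial_env [CharZero k] : AssociatorTrivial k U := by
  let e := bivectorEquiv k g
  refine associatorTrivial_of_choice (σ₀ := fun f => bivectorTwist (e.symm f).toAdd)
    (a₀ := fun f f' => bivectorCochain (e.symm f).toAdd (e.symm f').toAdd) ⟨?_, ?_⟩ ?_
  · exact fun f => e.apply_symm_apply f
  · intro f f'
    rw [map_mul, toAdd_mul, bivectorTwist_add]
  · intro f f' l
    rw [map_mul e.symm, map_mul e.symm, toAdd_mul, toAdd_mul, bivectorCochain_cocycle]

end EnvTwists

end InvTwist

end

theorem mainTheorem2 {k g : Type*} [Field k] [IsAlgClosed k] [CharZero k]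
    [LieRing g] [LieAlgebra k g] :
    (∃ e : Multiplicative (InvTwist.InvariantBivectorSeries k g) ≃*
        InvTwist.GaugeClasses k (UniversalEnvelopingAlgebra k g),
      ∀ X : InvTwist.InvariantBivectorSeries k g,
        ∃ F : InvTwist.invariantTwists k (UniversalEnvelopingAlgebra k g),
          ((F : (PowerSeries (UniversalEnvelopingAlgebra k g ⊗[k]
              UniversalEnvelopingAlgebra k g))ˣ) :
            PowerSeries (UniversalEnvelopingAlgebra k g ⊗[k] UniversalEnvelopingAlgebra k g)) =
              InvTwist.exph k (InvTwist.hMul X) ∧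
          e (Multiplicative.ofAdd X) =
            (F : InvTwist.GaugeClasses k (UniversalEnvelopingAlgebra k g))) ∧
    InvTwist.AssociatorTrivial k (UniversalEnvelopingAlgebra k g) :=
  ⟨⟨InvTwist.bivectorEquiv k g, fun X => ⟨InvTwist.bivectorTwist X, rfl, rfl⟩⟩,
    InvTwist.associatorTrivial_env k g⟩
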